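/- Let $N\ge 2$ and $\alpha\in(0,2]$. Let $W$ be either the real vector space $\mathrm{Herm}(N)$ of $N\times N$ Hermitian matrices or its subspace $\mathrm{Herm}_0(N)$ of traceless matrices, with Lebesgue measure $dX$ and Borel $\sigma$-algebra $\sigma(W)$. Put $\nu_\alpha(u)=|u|^\alpha\bigl(1-i\,\mathrm{sgn}(u)\tan\frac{\pi\alpha}{2}\bigr)$ for $\alpha\neq1$ and $\nu_1(u)=|u|\bigl(1+\frac{2i}{\pi}\mathrm{sgn}(u)\log|u|\bigr)$, with $\nu_\alpha(0)=0$. Let $H$ be a Borel probability measure on the unit sphere $\{R\in W:\mathrm{tr}\,R^2=1\}$ which is invariant under $R\mapsto VRV^\dagger$ for all $V\in U(N)$ and whose support spans $W$, and let $H_{\rm eig}$ be its eigenvalue part, i.e. the permutation-invariant law on the unit sphere of $\mathbb R^N$ of the eigenvalues, listed in uniformly random order, of an $H$-distributed matrix; put $t_0=\frac1N\int (r_1+\dots+r_N)\,H_{\rm eig}(dr)$. Let $\widetilde X_1,\widetilde X_2,\dots$ be i.i.d. random vectors in $\mathbb R^N$ with law $S(\alpha,H_{\rm eig},0)$, that is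 $\mathbb E\,e^{i\xi^\top \widetilde X_j}=\exp\bigl(-\int \nu_\alpha(r^\top\xi)\,H_{\rm eig}(dr)\bigr)$ for $\xi\in\mathbb R^N$; let $U_1,U_2,\dots$ be i.i.d. Haar distributed in $U(N)$, with all $\widetilde X_j$ and $U_j$ independent; and let $Y$ be a random Hermitian matrix with law $S(\alpha,H,0)$, that is $\mathbb E\,e^{i\,\mathrm{tr}\,SY}=\exp\bigl(-\int\nu_\alpha(\mathrm{tr}\,RS)\,H(dR)\bigr)$ for $S\in\mathrm{Herm}(N)$. For $m\ge1$ set $$Y_m=\frac{1}{m^{1/\alpha}}\sum_{j=1}^m U_j\,\mathrm{diag}(\widetilde X_j)\,U_j^\dagger-\frac{2t_0\log m}{\pi}\,I_N\,\mathbf 1_{\alpha=1}.$$ Then $Y_m$ (for every $m\ge1$) and $Y$ have probability densities $p_m$ and $p_\infty$ on $W$, and the total variation distance satisfies $$\sup_{A\in\sigma(W)}\left|\int_A p_m(X)\,dX-\int_A p_\infty(X)\,dX\right|=\frac12\int_W|p_m(X)-p_\infty(X)|\,dX=O\bigl(m^{-\alpha/(N^2+\alpha)}\bigr)\qquad(m\to\infty).$$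 -/

import Mathlib

open MeasureTheory ProbabilityTheory Filter
open scoped Matrix ENNReal

noncomputable section

namespace StableEnsemble

/-- Complex matrices carry the product (equivalently the Borel) sigma-algebra. -/
instance instMeasurableSpaceMatrix (N : ℕ) : MeasurableSpace (Matrix (Fin N) (Fin N) ℂ) :=
  inferInstanceAs (MeasurableSpace (Fin N → Fin N → ℂ))

instance instBorelSpaceMatrix (N : ℕ) : BorelSpace (Matrix (Fin N) (Fin N) ℂ) :=
  inferInstanceAs (BorelSpace (Fin N → Fin N → ℂ))

/-- The real vector space of `N × N` Hermitian matrices. -/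
abbrev Herm (N : ℕ) : Type := selfAdjoint (Matrix (Fin N) (Fin N) ℂ)

theorem isHermitian {N : ℕ} (R : Herm N) : (R : Matrix (Fin N) (Fin N) ℂ).IsHermitian :=
  selfAdjoint.mem_iff.mp R.2

/-- The unitary group `U(N)`. -/
abbrev UGroup (N : ℕ) : Type := Matrix.unitaryGroup (Fin N) ℂ

/-- The (real) trace of a Hermitian matrix, as a linear form. -/
def trForm (N : ℕ) : Herm N →ₗ[ℝ] ℝ where
  toFun R := (R : Matrix (Fin N) (Fin N) ℂ).trace.re
  map_add' R S := by simp [Matrix.trace_add]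
  map_smul' c R := by simp [Matrix.trace_smul]

/-- The subspace of traceless Hermitian matrices. -/
def Herm₀ (N : ℕ) : Submodule ℝ (Herm N) := LinearMap.ker (trForm N)

/-- The Euclidean pairing `tr (R S)` of Hermitian matrices (a real number). -/
def trPair {N : ℕ} (R S : Herm N) : ℝ :=
  ((R : Matrix (Fin N) (Fin N) ℂ) * (S : Matrix (Fin N) (Fin N) ℂ)).trace.re

/-- The conjugate action `R ↦ U R U†` of the unitary group. -/
def conj {N : ℕ} (U : UGroup N) (R : Herm N) : Herm N :=
  ⟨(U : Matrix (Fin N) (Fin N) ℂ) * (R : Matrix (Fin N) (Fin N) ℂ) *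
      (U : Matrix (Fin N) (Fin N) ℂ)ᴴ,
    selfAdjoint.mem_iff.mpr (Matrix.isHermitian_mul_mul_conjTranspose _ (isHermitian R))⟩

/-- The real diagonal matrix with prescribed diagonal. -/
def diagMat {N : ℕ} (r : Fin N → ℝ) : Herm N :=
  ⟨Matrix.diagonal fun i => (r i : ℂ), selfAdjoint.mem_iff.mpr
    (Matrix.isHermitian_diagonal_of_self_adjoint _ (by ext i; simp))⟩

/-- The function `ν_α` in the exponent of a stable characteristic function. -/
def nu (α u : ℝ) : ℂ :=
  if α = 1 then
    (|u| : ℝ) * (1 + 2 * Complex.I / Real.pi * (Real.sign u : ℂ) * (Real.log |u| : ℂ))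
  else
    ((|u| ^ α : ℝ) : ℂ) * (1 - Complex.I * (Real.sign u : ℂ) * (Real.tan (Real.pi * α / 2) : ℂ))

/-- `μ` is the stable law `S(α, H, 0)` (scale `1`, shift `0`) on a space with real pairing `pair`:
its characteristic function at `S` is `exp (- ∫ ν_α (pair R S) H(dR))`. -/
def IsStableLaw {E : Type*} [MeasurableSpace E] (pair : E → E → ℝ) (α : ℝ)
    (H μ : Measure E) : Prop :=
  IsProbabilityMeasure μ ∧
    ∀ S : E, ∫ X, Complex.exp (Complex.I * (pair S X : ℂ)) ∂μ
      = Complex.exp (-∫ R, nu α (pair R S) ∂H)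

/-- `H` is a unitarily invariant spectral measure on the unit sphere of `W` (a Borel probability
measure, regarded as a measure on `Herm N` carried by that sphere), whose support spans `W`. -/
structure IsSpectralMeasure {N : ℕ} (W : Submodule ℝ (Herm N)) (H : Measure (Herm N)) : Prop where
  isProbabilityMeasure : IsProbabilityMeasure H
  sphere : ∀ᵐ R ∂H, R ∈ W ∧ trPair R R = 1
  invariant : ∀ U : UGroup N, H.map (conj U) = H
  span_support : Submodule.span ℝ H.support = W

/-- The eigenvalue part `H_eig` of `H`: the law on `ℝ^N` of the eigenvalues (with multiplicity) of
an `H`-distributed matrix, listed in uniformly random order, so that it is permutation invariant. -/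
def eigPart {N : ℕ} (H : Measure (Herm N)) : Measure (Fin N → ℝ) :=
  ∑ σ : Equiv.Perm (Fin N), ((N.factorial : ℝ≥0∞)⁻¹) •
    H.map fun R i => (isHermitian R).eigenvalues (σ i)

/-- `t₀ = N⁻¹ ∫ (r₁ + ⋯ + r_N) H_eig(dr)`. -/
def tZero {N : ℕ} (Heig : Measure (Fin N → ℝ)) : ℝ :=
  (1 / (N : ℝ)) * ∫ r, ∑ i, r i ∂Heig

/-- The standardised sum
`m^{-1/α} ∑_j U_j diag(X_j) U_j† - (2 t₀ log m / π) 1_{α = 1} I_N` of `m` summands. -/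
def stdSum {N : ℕ} {Ω : Type*} (α t₀ : ℝ) (X : ℕ → Ω → Fin N → ℝ) (U : ℕ → Ω → UGroup N)
    (m : ℕ) (ω : Ω) : Herm N :=
  ((m : ℝ) ^ (-1 / α)) • (∑ j ∈ Finset.range m, conj (U j ω) (diagMat (X j ω)))
    - (if α = 1 then 2 * t₀ * Real.log m / Real.pi else 0) • (1 : Herm N)

/-- `p` is a probability density of the law `μ` on `W` with respect to the Lebesgue measure `vol`
of `W`; in particular `μ` is carried by `W`. -/
def IsDensity {N : ℕ} {W : Submodule ℝ (Herm N)} (vol : Measure W) (μ : Measure (Herm N))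
    (p : W → ℝ) : Prop :=
  Measurable p ∧ (∀ X, 0 ≤ p X) ∧
    μ = (vol.withDensity fun X => ENNReal.ofReal (p X)).map Subtype.val

/-- Total variation distance `sup_A |∫_A p - ∫_A q|` over the Borel sets `A` of `W`. -/
def tvDist {N : ℕ} {W : Submodule ℝ (Herm N)} (vol : Measure W) (p q : W → ℝ) : ℝ :=
  ⨆ A : {A : Set W // MeasurableSet A}, |(∫ X in A.1, p X ∂vol) - ∫ X in A.1, q X ∂vol|

end StableEnsemble

end

/-!
Both laws are compared through their characteristic functions on `W`, with `W` regarded as a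
Euclidean space with inner product `tr (R S)`.

Let `G` be the exponent of the stable law of the eigenvalue part, read on the diagonal of a matrix.
A single summand `U diag(X) U†` has characteristic function `ψ(S) = E exp (-G(U† S U))`
(`haarChar`), while unitary invariance of `H` gives `Φ(S) = exp (-E G(U† S U))` for the limit
(`integral_eigExponent_conj`). Both exponents are homogeneous of degree `α` up to the same phase,
which the logarithmic centring removes, so that the difference of the characteristic functions of
`Y_m` and `Y` has the modulus of `ψ(s)^m - Φ(s)^m` with `s = m^{-1/α} S`
(`norm_charFun_stdSum_sub`). As `ψ` and `Φ` differ only by the place of the average, they agree up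
to `O(‖s‖^{2α})` near zero (`exists_norm_haarChar_sub_le`). Away from zero both are bounded away
from one, and `ψ` decays at least like `‖s‖^{-1/2}` (`exists_norm_haarChar_le_rpow`): the real part
of `G` controls the diagonal, by Birkhoff's theorem and the spanning condition on `H`, and a matrix
of norm one has a small diagonal only in few bases (`exists_measureReal_small_diag_le`). This last
fact comes from rotations in coordinate planes, which turn a large off-diagonal entry into a large
diagonal one. Altogether the characteristic functions are within `O(1/m)` in `L¹(W)`
(`exists_integral_norm_pow_sub_pow_le`), hence the densities are within `O(1/m)` uniformly
(`abs_density_sub_le`). Since the limit has tails `O(R^{-α})` (`exists_tail_le`), the total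
variation distance is at most a multiple of `R^{N²}/m + R^{-α}`, and `R = m^{1/(N²+α)}` gives the
rate.

For the limit, and for `diag(X)` on the diagonal matrices of `W`, a density exists because the
characteristic function is integrable (`absolutelyContinuous_of_integrable_charFun`). For small `m`
the characteristic function of `Y_m` need not be integrable. Instead, a conjugation-invariant null
set of `W` meets the diagonal matrices in a null set, since `D + O ↦ e^{iO} D e^{-iO}` is a local
diffeomorphism near a diagonal matrix with distinct entries (`exists_hasStrictFDerivAt_rotDiag`,
`ae_diagSub_notMem`). So a single summand is absolutely continuous (`map_summand_eq_zero`), and a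
sum with an independent absolutely continuous summand is absolutely continuous.
-/

noncomputable section

namespace StableEnsemble

open scoped FourierTransform Topology

/-! ### Measures and their characteristic functions -/

section Fourier

variable {E : Type*} [NormedAddCommGroup E] [InnerProductSpace ℝ E] [FiniteDimensional ℝ E]
  [MeasurableSpace E] [BorelSpace E]

/-- A Schwartz function is integrated against a finite measure by pairing its inverse Fourier
transform with the characteristic function. -/
theorem integral_schwartz_eq_charFun (μ : Measure E) [IsFiniteMeasure μ] (f : SchwartzMap E ℂ) :
    ∫ x, f x ∂μ = ∫ x, (𝓕⁻ f : SchwartzMap E ℂ) x * charFun μ (-(2 * Real.pi) • x) := by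
  have h := VectorFourier.integral_fourierIntegral_smul_eq_flip (L := innerₗ E) (μ := volume)
    (ν := μ) (f := (𝓕⁻ f : SchwartzMap E ℂ)) (g := fun _ => (1 : ℂ))
    Real.continuous_fourierChar continuous_inner (SchwartzMap.integrable _) (integrable_const _)
  have e1 : ∀ ξ, VectorFourier.fourierIntegral Real.fourierChar volume (innerₗ E)
      (𝓕⁻ f : SchwartzMap E ℂ) ξ = f ξ := fun ξ => by
    have : 𝓕 ((𝓕⁻ f : SchwartzMap E ℂ) : E → ℂ) ξ = f ξ := by
      rw [← SchwartzMap.fourier_coe]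
      simp
    exact this
  simp only [e1, smul_eq_mul, mul_one] at h
  rw [h]
  congr 1
  ext x
  congr 1
  rw [charFun_eq_fourierIntegral' , smul_smul, neg_mul_neg, inv_mul_cancel₀ (by positivity),
    one_smul, flip_innerₗ]
  rfl

/-- The inverse Fourier transform of the difference of two characteristic functions. -/
def charFunDiffInv (μ ν : Measure E) : E → ℂ :=
  𝓕⁻ (fun x : E => charFun μ (-(2 * Real.pi) • x) - charFun ν (-(2 * Real.pi) • x))

variable {μ ν : Measure E}

theorem integrable_charFun_diff_smul (h : Integrable (fun x => charFun μ x - charFun ν x)) :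
    Integrable (fun x : E => charFun μ (-(2 * Real.pi) • x) - charFun ν (-(2 * Real.pi) • x)) :=
  (integrable_comp_smul_iff volume (fun x => charFun μ x - charFun ν x)
    (by simp [Real.pi_ne_zero])).2 h

/-- Tested against Schwartz functions, the difference of two finite measures whose characteristic
functions have integrable difference is the function `charFunDiffInv`. -/
theorem integral_sub_integral_eq_charFunDiffInv [IsFiniteMeasure μ] [IsFiniteMeasure ν]
    (h : Integrable (fun x => charFun μ x - charFun ν x)) (f : SchwartzMap E ℂ) :
    ∫ x, f x ∂μ - ∫ x, f x ∂ν = ∫ x, f x * charFunDiffInv μ ν x := by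
  have hi := integrable_charFun_diff_smul h
  have key : ∀ ρ : Measure E, IsFiniteMeasure ρ → Integrable (fun x =>
      (𝓕⁻ f : SchwartzMap E ℂ) x * charFun ρ (-(2 * Real.pi) • x)) := fun ρ _ => by
    refine (SchwartzMap.integrable (𝓕⁻ f)).mul_bdd (c := ρ.real Set.univ) ?_ ?_
    · exact (measurable_charFun.comp (measurable_const_smul _)).aestronglyMeasurable
    · exact Eventually.of_forall fun x => norm_charFun_le _
  rw [integral_schwartz_eq_charFun, integral_schwartz_eq_charFun,
    ← integral_sub (key μ inferInstance) (key ν inferInstance)]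
  have h2 := VectorFourier.integral_fourierIntegral_smul_eq_flip (L := -innerₗ E) (μ := volume)
    (ν := volume) (f := f) (g := fun x : E => charFun μ (-(2 * Real.pi) • x) -
      charFun ν (-(2 * Real.pi) • x))
    Real.continuous_fourierChar continuous_inner.neg f.integrable hi
  have e1 : ∀ ξ, VectorFourier.fourierIntegral Real.fourierChar volume (-innerₗ E) f ξ
      = (𝓕⁻ f : SchwartzMap E ℂ) ξ := fun ξ => by
    rw [SchwartzMap.fourierInv_coe]; rfl
  have e2 : (-innerₗ E).flip = -innerₗ E := by
    ext x y
    simp [real_inner_comm]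
  simp only [e1, e2, smul_eq_mul, mul_sub] at h2
  rw [h2]
  rfl

theorem norm_charFunDiffInv_le (x : E) :
    ‖charFunDiffInv μ ν x‖ ≤ ∫ x : E,
      ‖charFun μ (-(2 * Real.pi) • x) - charFun ν (-(2 * Real.pi) • x)‖ :=
  VectorFourier.norm_fourierIntegral_le_integral_norm _ _ _ _ _

theorem integral_norm_charFun_diff_smul :
    ∫ x : E, ‖charFun μ (-(2 * Real.pi) • x) - charFun ν (-(2 * Real.pi) • x)‖
      = (2 * Real.pi)⁻¹ ^ Module.finrank ℝ E * ∫ x : E, ‖charFun μ x - charFun ν x‖ := by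
  rw [Measure.integral_comp_smul volume (fun x : E => ‖charFun μ x - charFun ν x‖)]
  have : |((-(2 * Real.pi)) ^ Module.finrank ℝ E)⁻¹| = (2 * Real.pi)⁻¹ ^ Module.finrank ℝ E := by
    rw [abs_inv, abs_pow, abs_neg, abs_of_pos (by positivity), inv_pow]
  rw [this, smul_eq_mul]

theorem continuous_charFunDiffInv (h : Integrable (fun x => charFun μ x - charFun ν x)) :
    Continuous (charFunDiffInv μ ν) :=
  VectorFourier.fourierIntegral_continuous Real.continuous_fourierChar
    (continuous_inner.neg) (integrable_charFun_diff_smul h)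

/-- A measure with integrable characteristic function charges no Lebesgue null set: tested against
smooth functions it is bounded by a multiple of Lebesgue measure. -/
theorem absolutelyContinuous_of_integrable_charFun [IsFiniteMeasure μ]
    (h : Integrable (charFun μ)) : μ ≪ volume := by
  have h0 : Integrable (fun x => charFun μ x - charFun (0 : Measure E) x) := by simpa using h
  set C : ℝ := ∫ x : E,
      ‖charFun μ (-(2 * Real.pi) • x) - charFun (0 : Measure E) (-(2 * Real.pi) • x)‖ with hC
  have hC0 : 0 ≤ C := integral_nonneg fun _ => norm_nonneg _
  have main : ∀ K V : Set E, IsCompact K → IsOpen V → Bornology.IsBounded V → K ⊆ V →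
      μ.real K ≤ C * volume.real V := by
    intro K V hK hV hVb hKV
    obtain ⟨f, hfs, hfc, hfr⟩ := hV.exists_contDiff_support_eq (n := ⊤)
    -- a smooth function that equals one on `K` and vanishes off `V`
    obtain ⟨δ, hδ, hKδ⟩ : ∃ δ > 0, ∀ x ∈ K, δ ≤ f x := by
      rcases K.eq_empty_or_nonempty with rfl | hne
      · exact ⟨1, one_pos, by simp⟩
      obtain ⟨x0, hx0, hmin⟩ := hK.exists_isMinOn hne hfc.continuous.continuousOn
      refine ⟨f x0, ?_, fun x hx => hmin hx⟩
      have : x0 ∈ Function.support f := hfs ▸ hKV hx0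
      exact lt_of_le_of_ne (hfr ⟨x0, rfl⟩).1 (Ne.symm this)
    set u : E → ℝ := fun x => Real.smoothTransition (f x / δ) with hu
    have huc : ContDiff ℝ (⊤ : ℕ∞) u := by
      exact Real.smoothTransition.contDiff.comp (hfc.div_const δ)
    have hu1 : ∀ x ∈ K, u x = 1 := fun x hx =>
      Real.smoothTransition.one_of_one_le ((one_le_div hδ).2 (hKδ x hx))
    have hu0 : ∀ x, x ∉ V → u x = 0 := fun x hx => by
      have : f x = 0 := by
        by_contra hne
        exact hx (hfs ▸ (show x ∈ Function.support f from hne))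
      simp [hu, this, Real.smoothTransition.zero]
    have hsupp : HasCompactSupport (fun x => (u x : ℂ)) := by
      refine HasCompactSupport.of_support_subset_isCompact hVb.isCompact_closure ?_
      intro x hx
      by_contra hn
      exact hx (by simp [hu0 x fun hxV => hn (subset_closure hxV)])
    have hcd : ContDiff ℝ (⊤ : ℕ∞) (fun x => (u x : ℂ)) := Complex.ofRealCLM.contDiff.comp huc
    have hkey := integral_sub_integral_eq_charFunDiffInv h0 (hsupp.toSchwartzMap hcd)
    simp only [HasCompactSupport.toSchwartzMap_toFun, integral_zero_measure, sub_zero] at hkey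
    have hl : μ.real K ≤ ‖∫ x, (u x : ℂ) ∂μ‖ := by
      rw [integral_complex_ofReal, Complex.norm_real]
      refine le_trans ?_ (le_abs_self _)
      have hint : Integrable u μ := by
        refine Integrable.of_bound huc.continuous.aestronglyMeasurable 1 (ae_of_all _ fun x => ?_)
        rw [Real.norm_of_nonneg (Real.smoothTransition.nonneg _)]
        exact Real.smoothTransition.le_one _
      calc μ.real K = ∫ x, K.indicator 1 x ∂μ := by
            rw [integral_indicator_one hK.measurableSet]
        _ ≤ ∫ x, u x ∂μ := by
            refine integral_mono ((integrable_const (1:ℝ)).indicator hK.measurableSet) hint ?_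
            intro x
            by_cases hx : x ∈ K
            · simp [hx, hu1 x hx]
            · simp [hx, hu, Real.smoothTransition.nonneg]
    have hr : ‖∫ x, (u x : ℂ) * charFunDiffInv μ 0 x‖ ≤ C * volume.real V := by
      rw [← setIntegral_eq_integral_of_forall_compl_eq_zero (s := V)
        (fun x hx => by simp [hu0 x hx])]
      refine norm_setIntegral_le_of_norm_le_const hVb.measure_lt_top fun x _ => ?_
      rw [norm_mul, Complex.norm_real, Real.norm_of_nonneg (Real.smoothTransition.nonneg _)]
      calc _ ≤ 1 * C := mul_le_mul (Real.smoothTransition.le_one _) (norm_charFunDiffInv_le x)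
            (norm_nonneg _) zero_le_one
        _ = C := one_mul _
    exact hl.trans (hkey ▸ hr)
  refine Measure.AbsolutelyContinuous.mk fun A hA hA0 => ?_
  rw [hA.measure_eq_iSup_isCompact]
  simp only [ENNReal.iSup_eq_zero]
  intro K hKA hK
  have hK0 : volume K = 0 := measure_mono_null hKA hA0
  obtain ⟨R, hR⟩ := hK.isBounded.subset_ball (0 : E)
  have hle : ∀ ε : ℝ, 0 < ε → μ.real K ≤ C * ε := fun ε hε => by
    obtain ⟨V, hKV, hVo, hVε⟩ := K.exists_isOpen_lt_of_lt (μ := volume) (ENNReal.ofReal ε)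
      (by rw [hK0]; simpa using hε)
    refine (main K (V ∩ Metric.ball 0 R) hK (hVo.inter Metric.isOpen_ball)
      (Metric.isBounded_ball.subset Set.inter_subset_right) (Set.subset_inter hKV hR)).trans ?_
    refine mul_le_mul_of_nonneg_left ?_ hC0
    refine ENNReal.toReal_le_of_le_ofReal hε.le ?_
    exact (measure_mono Set.inter_subset_left).trans hVε.le
  have : μ.real K ≤ 0 := by
    refine le_of_forall_pos_le_add fun ε hε => ?_
    have := hle (ε / (C + 1)) (by positivity)
    have h3 : C * (ε / (C + 1)) ≤ ε := by
      rw [mul_div_assoc', div_le_iff₀ (by positivity)]; nlinarith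
    linarith
  exact (measureReal_eq_zero_iff).1 (le_antisymm this measureReal_nonneg)

/-- Densities of two finite measures with close characteristic functions are uniformly close. -/
theorem abs_density_sub_le [IsFiniteMeasure μ] [IsFiniteMeasure ν] {p q : E → ℝ}
    (hp : Measurable p) (hq : Measurable q) (hp0 : ∀ x, 0 ≤ p x) (hq0 : ∀ x, 0 ≤ q x)
    (hμ : μ = volume.withDensity fun x => ENNReal.ofReal (p x))
    (hν : ν = volume.withDensity fun x => ENNReal.ofReal (q x))
    (h : Integrable (fun x => charFun μ x - charFun ν x)) :
    ∀ᵐ x, |p x - q x| ≤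
      (2 * Real.pi)⁻¹ ^ Module.finrank ℝ E * ∫ x : E, ‖charFun μ x - charFun ν x‖ := by
  have hint : ∀ (ρ : Measure E) (r : E → ℝ), IsFiniteMeasure ρ → Measurable r → (∀ x, 0 ≤ r x) →
      ρ = volume.withDensity (fun x => ENNReal.ofReal (r x)) → Integrable r := by
    intro ρ r hρ hr hr0 he
    refine ⟨hr.aestronglyMeasurable, ?_⟩
    rw [hasFiniteIntegral_iff_ofReal (ae_of_all _ hr0)]
    have : ρ Set.univ < ⊤ := measure_lt_top _ _
    rwa [he, withDensity_apply _ MeasurableSet.univ, Measure.restrict_univ] at this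
  have hwd : ∀ (r : E → ℝ) (f : E → ℂ), Measurable r → (∀ x, 0 ≤ r x) →
      ∫ x, f x ∂(volume.withDensity fun x => ENNReal.ofReal (r x)) = ∫ x, (r x : ℂ) * f x := by
    intro r f hr hr0
    rw [integral_withDensity_eq_integral_toReal_smul hr.ennreal_ofReal (by simp)]
    refine integral_congr_ae (ae_of_all _ fun x => ?_)
    simp [ENNReal.toReal_ofReal (hr0 x)]
  have hpi := hint μ p inferInstance hp hp0 hμ
  have hqi := hint ν q inferInstance hq hq0 hν
  have hae : ∀ᵐ x, ((p x - q x : ℝ) : ℂ) = charFunDiffInv μ ν x := by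
    have hl1 : Integrable (fun x => ((p x - q x : ℝ) : ℂ)) := (hpi.sub hqi).ofReal
    refine ae_eq_of_integral_contDiff_smul_eq hl1.locallyIntegrable
      (continuous_charFunDiffInv h).locallyIntegrable ?_
    intro g hg hgs
    have hsupp : HasCompactSupport (fun x => (g x : ℂ)) :=
      hgs.comp_left (g := fun t : ℝ => (t : ℂ)) Complex.ofReal_zero
    have hcd : ContDiff ℝ (⊤ : ℕ∞) (fun x => (g x : ℂ)) :=
      Complex.ofRealCLM.contDiff.comp hg
    have hkey := integral_sub_integral_eq_charFunDiffInv h (hsupp.toSchwartzMap hcd)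
    have hb : ∀ r : E → ℝ, Integrable r → Integrable (fun x => (r x : ℂ) * (g x : ℂ)) := by
      intro r hr
      obtain ⟨B, hB⟩ := hgs.exists_bound_of_continuous hg.continuous
      exact hr.ofReal.mul_bdd (c := B) hcd.continuous.aestronglyMeasurable
        (ae_of_all _ fun x => by simpa using hB x)
    simp only [HasCompactSupport.toSchwartzMap_toFun] at hkey
    have eμ : ∫ x, (g x : ℂ) ∂μ = ∫ x, (p x : ℂ) * g x := by rw [hμ, hwd p _ hp hp0]
    have eν : ∫ x, (g x : ℂ) ∂ν = ∫ x, (q x : ℂ) * g x := by rw [hν, hwd q _ hq hq0]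
    rw [eμ, eν, ← integral_sub (hb p hpi) (hb q hqi)] at hkey
    simp only [Complex.real_smul]
    rw [← hkey]
    congr 1
    ext x
    push_cast
    ring
  filter_upwards [hae] with x hx
  rw [← integral_norm_charFun_diff_smul, ← Real.norm_eq_abs, ← Complex.norm_real, hx]
  exact norm_charFunDiffInv_le x

end Fourier

/-! ### Total variation distance of two densities -/

section TotalVariation

variable {E : Type*} [MeasurableSpace E] {vol : Measure E} {p q : E → ℝ}

/-- Scheffé's identity: for densities of equal mass the supremum is attained at `{q ≤ p}`. -/
theorem iSup_abs_setIntegral_sub_eq (hp : Measurable p) (hq : Measurable q)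
    (hpi : Integrable p vol) (hqi : Integrable q vol) (h : ∫ x, p x ∂vol = ∫ x, q x ∂vol) :
    (⨆ A : {A : Set E // MeasurableSet A}, |(∫ x in A.1, p x ∂vol) - ∫ x in A.1, q x ∂vol|)
      = 1 / 2 * ∫ x, |p x - q x| ∂vol := by
  have hi : Integrable (fun x => p x - q x) vol := hpi.sub hqi
  have hs : ∀ A : Set E, (∫ x in A, p x ∂vol) - ∫ x in A, q x ∂vol
      = ∫ x in A, (p x - q x) ∂vol :=
    fun A => (integral_sub hpi.integrableOn hqi.integrableOn).symm
  have hz : ∫ x, (p x - q x) ∂vol = 0 := by rw [integral_sub hpi hqi, h, sub_self]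
  have hcompl : ∀ A : Set E, MeasurableSet A →
      ∫ x in Aᶜ, (p x - q x) ∂vol = -∫ x in A, (p x - q x) ∂vol := fun A hA => by
    have := integral_add_compl hA hi
    linarith
  have hle : ∀ A : Set E, MeasurableSet A →
      |∫ x in A, (p x - q x) ∂vol| ≤ 1 / 2 * ∫ x, |p x - q x| ∂vol := fun A hA => by
    have h1 : |∫ x in A, (p x - q x) ∂vol| ≤ ∫ x in A, |p x - q x| ∂vol :=
      abs_integral_le_integral_abs
    have h2 : |∫ x in Aᶜ, (p x - q x) ∂vol| ≤ ∫ x in Aᶜ, |p x - q x| ∂vol :=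
      abs_integral_le_integral_abs
    rw [hcompl A hA, abs_neg] at h2
    have h3 := integral_add_compl hA hi.abs
    linarith
  simp only [hs]
  apply le_antisymm
  · have : Nonempty {A : Set E // MeasurableSet A} := ⟨⟨∅, MeasurableSet.empty⟩⟩
    exact ciSup_le fun A => hle A.1 A.2
  · have hA : MeasurableSet {x | q x ≤ p x} := measurableSet_le hq hp
    refine le_trans (le_of_eq ?_) (le_ciSup (f := fun A : {A : Set E // MeasurableSet A} =>
      |∫ x in A.1, (p x - q x) ∂vol|) ⟨_, by rintro _ ⟨A, rfl⟩; exact hle A.1 A.2⟩ ⟨_, hA⟩)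
    have h1 : ∫ x in {x | q x ≤ p x}, |p x - q x| ∂vol
        = ∫ x in {x | q x ≤ p x}, (p x - q x) ∂vol :=
      setIntegral_congr_fun hA fun x hx => abs_of_nonneg (sub_nonneg.2 hx)
    have h2 : ∫ x in {x | q x ≤ p x}ᶜ, |p x - q x| ∂vol
        = -∫ x in {x | q x ≤ p x}ᶜ, (p x - q x) ∂vol := by
      rw [← integral_neg]
      exact setIntegral_congr_fun hA.compl fun x hx =>
        abs_of_neg (sub_neg.2 (not_le.1 (fun h => hx h)))
    rw [← integral_add_compl hA hi.abs, h1, h2, hcompl _ hA]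
    have h0 : 0 ≤ ∫ x in {x | q x ≤ p x}, (p x - q x) ∂vol := by
      rw [← h1]; exact integral_nonneg fun _ => abs_nonneg _
    rw [abs_of_nonneg h0]; ring

/-- Only the tail of one of the two densities enters, since both have the same mass. -/
theorem half_integral_abs_sub_le (hp0 : ∀ x, 0 ≤ p x) (hq0 : ∀ x, 0 ≤ q x)
    (hpi : Integrable p vol) (hqi : Integrable q vol) (h : ∫ x, p x ∂vol = ∫ x, q x ∂vol)
    {δ : ℝ} (hδ : ∀ᵐ x ∂vol, |p x - q x| ≤ δ) {B : Set E} (hB : MeasurableSet B)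
    (hBf : vol B ≠ ⊤) :
    1 / 2 * ∫ x, |p x - q x| ∂vol ≤ δ * vol.real B + ∫ x in Bᶜ, q x ∂vol := by
  have hi : Integrable (fun x => q x - p x) vol := hqi.sub hpi
  have hi2 : Integrable (fun x => max (q x - p x) 0) vol := hi.pos_part
  have e : ∫ x, |p x - q x| ∂vol = 2 * ∫ x, max (q x - p x) 0 ∂vol := by
    have : ∀ x, |p x - q x| = 2 * max (q x - p x) 0 + (p x - q x) := fun x => by
      rcases le_total (q x) (p x) with hx | hx
      · rw [abs_of_nonneg (by linarith), max_eq_right (by linarith)]; ring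
      · rw [abs_of_nonpos (by linarith), max_eq_left (by linarith)]; ring
    simp only [this]
    have hi3 : Integrable (fun x => p x - q x) vol := hpi.sub hqi
    rw [integral_add (hi2.const_mul 2) hi3, integral_const_mul, integral_sub hpi hqi, h]
    ring
  rw [e, ← integral_add_compl hB hi2]
  have h1 : ∫ x in B, max (q x - p x) 0 ∂vol ≤ ∫ x in B, δ ∂vol := by
    refine setIntegral_mono_ae hi2.integrableOn (integrableOn_const hBf) ?_
    filter_upwards [hδ] with x hx
    exact max_le ((le_abs_self _).trans (abs_sub_comm (p x) (q x) ▸ hx)) ((abs_nonneg _).trans hx)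
  have h2 : ∫ x in Bᶜ, max (q x - p x) 0 ∂vol ≤ ∫ x in Bᶜ, q x ∂vol := by
    refine setIntegral_mono hi2.integrableOn hqi.integrableOn fun x => ?_
    exact max_le (by linarith [hp0 x]) (hq0 x)
  rw [setIntegral_const, smul_eq_mul] at h1
  linarith

end TotalVariation

/-! ### Tails from the characteristic function near zero -/

section Tail

variable {E : Type*} [NormedAddCommGroup E] [InnerProductSpace ℝ E] [FiniteDimensional ℝ E]
  [MeasurableSpace E] [BorelSpace E]

/-- The tail in a single direction, from Mathlib's truncation inequality on the real line. -/
theorem measureReal_abs_inner_gt_le_of_charFun {μ : Measure E} [IsProbabilityMeasure μ] {α C : ℝ}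
    (hα : 0 < α) (hC : 0 ≤ C) (h : ∀ s, 1 - (charFun μ s).re ≤ C * ‖s‖ ^ α) {a : E}
    (ha : ‖a‖ = 1) {r : ℝ} (hr : 0 < r) :
    μ.real {x | r < |inner ℝ a x|} ≤ 2 * C * (2 * r⁻¹) ^ α := by
  refine (measureReal_abs_inner_gt_le_integral_charFun hr).trans ?_
  set T : ℝ := 2 * r⁻¹ with hT
  have hT0 : 0 < T := by positivity
  set f : ℝ → ℂ := fun t => 1 - charFun μ (t • a) with hf
  have hfm : Measurable f :=
    measurable_const.sub (measurable_charFun.comp (measurable_id.smul_const a))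
  have hfi : IntervalIntegrable f volume (-T) T := by
    refine IntervalIntegrable.mono_fun' (g := fun _ => (2 : ℝ)) (by simp)
      hfm.aestronglyMeasurable (ae_of_all _ fun t => ?_)
    exact norm_one_sub_charFun_le_two
  have hfi' : IntervalIntegrable (fun t => f (-t)) volume (-T) T := by
    have := hfi.comp_sub_left 0
    simp at this
    simpa using this.symm
  -- the odd imaginary part drops out of the integral over a symmetric interval
  have e : ∫ t in -T..T, f t = ∫ t in -T..T, (2⁻¹ : ℂ) * (f t + f (-t)) := by
    rw [intervalIntegral.integral_const_mul, intervalIntegral.integral_add hfi hfi',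
      intervalIntegral.integral_comp_neg]
    simp only [neg_neg]
    ring
  have hb : ‖∫ t in -T..T, f t‖ ≤ C * T ^ α * |T - -T| := by
    rw [e]
    refine intervalIntegral.norm_integral_le_of_norm_le_const fun t ht => ?_
    rw [Set.uIoc_of_le (by linarith)] at ht
    have : (2⁻¹ : ℂ) * (f t + f (-t)) = ((1 - (charFun μ (t • a)).re : ℝ) : ℂ) := by
      have h1 : charFun μ ((-t) • a) = (starRingEnd ℂ) (charFun μ (t • a)) := by
        rw [neg_smul, charFun_neg]
      simp only [hf, h1]
      have := Complex.add_conj (charFun μ (t • a))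
      push_cast at this ⊢
      linear_combination (-1 / 2 : ℂ) * this
    rw [this, Complex.norm_real, Real.norm_eq_abs, abs_of_nonneg]
    · refine (h _).trans ?_
      rw [norm_smul, ha, mul_one]
      gcongr
      exact abs_le.2 ⟨by linarith [ht.1], ht.2⟩
    · have := (Complex.re_le_norm (charFun μ (t • a))).trans (norm_charFun_le_one _)
      linarith
  have : -2 * r⁻¹ = -T := by rw [hT]; ring
  rw [this]
  calc 2⁻¹ * r * ‖∫ t in -T..T, f t‖ ≤ 2⁻¹ * r * (C * T ^ α * |T - -T|) := by gcongr
    _ = 2 * C * T ^ α := by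
      rw [sub_neg_eq_add, abs_of_pos (by positivity), hT]
      field_simp
      ring

/-- The behaviour of the characteristic function near zero controls the tail. -/
theorem exists_tail_le {μ : Measure E} [IsProbabilityMeasure μ] {α C : ℝ}
    (hα : 0 < α) (hC : 0 ≤ C) (h : ∀ s, 1 - (charFun μ s).re ≤ C * ‖s‖ ^ α) :
    ∃ C' : ℝ, 0 ≤ C' ∧ ∀ R : ℝ, 0 < R → μ.real {x | R < ‖x‖} ≤ C' * R ^ (-α) := by
  set d : ℕ := Module.finrank ℝ E with hd
  refine ⟨∑ _i : Fin d, 2 * C * (2 * (d + 1)) ^ α, by positivity, fun R hR => ?_⟩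
  set b := stdOrthonormalBasis ℝ E
  have hsub : {x : E | R < ‖x‖} ⊆ ⋃ i : Fin d, {x | R / (d + 1) < |inner ℝ (b i) x|} := by
    intro x hx
    by_contra hn
    simp only [Set.mem_iUnion, Set.mem_ofPred_eq, not_exists, not_lt] at hn hx
    have h1 : ‖x‖ ^ 2 ≤ ∑ _i : Fin d, (R / (d + 1)) ^ 2 := by
      rw [← b.sum_sq_norm_inner_right x]
      refine Finset.sum_le_sum fun i _ => ?_
      rw [Real.norm_eq_abs]
      exact pow_le_pow_left₀ (abs_nonneg _) (hn i) 2
    simp only [Finset.sum_const, Finset.card_univ, Fintype.card_fin, nsmul_eq_mul] at h1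
    have h2 : (d : ℝ) * (R / (d + 1)) ^ 2 ≤ R ^ 2 := by
      rw [div_pow, mul_div_assoc', div_le_iff₀ (by positivity)]
      have : (0 : ℝ) ≤ d := by positivity
      nlinarith [sq_nonneg R, mul_nonneg this (sq_nonneg R)]
    have h3 : R ^ 2 < ‖x‖ ^ 2 := pow_lt_pow_left₀ hx hR.le two_ne_zero
    linarith
  refine (measureReal_mono hsub).trans ((measureReal_iUnion_fintype_le _).trans ?_)
  rw [Finset.sum_mul]
  refine Finset.sum_le_sum fun i _ => ?_
  refine (measureReal_abs_inner_gt_le_of_charFun hα hC h (b.norm_eq_one i)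
    (by positivity)).trans (le_of_eq ?_)
  rw [inv_div, mul_div_assoc', Real.div_rpow (by positivity) hR.le, Real.rpow_neg hR.le]
  ring

end Tail

/-! ### Laws carried by a subspace -/

section Carried

variable {E : Type*} [NormedAddCommGroup E] [InnerProductSpace ℝ E] [FiniteDimensional ℝ E]
  [MeasurableSpace E] [BorelSpace E]

/-- A law whose characteristic function is one on the orthogonal complement of a subspace is
carried by that subspace. -/
theorem ae_mem_of_charFun_eq_one {μ : Measure E} [IsProbabilityMeasure μ] (V : Submodule ℝ E)
    (h : ∀ s ∈ Vᗮ, charFun μ s = 1) : ∀ᵐ x ∂μ, x ∈ V := by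
  have h1 : ∀ s ∈ Vᗮ, ∀ᵐ x ∂μ, inner ℝ s x = 0 := by
    intro s hs
    have hm : Measurable fun x : E => inner ℝ s x := by fun_prop
    have : IsProbabilityMeasure (μ.map fun x : E => inner ℝ s x) :=
      Measure.isProbabilityMeasure_map hm.aemeasurable
    have e : μ.map (fun x : E => inner ℝ s x) = Measure.dirac 0 := by
      refine Measure.ext_of_charFun ?_
      ext t
      rw [charFun_dirac, inner_zero_left, Complex.ofReal_zero, zero_mul, Complex.exp_zero,
        charFun_apply_real, integral_map hm.aemeasurable (by fun_prop),
        ← h (t • s) (Vᗮ.smul_mem t hs), charFun_apply]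
      congr 1
      ext x
      rw [inner_smul_right, real_inner_comm]
      push_cast
      ring_nf
    have h0 : ∀ᵐ y ∂(μ.map fun x : E => inner ℝ s x), y = 0 := by
      rw [e]; simp
    exact ae_of_ae_map hm.aemeasurable h0
  have h2 : ∀ᵐ x ∂μ, ∀ i, inner ℝ ((stdOrthonormalBasis ℝ Vᗮ i : Vᗮ) : E) x = 0 :=
    ae_all_iff.2 fun i => h1 _ (stdOrthonormalBasis ℝ Vᗮ i).2
  filter_upwards [h2] with x hx
  rw [← Submodule.orthogonal_orthogonal V, Submodule.mem_orthogonal]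
  intro u hu
  have hrep := (stdOrthonormalBasis ℝ Vᗮ).sum_repr ⟨u, hu⟩
  have : u = ∑ i, ((stdOrthonormalBasis ℝ Vᗮ).repr ⟨u, hu⟩ i) •
      ((stdOrthonormalBasis ℝ Vᗮ i : Vᗮ) : E) := by
    have := congrArg (Subtype.val) hrep
    simpa using this.symm
  rw [this, sum_inner]
  refine Finset.sum_eq_zero fun i _ => ?_
  rw [inner_smul_left, hx i, mul_zero]

/-- The law of the orthogonal projection onto a subspace. -/
def projLaw (V : Submodule ℝ E) (μ : Measure E) : Measure V := μ.map V.orthogonalProjectionOnto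

theorem isProbabilityMeasure_projLaw (V : Submodule ℝ E) (μ : Measure E)
    [IsProbabilityMeasure μ] : IsProbabilityMeasure (projLaw V μ) :=
  Measure.isProbabilityMeasure_map (ContinuousLinearMap.measurable _).aemeasurable

theorem charFun_projLaw (V : Submodule ℝ E) (μ : Measure E) (s : V) :
    charFun (projLaw V μ) s = charFun μ (s : E) := by
  rw [projLaw, charFun_apply, charFun_apply,
    integral_map (ContinuousLinearMap.measurable _).aemeasurable (by fun_prop)]
  congr 1
  ext x
  rw [Submodule.coe_inner, ← Submodule.starProjection_apply,
    Submodule.inner_starProjection_left_eq_right, Submodule.starProjection_eq_self_iff.2 s.2]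

theorem map_val_projLaw {V : Submodule ℝ E} {μ : Measure E} (h : ∀ᵐ x ∂μ, x ∈ V) :
    (projLaw V μ).map Subtype.val = μ := by
  rw [projLaw, Measure.map_map measurable_subtype_coe (ContinuousLinearMap.measurable _)]
  refine (Measure.map_congr (g := id) ?_).trans Measure.map_id
  filter_upwards [h] with x hx
  simpa using Submodule.starProjection_eq_self_iff.2 hx

end Carried

/-! ### Elementary decay estimates -/

section Decay

theorem exists_rpow_mul_exp_neg_le {c : ℝ} (hc : 0 < c) (β : ℝ) :
    ∃ K : ℝ, 0 ≤ K ∧ ∀ u : ℝ, 1 ≤ u → u ^ β * Real.exp (-c * u) ≤ K := by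
  obtain ⟨k, hk⟩ := exists_nat_ge β
  refine ⟨k.factorial / c ^ k, by positivity, fun u hu => ?_⟩
  have h1 : u ^ β ≤ u ^ k := by
    rw [← Real.rpow_natCast]
    exact Real.rpow_le_rpow_of_exponent_le hu hk
  have h2 : (c * u) ^ k / k.factorial ≤ Real.exp (c * u) :=
    Real.pow_div_factorial_le_exp _ (by positivity) k
  rw [neg_mul, Real.exp_neg, ← div_eq_mul_inv, div_le_iff₀ (Real.exp_pos _)]
  calc u ^ β ≤ u ^ k := h1
    _ = k.factorial / c ^ k * ((c * u) ^ k / k.factorial) := by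
      rw [mul_pow]; field_simp
    _ ≤ _ := by gcongr

theorem exists_rpow_mul_exp_neg_rpow_le {α c r : ℝ} (hα : 0 < α) (hc : 0 < c) (hr : 0 ≤ r) :
    ∃ K : ℝ, 0 ≤ K ∧ ∀ t : ℝ, 0 ≤ t →
      t ^ (2 * α) * Real.exp (-c * t ^ α) ≤ K * (1 + t) ^ (-r) := by
  obtain ⟨K, hK0, hK⟩ := exists_rpow_mul_exp_neg_le hc (2 + r / α)
  refine ⟨2 ^ r * max 1 K, by positivity, fun t ht => ?_⟩
  have hpos : 0 < (1 + t) ^ r := Real.rpow_pos_of_pos (by linarith) r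
  rw [Real.rpow_neg (by linarith), ← div_eq_mul_inv, le_div_iff₀ hpos]
  rcases le_total t 1 with h1 | h1
  · have e1 : t ^ (2 * α) ≤ 1 := Real.rpow_le_one ht h1 (by positivity)
    have e2 : Real.exp (-c * t ^ α) ≤ 1 := by
      rw [Real.exp_le_one_iff]
      have := Real.rpow_nonneg ht α
      nlinarith
    have e3 : (1 + t) ^ r ≤ 2 ^ r := Real.rpow_le_rpow (by linarith) (by linarith) hr
    calc t ^ (2 * α) * Real.exp (-c * t ^ α) * (1 + t) ^ r ≤ 1 * 1 * 2 ^ r := by gcongr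
      _ ≤ 2 ^ r * max 1 K := by
        have : (0 : ℝ) < 2 ^ r := by positivity
        nlinarith [le_max_left 1 K]
  · have hu : 1 ≤ t ^ α := Real.one_le_rpow h1 hα.le
    have e3 : (1 + t) ^ r ≤ 2 ^ r * t ^ r := by
      rw [← Real.mul_rpow (by norm_num) ht]
      exact Real.rpow_le_rpow (by linarith) (by linarith) hr
    have e4 : t ^ (2 * α) * t ^ r = (t ^ α) ^ (2 + r / α) := by
      rw [← Real.rpow_mul ht, ← Real.rpow_add (by linarith)]
      congr 1
      field_simp
    calc t ^ (2 * α) * Real.exp (-c * t ^ α) * (1 + t) ^ r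
        ≤ t ^ (2 * α) * Real.exp (-c * t ^ α) * (2 ^ r * t ^ r) := by gcongr
      _ = 2 ^ r * ((t ^ α) ^ (2 + r / α) * Real.exp (-c * t ^ α)) := by rw [← e4]; ring
      _ ≤ 2 ^ r * max 1 K := by
        gcongr
        exact (hK _ hu).trans (le_max_right _ _)

/-- The telescoping bound for a difference of powers. -/
theorem norm_pow_sub_pow_le_of_le {a b : ℂ} {M : ℝ} (ha : ‖a‖ ≤ M) (hb : ‖b‖ ≤ M) (m : ℕ) :
    ‖a ^ m - b ^ m‖ ≤ m * ‖a - b‖ * M ^ (m - 1) := by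
  have hM : 0 ≤ M := (norm_nonneg _).trans ha
  cases m with
  | zero => simp
  | succ m =>
    induction m with
    | zero => simp
    | succ m ih =>
      have e : a ^ (m + 1 + 1) - b ^ (m + 1 + 1) = a * (a ^ (m + 1) - b ^ (m + 1)) +
          (a - b) * b ^ (m + 1) := by ring
      rw [e]
      simp only [Nat.add_sub_cancel] at ih ⊢
      calc _ ≤ ‖a‖ * ‖a ^ (m + 1) - b ^ (m + 1)‖ + ‖a - b‖ * ‖b‖ ^ (m + 1) := by
            refine (norm_add_le _ _).trans ?_
            rw [norm_mul, norm_mul, norm_pow]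
        _ ≤ M * ((m + 1 : ℕ) * ‖a - b‖ * M ^ m) + ‖a - b‖ * M ^ (m + 1) := by gcongr
        _ = _ := by push_cast; ring

end Decay

/-! ### Comparison of powers of characteristic functions -/

section FourierEstimate

variable {E : Type*} [NormedAddCommGroup E] [InnerProductSpace ℝ E]

/-- Pointwise form of the comparison of the powers of two characteristic functions at the scale
`m^{-1/α}`: close to the origin they differ by `m` times the one-step error, away from the origin
both are exponentially small in `m`. -/
theorem exists_norm_pow_sub_pow_le {ψ Φ : E → ℂ} {α c C r : ℝ} (hα : 0 < α) (hc : 0 < c)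
    (hC : 0 ≤ C) (hr : 0 ≤ r)
    (h1 : ∀ s, ‖s‖ ≤ 1 → ‖ψ s - Φ s‖ ≤ C * ‖s‖ ^ (2 * α))
    (h2 : ∀ s, ‖s‖ ≤ 1 → ‖ψ s‖ ≤ Real.exp (-c * ‖s‖ ^ α))
    (h3 : ∀ s, ‖Φ s‖ ≤ Real.exp (-c * ‖s‖ ^ α))
    (h4 : ∀ s, 1 ≤ ‖s‖ → ‖ψ s‖ ≤ Real.exp (-c))
    (h5 : ∀ s, 1 ≤ ‖s‖ → ‖ψ s‖ ≤ C * ‖s‖ ^ (-(1 / 2) : ℝ)) :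
    ∃ K : ℝ, 0 ≤ K ∧ ∃ m₀ : ℕ, 1 ≤ m₀ ∧ ∀ m : ℕ, m₀ ≤ m → ∀ S : E,
      ‖ψ ((m : ℝ) ^ (-1 / α) • S) ^ m - Φ ((m : ℝ) ^ (-1 / α) • S) ^ m‖
        ≤ K / m * (1 + ‖S‖) ^ (-r) := by
  obtain ⟨K1, hK10, hK1⟩ := exists_rpow_mul_exp_neg_rpow_le hα (half_pos hc) hr
  obtain ⟨K2, hK20, hK2⟩ := exists_rpow_mul_exp_neg_rpow_le hα hc hr
  obtain ⟨K3, hK30, hK3⟩ := exists_rpow_mul_exp_neg_le hc (r / α + 1)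
  -- of `m` factors of `ψ`, the number `k ≥ 2 r` gives decay in `s` and the rest decay in `m`
  obtain ⟨k, hk⟩ := exists_nat_ge (2 * r + 1)
  have hk1 : 1 ≤ k := by exact_mod_cast (show (1 : ℝ) ≤ k by linarith)
  set B : ℝ := C ^ k * 2 ^ r + K2 with hB
  have hB0 : 0 ≤ B := by positivity
  set K : ℝ := C * K1 + B * Real.exp (c * (k + 1)) * K3 with hK
  refine ⟨K, by positivity, k + 2, by omega, fun m hm S => ?_⟩
  have hm1 : (1 : ℝ) ≤ m := by exact_mod_cast (show 1 ≤ m by omega)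
  have hm0 : (0 : ℝ) < m := by linarith
  set ρ : ℝ := (m : ℝ) ^ (-1 / α) with hρ
  have hρ0 : 0 < ρ := Real.rpow_pos_of_pos hm0 _
  have hρ1 : ρ ≤ 1 := Real.rpow_le_one_of_one_le_of_nonpos hm1
    (div_nonpos_of_nonpos_of_nonneg (by norm_num) hα.le)
  have hρα : ρ ^ α = (m : ℝ)⁻¹ := by
    rw [hρ, ← Real.rpow_mul hm0.le, div_mul_cancel₀ _ hα.ne', Real.rpow_neg_one]
  set s : E := ρ • S with hs
  have hns : ‖s‖ = ρ * ‖S‖ := by rw [hs, norm_smul, Real.norm_of_nonneg hρ0.le]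
  have hnsα : ‖s‖ ^ α = ‖S‖ ^ α / m := by
    rw [hns, Real.mul_rpow hρ0.le (norm_nonneg _), hρα]; ring
  have hw : 0 < (1 + ‖S‖) ^ (-r) := Real.rpow_pos_of_pos (by positivity) _
  have hsplit : K / m * (1 + ‖S‖) ^ (-r) = C * K1 / m * (1 + ‖S‖) ^ (-r)
      + B * Real.exp (c * (k + 1)) * K3 / m * (1 + ‖S‖) ^ (-r) := by
    rw [hK]; ring
  rw [hsplit]
  rcases le_total ‖s‖ 1 with hle | hge
  · -- near the origin
    refine le_trans ?_ (le_add_of_nonneg_right (by positivity))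
    refine (norm_pow_sub_pow_le_of_le (h2 s hle) (h3 s) m).trans ?_
    have e1 : Real.exp (-c * ‖s‖ ^ α) ^ (m - 1) ≤ Real.exp (-(c / 2) * ‖S‖ ^ α) := by
      rw [← Real.exp_nat_mul, Real.exp_le_exp, hnsα, Nat.cast_sub (by omega), Nat.cast_one]
      have hm2 : (2 : ℝ) ≤ m := by exact_mod_cast (show 2 ≤ m by omega)
      have hS : 0 ≤ ‖S‖ ^ α := by positivity
      have : (1 : ℝ) / 2 ≤ (m - 1) / m := by
        rw [div_le_div_iff₀ (by norm_num) hm0]; linarith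
      have h6 := mul_le_mul_of_nonneg_right this (mul_nonneg hc.le hS)
      calc ((m : ℝ) - 1) * (-c * (‖S‖ ^ α / m)) = -((m - 1) / m * (c * ‖S‖ ^ α)) := by ring
        _ ≤ -(1 / 2 * (c * ‖S‖ ^ α)) := by linarith
        _ = _ := by ring
    have e2 : ‖s‖ ^ (2 * α) = ‖S‖ ^ (2 * α) / m ^ 2 := by
      rw [mul_comm 2 α, Real.rpow_mul (norm_nonneg _), Real.rpow_mul (norm_nonneg _), hnsα,
        Real.div_rpow (by positivity) hm0.le, Real.rpow_two (m : ℝ)]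
    calc (m : ℝ) * ‖ψ s - Φ s‖ * Real.exp (-c * ‖s‖ ^ α) ^ (m - 1)
        ≤ m * (C * (‖S‖ ^ (2 * α) / m ^ 2)) * Real.exp (-(c / 2) * ‖S‖ ^ α) := by
          have h6 := h1 s hle
          rw [e2] at h6
          gcongr
      _ = C / m * (‖S‖ ^ (2 * α) * Real.exp (-(c / 2) * ‖S‖ ^ α)) := by field_simp
      _ ≤ C / m * (K1 * (1 + ‖S‖) ^ (-r)) :=
          mul_le_mul_of_nonneg_left (hK1 _ (norm_nonneg S)) (by positivity)
      _ = C * K1 / m * (1 + ‖S‖) ^ (-r) := by ring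
  · -- away from the origin
    refine le_trans ?_ (le_add_of_nonneg_left (by positivity))
    have hs0 : 0 < ‖s‖ := by linarith
    have hq : Real.exp (-c) ^ (m - k) ≤ Real.exp (c * (k + 1)) * Real.exp (-c * m) := by
      rw [← Real.exp_nat_mul, ← Real.exp_add, Real.exp_le_exp, Nat.cast_sub (by omega)]
      linarith
    have e1 : ‖ψ s‖ ^ m ≤ Real.exp (-c) ^ (m - k) * (C ^ k * 2 ^ r * (1 + ‖s‖) ^ (-r)) := by
      have : ‖ψ s‖ ^ m = ‖ψ s‖ ^ (m - k) * ‖ψ s‖ ^ k := by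
        rw [← pow_add]; congr 1; omega
      rw [this]
      have e2 : ‖ψ s‖ ^ k ≤ C ^ k * (2 ^ r * (1 + ‖s‖) ^ (-r)) := by
        calc ‖ψ s‖ ^ k ≤ (C * ‖s‖ ^ (-(1 / 2) : ℝ)) ^ k := by gcongr; exact h5 s hge
          _ = C ^ k * (‖s‖ ^ (-(1 / 2) * k : ℝ)) := by
            rw [mul_pow, ← Real.rpow_natCast (‖s‖ ^ _), ← Real.rpow_mul hs0.le]
          _ ≤ C ^ k * (‖s‖ ^ (-r)) := by
            gcongr
            linarith
          _ ≤ C ^ k * (2 ^ r * (1 + ‖s‖) ^ (-r)) := by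
            gcongr
            rw [Real.rpow_neg hs0.le, Real.rpow_neg (by linarith), ← div_eq_mul_inv,
              le_div_iff₀ (by positivity), inv_mul_le_iff₀ (by positivity),
              ← Real.mul_rpow hs0.le (by norm_num)]
            exact Real.rpow_le_rpow (by linarith) (by linarith) hr
      have e3 : ‖ψ s‖ ^ (m - k) ≤ Real.exp (-c) ^ (m - k) := by gcongr; exact h4 s hge
      calc _ ≤ Real.exp (-c) ^ (m - k) * (C ^ k * (2 ^ r * (1 + ‖s‖) ^ (-r))) := by gcongr
        _ = _ := by ring
    have e2 : ‖Φ s‖ ^ m ≤ Real.exp (-c) ^ (m - k) * (K2 * (1 + ‖s‖) ^ (-r)) := by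
      have hu : 1 ≤ ‖s‖ ^ α := Real.one_le_rpow hge hα.le
      have e3 : ‖Φ s‖ ≤ Real.exp (-c) := (h3 s).trans (by
        rw [Real.exp_le_exp]; nlinarith)
      have e4 : ‖Φ s‖ ≤ K2 * (1 + ‖s‖) ^ (-r) := by
        refine (h3 s).trans (le_trans ?_ (hK2 _ hs0.le))
        exact le_mul_of_one_le_left (Real.exp_pos _).le (Real.one_le_rpow hge (by positivity))
      have : ‖Φ s‖ ^ m = ‖Φ s‖ ^ (m - 1) * ‖Φ s‖ := by
        rw [← pow_succ]; congr 1; omega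
      rw [this]
      have e5 : ‖Φ s‖ ^ (m - 1) ≤ Real.exp (-c) ^ (m - k) :=
        (pow_le_pow_left₀ (norm_nonneg _) e3 _).trans
          (pow_le_pow_of_le_one (Real.exp_pos _).le
            (Real.exp_le_one_iff.2 (by linarith)) (by omega))
      gcongr
    have e3 : (1 + ‖s‖) ^ (-r) ≤ (m : ℝ) ^ (r / α) * (1 + ‖S‖) ^ (-r) := by
      have h6 : ρ * (1 + ‖S‖) ≤ 1 + ‖s‖ := by rw [hns]; linarith
      have h7 : (m : ℝ) ^ (r / α) = ρ ^ (-r) := by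
        rw [hρ, ← Real.rpow_mul hm0.le]; congr 1; ring
      rw [h7, ← Real.mul_rpow hρ0.le (by positivity)]
      exact Real.rpow_le_rpow_of_nonpos (by positivity) h6 (by linarith)
    have e4 : (m : ℝ) ^ (r / α) * Real.exp (-c * m) ≤ K3 / m := by
      rw [le_div_iff₀ hm0]
      refine le_trans (le_of_eq ?_) (hK3 m hm1)
      rw [Real.rpow_add_one hm0.ne']; ring
    calc ‖ψ s ^ m - Φ s ^ m‖ ≤ ‖ψ s‖ ^ m + ‖Φ s‖ ^ m := by
          rw [← norm_pow, ← norm_pow]; exact norm_sub_le _ _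
      _ ≤ Real.exp (-c) ^ (m - k) * (B * (1 + ‖s‖) ^ (-r)) := by
          rw [hB]; linarith
      _ ≤ (Real.exp (c * (k + 1)) * Real.exp (-c * m)) *
            (B * ((m : ℝ) ^ (r / α) * (1 + ‖S‖) ^ (-r))) := by gcongr
      _ = B * Real.exp (c * (k + 1)) * ((m : ℝ) ^ (r / α) * Real.exp (-c * m)) *
            (1 + ‖S‖) ^ (-r) := by ring
      _ ≤ B * Real.exp (c * (k + 1)) * (K3 / m) * (1 + ‖S‖) ^ (-r) := by gcongr
      _ = _ := by ring

variable [FiniteDimensional ℝ E] [MeasurableSpace E] [BorelSpace E]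

/-- Integrated comparison of the powers of a one-step characteristic function `ψ` and of a stable
one `Φ`: if they agree to second order at the origin, the `m`-th powers at scale `m^{-1/α}` are
within `O(1 / m)` in `L¹`. The polynomial decay `h5` is slow, but high powers of `ψ` inherit enough
of it to be integrable. -/
theorem exists_integral_norm_pow_sub_pow_le {ψ Φ : E → ℂ} {α c C : ℝ} (hα : 0 < α) (hc : 0 < c)
    (hC : 0 ≤ C) (hψ : Measurable ψ) (hΦ : Measurable Φ)
    (h1 : ∀ s, ‖s‖ ≤ 1 → ‖ψ s - Φ s‖ ≤ C * ‖s‖ ^ (2 * α))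
    (h2 : ∀ s, ‖s‖ ≤ 1 → ‖ψ s‖ ≤ Real.exp (-c * ‖s‖ ^ α))
    (h3 : ∀ s, ‖Φ s‖ ≤ Real.exp (-c * ‖s‖ ^ α))
    (h4 : ∀ s, 1 ≤ ‖s‖ → ‖ψ s‖ ≤ Real.exp (-c))
    (h5 : ∀ s, 1 ≤ ‖s‖ → ‖ψ s‖ ≤ C * ‖s‖ ^ (-(1 / 2) : ℝ)) :
    ∃ K : ℝ, 0 ≤ K ∧ ∃ m₀ : ℕ, 1 ≤ m₀ ∧ ∀ m : ℕ, m₀ ≤ m →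
      Integrable (fun S : E =>
        ‖ψ ((m : ℝ) ^ (-1 / α) • S) ^ m - Φ ((m : ℝ) ^ (-1 / α) • S) ^ m‖) ∧
      ∫ S : E, ‖ψ ((m : ℝ) ^ (-1 / α) • S) ^ m - Φ ((m : ℝ) ^ (-1 / α) • S) ^ m‖ ≤ K / m := by
  set r : ℝ := Module.finrank ℝ E + 1
  obtain ⟨K, hK0, m₀, hm₀, h⟩ := exists_norm_pow_sub_pow_le (r := r) hα hc hC (by positivity)
    h1 h2 h3 h4 h5
  have hint : Integrable (fun S : E => (1 + ‖S‖) ^ (-r)) :=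
    integrable_one_add_norm (lt_add_one _)
  refine ⟨K * ∫ S : E, (1 + ‖S‖) ^ (-r), by positivity, m₀, hm₀, fun m hm => ?_⟩
  have hi : Integrable (fun S : E =>
        ‖ψ ((m : ℝ) ^ (-1 / α) • S) ^ m - Φ ((m : ℝ) ^ (-1 / α) • S) ^ m‖) := by
    refine (hint.const_mul (K / m)).mono' ?_ (ae_of_all _ fun S => ?_)
    · exact (((hψ.comp (measurable_const_smul _)).pow_const m).sub
        ((hΦ.comp (measurable_const_smul _)).pow_const m)).norm.aestronglyMeasurable
    · rw [norm_norm]; exact h m hm S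
  refine ⟨hi, (integral_mono hi (hint.const_mul (K / m)) fun S => h m hm S).trans ?_⟩
  rw [integral_const_mul]
  exact le_of_eq (by ring)

theorem integrable_of_norm_le_exp {Φ : E → ℂ} {α c : ℝ} (hα : 0 < α) (hc : 0 < c)
    (hΦ : Measurable Φ) (h : ∀ s, ‖Φ s‖ ≤ Real.exp (-c * ‖s‖ ^ α)) : Integrable Φ := by
  set r : ℝ := Module.finrank ℝ E + 1
  obtain ⟨K, hK0, hK⟩ := exists_rpow_mul_exp_neg_rpow_le (r := r) hα hc (by positivity)
  have hint : Integrable (fun S : E => (1 + ‖S‖) ^ (-r)) :=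
    integrable_one_add_norm (lt_add_one _)
  refine (hint.const_mul (max K (2 ^ r))).mono' hΦ.aestronglyMeasurable (ae_of_all _ fun s => ?_)
  refine (h s).trans ?_
  rcases le_total ‖s‖ 1 with hle | hge
  · have h1 : Real.exp (-c * ‖s‖ ^ α) ≤ 1 := by
      rw [Real.exp_le_one_iff]
      have := Real.rpow_nonneg (norm_nonneg s) α
      nlinarith
    have h2 : 1 ≤ 2 ^ r * (1 + ‖s‖) ^ (-r) := by
      rw [Real.rpow_neg (by positivity), ← div_eq_mul_inv, one_le_div (by positivity)]
      exact Real.rpow_le_rpow (by positivity) (by linarith) (by positivity)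
    refine h1.trans (h2.trans ?_)
    gcongr
    exact le_max_right _ _
  · refine (le_mul_of_one_le_left (Real.exp_pos _).le
      (Real.one_le_rpow hge (by positivity : 0 ≤ 2 * α))).trans ((hK _ (norm_nonneg s)).trans ?_)
    gcongr
    exact le_max_left _ _

end FourierEstimate

/-! ### The Euclidean space of Hermitian matrices -/

section Geometry

variable {N : ℕ}

theorem star_apply (R : Herm N) (i j : Fin N) :
    (starRingEnd ℂ) ((R : Matrix (Fin N) (Fin N) ℂ) i j) = (R : Matrix (Fin N) (Fin N) ℂ) j i :=
  (isHermitian R).apply j i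

theorem trPair_eq_sum (R S : Herm N) :
    trPair R S = ∑ i, ∑ j, (((R : Matrix (Fin N) (Fin N) ℂ) i j).re *
      ((S : Matrix (Fin N) (Fin N) ℂ) i j).re + ((R : Matrix (Fin N) (Fin N) ℂ) i j).im *
      ((S : Matrix (Fin N) (Fin N) ℂ) i j).im) := by
  simp only [trPair, Matrix.trace, Matrix.diag, Matrix.mul_apply, Complex.re_sum]
  refine Finset.sum_congr rfl fun i _ => Finset.sum_congr rfl fun j _ => ?_
  rw [← star_apply S i j]
  simp [Complex.mul_re]

theorem trPair_self_eq_sum (R : Herm N) :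
    trPair R R = ∑ i, ∑ j, ‖(R : Matrix (Fin N) (Fin N) ℂ) i j‖ ^ 2 := by
  rw [trPair_eq_sum]
  refine Finset.sum_congr rfl fun i _ => Finset.sum_congr rfl fun j _ => ?_
  rw [← Complex.normSq_eq_norm_sq, Complex.normSq_apply]

theorem trPair_comm (R S : Herm N) : trPair R S = trPair S R := by
  simp only [trPair_eq_sum, mul_comm]

theorem sq_norm_apply_le (R : Herm N) (i j : Fin N) :
    ‖(R : Matrix (Fin N) (Fin N) ℂ) i j‖ ^ 2 ≤ trPair R R := by
  rw [trPair_self_eq_sum]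
  refine le_trans ?_ (Finset.single_le_sum (f := fun i => ∑ j,
    ‖(R : Matrix (Fin N) (Fin N) ℂ) i j‖ ^ 2) (fun i _ => Finset.sum_nonneg fun j _ => sq_nonneg _)
    (Finset.mem_univ i))
  exact Finset.single_le_sum (f := fun j => ‖(R : Matrix (Fin N) (Fin N) ℂ) i j‖ ^ 2)
    (fun j _ => sq_nonneg _) (Finset.mem_univ j)

/-- The trace pairing as an inner product on Hermitian matrices. -/
@[reducible] def hermCore (N : ℕ) : InnerProductSpace.Core ℝ (Herm N) where
  inner := trPair
  conj_inner_symm R S := by simp [trPair_comm R S]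
  re_inner_nonneg R := by
    simp only [RCLike.re_to_real, trPair_self_eq_sum]
    positivity
  add_left R S T := by simp [trPair, add_mul]
  smul_left R S c := by simp [trPair]
  definite R h := by
    have h0 : ∀ i j, (R : Matrix (Fin N) (Fin N) ℂ) i j = 0 := fun i j => by
      have := sq_norm_apply_le R i j
      rw [show trPair R R = 0 from h] at this
      have h1 : ‖(R : Matrix (Fin N) (Fin N) ℂ) i j‖ = 0 := by
        nlinarith [norm_nonneg ((R : Matrix (Fin N) (Fin N) ℂ) i j)]
      exact norm_eq_zero.1 h1
    exact Subtype.ext (Matrix.ext h0)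

theorem continuous_trPair : Continuous fun p : Herm N × Herm N => trPair p.1 p.2 := by
  unfold trPair
  fun_prop

instance instContinuousSMulHerm (N : ℕ) : ContinuousSMul ℝ (Herm N) :=
  ⟨by
    refine Continuous.subtype_mk (f := fun p : ℝ × Herm N =>
      p.1 • (p.2 : Matrix (Fin N) (Fin N) ℂ)) (by fun_prop) _⟩

theorem continuousAt_trPair_self : ContinuousAt (fun R : Herm N => trPair R R) 0 :=
  (continuous_trPair.comp (continuous_id.prodMk continuous_id)).continuousAt

theorem isClosedEmbedding_coe :
    Topology.IsClosedEmbedding (Subtype.val : Herm N → Matrix (Fin N) (Fin N) ℂ) := by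
  refine IsClosed.isClosedEmbedding_subtypeVal ?_
  have : {R : Matrix (Fin N) (Fin N) ℂ | star R = R} =
      ((selfAdjoint (Matrix (Fin N) (Fin N) ℂ) : Set (Matrix (Fin N) (Fin N) ℂ))) := by
    ext R; simp [selfAdjoint.mem_iff]
  have h2 := isClosed_eq (f := fun R : Matrix (Fin N) (Fin N) ℂ => star R) (g := id)
    (by fun_prop) continuous_id
  exact this ▸ h2

theorem isVonNBounded_trPair_lt :
    Bornology.IsVonNBounded ℝ {R : Herm N | RCLike.re (trPair R R) < 1} := by
  have hK : IsCompact (Set.pi Set.univ fun _ : Fin N => Set.pi Set.univ fun _ : Fin N =>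
      Metric.closedBall (0 : ℂ) 1) :=
    isCompact_univ_pi fun _ => isCompact_univ_pi fun _ => isCompact_closedBall _ _
  have hK2 : IsCompact ((Subtype.val : Herm N → Matrix (Fin N) (Fin N) ℂ) ⁻¹'
    (Set.pi Set.univ fun _ : Fin N => Set.pi Set.univ fun _ : Fin N =>
      Metric.closedBall (0 : ℂ) 1)) := isClosedEmbedding_coe.isCompact_preimage hK
  refine Bornology.IsVonNBounded.subset ?_ (hK2.isVonNBounded ℝ)
  intro R hR i _ j _
  have h1 := sq_norm_apply_le R i j
  have h2 : trPair R R < 1 := hR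
  rw [mem_closedBall_zero_iff]
  nlinarith [norm_nonneg ((R : Matrix (Fin N) (Fin N) ℂ) i j)]

/-- The norm `√(tr R²)`; its topology is the given one by definition. -/
@[reducible] def hermNormed (N : ℕ) : NormedAddCommGroup (Herm N) :=
  letI := hermCore N
  InnerProductSpace.Core.toNormedAddCommGroupOfTopology (𝕜 := ℝ) (F := Herm N)
    continuousAt_trPair_self isVonNBounded_trPair_lt

attribute [local instance] hermNormed

/-- Hermitian matrices with the inner product `tr (R S)`. -/
@[reducible] def hermInner (N : ℕ) : InnerProductSpace ℝ (Herm N) :=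
  InnerProductSpace.ofCoreOfTopology (hermCore N) continuousAt_trPair_self isVonNBounded_trPair_lt

attribute [local instance] hermInner

theorem inner_eq_trPair (R S : Herm N) : inner ℝ R S = trPair R S := rfl

instance instFiniteDimensionalHerm (N : ℕ) : FiniteDimensional ℝ (Herm N) := by
  let f : Herm N →ₗ[ℝ] Matrix (Fin N) (Fin N) ℂ :=
    { toFun := Subtype.val, map_add' := fun _ _ => rfl, map_smul' := fun _ _ => rfl }
  exact Module.Finite.of_injective f Subtype.val_injective

/-! ### Conjugation by unitary matrices -/

theorem conj_add (U : UGroup N) (R S : Herm N) : conj U (R + S) = conj U R + conj U S :=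
  Subtype.ext (by simp [conj, mul_add, add_mul])

theorem conj_smul (U : UGroup N) (c : ℝ) (R : Herm N) : conj U (c • R) = c • conj U R :=
  Subtype.ext (by simp [conj])

theorem conj_conj (U V : UGroup N) (R : Herm N) : conj U (conj V R) = conj (U * V) R :=
  Subtype.ext (by simp [conj, mul_assoc, Matrix.conjTranspose_mul])

theorem conj_one (R : Herm N) : conj 1 R = R :=
  Subtype.ext (by simp [conj])

theorem conj_inv_conj (U : UGroup N) (R : Herm N) : conj U⁻¹ (conj U R) = R := by
  rw [conj_conj, inv_mul_cancel, conj_one]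

theorem conj_self_one (U : UGroup N) : conj U (1 : Herm N) = 1 :=
  Subtype.ext (by
    have := Matrix.mem_unitaryGroup_iff.1 U.2
    simpa [conj, Matrix.star_eq_conjTranspose] using this)

theorem trPair_conj_left (U : UGroup N) (R S : Herm N) :
    trPair (conj U R) S = trPair R (conj U⁻¹ S) := by
  have h : ((U⁻¹ : UGroup N) : Matrix (Fin N) (Fin N) ℂ) = (U : Matrix (Fin N) (Fin N) ℂ)ᴴ := rfl
  simp only [trPair, conj, h, Matrix.conjTranspose_conjTranspose]
  congr 1
  rw [mul_assoc, mul_assoc, Matrix.trace_mul_comm, ← mul_assoc, ← mul_assoc, ← mul_assoc]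

theorem trPair_conj_conj (U : UGroup N) (R S : Herm N) :
    trPair (conj U R) (conj U S) = trPair R S := by
  rw [trPair_conj_left, conj_inv_conj]

theorem trForm_eq_trPair_one (R : Herm N) : trForm N R = trPair R 1 := by
  simp [trForm, trPair]

theorem trForm_conj (U : UGroup N) (R : Herm N) : trForm N (conj U R) = trForm N R := by
  rw [trForm_eq_trPair_one, trForm_eq_trPair_one, trPair_conj_left, conj_self_one]

theorem continuous_conj : Continuous fun p : UGroup N × Herm N => conj p.1 p.2 := by
  unfold conj
  fun_prop

/-! ### Diagonal matrices and diagonals -/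

/-- The diagonal entries of a Hermitian matrix, which are real. -/
def diagVec (S : Herm N) : Fin N → ℝ := fun i => ((S : Matrix (Fin N) (Fin N) ℂ) i i).re

theorem diagVec_diagMat (r : Fin N → ℝ) : diagVec (diagMat r) = r := by
  ext i; simp [diagVec, diagMat]

theorem diagVec_add (R S : Herm N) : diagVec (R + S) = diagVec R + diagVec S := by
  ext i; simp [diagVec]

theorem diagVec_smul (c : ℝ) (S : Herm N) : diagVec (c • S) = c • diagVec S := by
  ext i; simp [diagVec]

theorem diagMat_add (r s : Fin N → ℝ) : diagMat (r + s) = diagMat r + diagMat s :=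
  Subtype.ext (by simp [diagMat, ← Matrix.diagonal_add])

theorem diagMat_smul (c : ℝ) (r : Fin N → ℝ) : diagMat (c • r) = c • diagMat r :=
  Subtype.ext (by ext i j; by_cases h : i = j <;> simp [diagMat, h])

theorem trPair_diagMat (r : Fin N → ℝ) (S : Herm N) :
    trPair (diagMat r) S = r ⬝ᵥ diagVec S := by
  simp [trPair, diagMat, Matrix.trace, diagVec, dotProduct]

theorem trForm_eq_sum_diagVec (S : Herm N) : trForm N S = ∑ i, diagVec S i := by
  simp [trForm, Matrix.trace, diagVec]

theorem continuous_diagMat : Continuous (diagMat : (Fin N → ℝ) → Herm N) := by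
  unfold diagMat
  refine Continuous.subtype_mk ?_ _
  exact Continuous.matrix_diagonal (by fun_prop)

theorem continuous_diagVec : Continuous (diagVec : Herm N → Fin N → ℝ) := by
  refine continuous_pi fun i => ?_
  exact Complex.continuous_re.comp (continuous_subtype_val.matrix_elem i i)

theorem diagMat_mem_of_mem {W : Submodule ℝ (Herm N)} (hW : W = ⊤ ∨ W = Herm₀ N) {S : Herm N}
    (hS : S ∈ W) : diagMat (diagVec S) ∈ W := by
  rcases hW with rfl | rfl
  · trivial
  · rw [Herm₀, LinearMap.mem_ker, trForm_eq_sum_diagVec] at hS ⊢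
    rwa [diagVec_diagMat]

theorem conj_mem {W : Submodule ℝ (Herm N)} (hW : W = ⊤ ∨ W = Herm₀ N) (U : UGroup N)
    {S : Herm N} (hS : S ∈ W) : conj U S ∈ W := by
  rcases hW with rfl | rfl
  · trivial
  · rw [Herm₀, LinearMap.mem_ker] at hS ⊢
    rwa [trForm_conj]

/-! ### Diagonalisation and permutation of eigenvalues -/

theorem exists_conj_diagMat_eigenvalues (R : Herm N) :
    ∃ V : UGroup N, R = conj V (diagMat (isHermitian R).eigenvalues) := by
  refine ⟨(isHermitian R).eigenvectorUnitary, Subtype.ext ?_⟩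
  have := (isHermitian R).spectral_theorem
  rw [Unitary.conjStarAlgAut_apply] at this
  exact this

/-- The unitary matrix of a permutation. -/
def permUnitary (σ : Equiv.Perm (Fin N)) : UGroup N :=
  ⟨σ.permMatrix ℂ, by
    rw [Matrix.mem_unitaryGroup_iff, Matrix.star_eq_conjTranspose, Matrix.conjTranspose_permMatrix,
      ← Matrix.permMatrix_mul]
    simp⟩

theorem conj_permUnitary (σ : Equiv.Perm (Fin N)) (r : Fin N → ℝ) :
    conj (permUnitary σ) (diagMat r) = diagMat (r ∘ σ) := by
  refine Subtype.ext ?_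
  ext i j
  simp [conj, permUnitary, diagMat, Matrix.conjTranspose_permMatrix, Equiv.Perm.permMatrix,
    PEquiv.toMatrix_toPEquiv_mul, PEquiv.mul_toMatrix_toPEquiv, Matrix.diagonal_apply,
    Equiv.Perm.inv_def]

end Geometry

/-! ### The unitary group -/

section Unitary

variable {N : ℕ}

instance instCompactSpaceUGroup (N : ℕ) : CompactSpace (UGroup N) := by
  refine (isCompact_iff_compactSpace (s := (Matrix.unitaryGroup (Fin N) ℂ :
    Set (Matrix (Fin N) (Fin N) ℂ)))).1 ?_
  have hK : IsCompact (Set.pi Set.univ fun _ : Fin N => Set.pi Set.univ fun _ : Fin N =>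
      Metric.closedBall (0 : ℂ) 1) :=
    isCompact_univ_pi fun _ => isCompact_univ_pi fun _ => isCompact_closedBall _ _
  refine IsCompact.of_isClosed_subset hK ?_ ?_
  · have : {U : Matrix (Fin N) (Fin N) ℂ | U * star U = 1} =
        (Matrix.unitaryGroup (Fin N) ℂ : Set (Matrix (Fin N) (Fin N) ℂ)) := by
      ext R; simp [Matrix.mem_unitaryGroup_iff]
    exact this ▸ isClosed_eq (by fun_prop) continuous_const
  · intro U hU i _ j _
    rw [mem_closedBall_zero_iff]
    exact entry_norm_bound_of_unitary hU i j

instance instSecondCountableTopologyMatrix (N : ℕ) :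
    SecondCountableTopology (Matrix (Fin N) (Fin N) ℂ) :=
  inferInstanceAs (SecondCountableTopology (Fin N → Fin N → ℂ))

instance instSecondCountableTopologyUGroup (N : ℕ) : SecondCountableTopology (UGroup N) :=
  TopologicalSpace.Subtype.secondCountableTopology _

instance instMeasurableMul₂UGroup (N : ℕ) : MeasurableMul₂ (UGroup N) := ⟨by
  exact (continuous_mul (M := UGroup N)).measurable⟩

/-- On a compact group a Haar probability measure is unique, hence invariant from both sides. -/
theorem isMulRightInvariant_of_isHaarMeasure (μ : Measure (UGroup N)) [IsProbabilityMeasure μ]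
    [μ.IsHaarMeasure] : μ.IsMulRightInvariant := ⟨fun g => by
  have hm : Measurable (fun x : UGroup N => x * g) := measurable_mul_const g
  have : IsProbabilityMeasure (μ.map (· * g)) := Measure.isProbabilityMeasure_map hm.aemeasurable
  exact Measure.isHaarMeasure_eq_of_isProbabilityMeasure _ _⟩

end Unitary

/-! ### Measurability of the ordered eigenvalues -/

section Eigenvalues

variable {N : ℕ}

/-- Vectors listed in the order that Mathlib uses for the eigenvalues of a Hermitian matrix. -/
def orderedVecs (N : ℕ) : Set (Fin N → ℝ) :=
  {x | Antitone (x ∘ (Fintype.equivOfCardEq (Fintype.card_fin _) :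
    Fin (Fintype.card (Fin N)) ≃ Fin N))}

theorem eigenvalues_mem_orderedVecs (R : Herm N) :
    (isHermitian R).eigenvalues ∈ orderedVecs N := by
  have : (isHermitian R).eigenvalues ∘ (Fintype.equivOfCardEq (Fintype.card_fin _) :
    Fin (Fintype.card (Fin N)) ≃ Fin N) = (isHermitian R).eigenvalues₀ := by
    ext i
    simp [Matrix.IsHermitian.eigenvalues]
  rw [orderedVecs, Set.mem_ofPred_eq, this]
  exact (isHermitian R).eigenvalues₀_antitone

theorem isClosed_orderedVecs : IsClosed (orderedVecs N) := by
  have h : Continuous fun x : Fin N → ℝ => x ∘ (Fintype.equivOfCardEq (Fintype.card_fin _) :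
    Fin (Fintype.card (Fin N)) ≃ Fin N) := by fun_prop
  exact IsClosed.preimage h isClosed_antitone

/-- The ordered eigenvalues of `V diag(x) V†` are `x` itself when `x` is ordered, since both are the
sorted list of the roots of the characteristic polynomial. -/
theorem eigenvalues_conj_diagMat {x : Fin N → ℝ} (hx : x ∈ orderedVecs N) (V : UGroup N) :
    (isHermitian (conj V (diagMat x))).eigenvalues = x := by
  set e := (Fintype.equivOfCardEq (Fintype.card_fin _) :
    Fin (Fintype.card (Fin N)) ≃ Fin N) with he
  set R := conj V (diagMat x) with hR
  have hroots : (R : Matrix (Fin N) (Fin N) ℂ).charpoly.roots =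
      Multiset.map (fun i => (x i : ℂ)) Finset.univ.val := by
    have h1 : (R : Matrix (Fin N) (Fin N) ℂ).charpoly
        = ∏ i, (Polynomial.X - Polynomial.C (x i : ℂ)) := by
      have hV : (V : Matrix (Fin N) (Fin N) ℂ)ᴴ * (V : Matrix (Fin N) (Fin N) ℂ) = 1 :=
        Matrix.mem_unitaryGroup_iff'.1 V.2
      simp only [hR, conj]
      rw [Matrix.charpoly_mul_comm, ← mul_assoc, hV, one_mul, diagMat, Matrix.charpoly_diagonal]
    rw [h1, Polynomial.roots_prod]
    · simp
    · exact Finset.prod_ne_zero_iff.2 fun i _ => Polynomial.X_sub_C_ne_zero _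
  have h2 := (isHermitian R).sort_roots_charpoly_eq_eigenvalues₀
  rw [hroots, Multiset.map_map] at h2
  have h3 : List.ofFn (x ∘ e) = List.ofFn (isHermitian R).eigenvalues₀ := by
    refine List.Perm.eq_of_sortedGE (List.sortedGE_ofFn_iff.2 hx)
      (List.sortedGE_ofFn_iff.2 (isHermitian R).eigenvalues₀_antitone) ?_
    rw [← Multiset.coe_eq_coe, ← h2, Multiset.sort_eq]
    rw [← Fin.univ_val_map, ← Multiset.map_map]
    simp
  have h4 := List.ofFn_injective h3
  ext i
  rw [Matrix.IsHermitian.eigenvalues, ← h4]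
  simp [he]

theorem continuous_conj_diagMat :
    Continuous fun p : (Fin N → ℝ) × UGroup N => conj p.2 (diagMat p.1) := by
  have h : Continuous fun p : (Fin N → ℝ) × UGroup N => (p.2, diagMat p.1) :=
    continuous_snd.prodMk (continuous_diagMat.comp continuous_fst)
  have h2 := continuous_conj.comp h
  exact h2

theorem isCompact_image_conj_diagMat {A : Set (Fin N → ℝ)} (hA : IsCompact A) :
    IsCompact ((fun p : (Fin N → ℝ) × UGroup N => conj p.2 (diagMat p.1)) '' (A ×ˢ Set.univ)) := by
  have h1 : IsCompact (A ×ˢ (Set.univ : Set (UGroup N))) := hA.prod isCompact_univ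
  exact h1.image continuous_conj_diagMat

/-- The matrices with ordered spectrum in `C` form a countable union of images of
`(bounded part of C) × U(N)`; these images are compact when `C` is closed. -/
theorem preimage_eigenvalues_eq_iUnion (C : Set (Fin N → ℝ)) :
    (fun R : Herm N => (isHermitian R).eigenvalues) ⁻¹' C = ⋃ n : ℕ,
      (fun p : (Fin N → ℝ) × UGroup N => conj p.2 (diagMat p.1)) ''
        ((orderedVecs N ∩ C ∩ Metric.closedBall 0 n) ×ˢ Set.univ) := by
  ext R
  rw [Set.mem_preimage, Set.mem_iUnion]
  constructor
  · intro hR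
    obtain ⟨V, hV⟩ := exists_conj_diagMat_eigenvalues R
    obtain ⟨n, hn⟩ := exists_nat_ge ‖(isHermitian R).eigenvalues‖
    exact ⟨n, ⟨(isHermitian R).eigenvalues, V⟩, ⟨⟨⟨eigenvalues_mem_orderedVecs R, hR⟩,
      mem_closedBall_zero_iff.2 hn⟩, Set.mem_univ _⟩, hV.symm⟩
  · rintro ⟨n, ⟨x, V⟩, ⟨⟨⟨hx, hxC⟩, -⟩, -⟩, rfl⟩
    have := eigenvalues_conj_diagMat hx V
    rw [← this] at hxC
    exact hxC

theorem measurable_eigenvalues :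
    Measurable fun R : Herm N => (isHermitian R).eigenvalues := by
  refine measurable_of_isClosed fun C hC => ?_
  rw [preimage_eigenvalues_eq_iUnion]
  refine MeasurableSet.iUnion fun n => (isCompact_image_conj_diagMat ?_).measurableSet
  exact (isCompact_closedBall (0 : Fin N → ℝ) (n : ℝ)).inter_left (isClosed_orderedVecs.inter hC)

/-- The eigenvalues in any order are the diagonal of a unitary conjugate. -/
theorem conj_conj_permUnitary_eigenvalues (R : Herm N) (σ : Equiv.Perm (Fin N)) :
    ∃ V : UGroup N, diagMat (fun i => (isHermitian R).eigenvalues (σ i)) = conj V R := by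
  obtain ⟨V, hV⟩ := exists_conj_diagMat_eigenvalues R
  refine ⟨permUnitary σ * V⁻¹, ?_⟩
  rw [← conj_conj]
  conv_rhs => rw [hV]
  rw [conj_inv_conj, conj_permUnitary]
  rfl

end Eigenvalues

/-! ### The function `ν_α` -/

section Exponent

theorem nu_re (α u : ℝ) : (nu α u).re = |u| ^ α := by
  unfold nu
  split_ifs with h
  · subst h
    have : (2 * Complex.I / (Real.pi : ℂ) * (Real.sign u : ℂ) * (Real.log |u| : ℂ))
        = Complex.I * ((2 / Real.pi * Real.sign u * Real.log |u| : ℝ) : ℂ) := by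
      push_cast; ring
    rw [this]
    simp
  · have : (Complex.I * (Real.sign u : ℂ) * (Real.tan (Real.pi * α / 2) : ℂ))
        = Complex.I * ((Real.sign u * Real.tan (Real.pi * α / 2) : ℝ) : ℂ) := by
      push_cast; ring
    rw [this, Complex.re_ofReal_mul, Complex.sub_re, Complex.I_mul_re, Complex.ofReal_im]
    simp

theorem measurable_sign : Measurable Real.sign := by
  have : Real.sign = fun r : ℝ => if r < 0 then -1 else if 0 < r then 1 else 0 := by
    ext r; exact Real.sign.eq_1 r
  rw [this]
  exact Measurable.ite measurableSet_Iio measurable_const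
    (Measurable.ite measurableSet_Ioi measurable_const measurable_const)

theorem measurable_nu (α : ℝ) : Measurable (nu α) := by
  have hs := measurable_sign
  have ha : Measurable fun u : ℝ => |u| := measurable_id.abs
  unfold nu
  split_ifs with h
  · have hl : Measurable fun u : ℝ => Real.log |u| := Real.measurable_log.comp ha
    exact (Complex.measurable_ofReal.comp ha).mul (measurable_const.add
      ((measurable_const.mul (Complex.measurable_ofReal.comp hs)).mul
        (Complex.measurable_ofReal.comp hl)))
  · exact (Complex.measurable_ofReal.comp (ha.pow_const α)).mul (measurable_const.sub
      ((measurable_const.mul (Complex.measurable_ofReal.comp hs)).mul measurable_const))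

/-- The coefficient of the linear term that the logarithm produces in `ν_α (ρ u)`. -/
def logShift (α ρ : ℝ) : ℝ := if α = 1 then 2 / Real.pi * (ρ * Real.log ρ) else 0

theorem abs_mul_sign (u : ℝ) : |u| * Real.sign u = u := by
  rcases lt_trichotomy u 0 with h | h | h
  · rw [Real.sign_of_neg h, abs_of_neg h]; ring
  · simp [h]
  · rw [Real.sign_of_pos h, abs_of_pos h, mul_one]

/-- `ν_α` is homogeneous of degree `α`, up to a linear imaginary term that is present only for
`α = 1`. -/
theorem nu_mul (α : ℝ) {ρ : ℝ} (hρ : 0 < ρ) (u : ℝ) :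
    nu α (ρ * u) = (ρ ^ α : ℝ) * nu α u + Complex.I * (logShift α ρ * u : ℝ) := by
  have hsign : Real.sign (ρ * u) = Real.sign u := by
    rcases lt_trichotomy u 0 with h | h | h
    · rw [Real.sign_of_neg h, Real.sign_of_neg (mul_neg_of_pos_of_neg hρ h)]
    · simp [h]
    · rw [Real.sign_of_pos h, Real.sign_of_pos (mul_pos hρ h)]
  unfold nu logShift
  split_ifs with h
  · subst h
    rcases eq_or_ne u 0 with rfl | hu
    · simp
    have hlog : Real.log |ρ * u| = Real.log ρ + Real.log |u| := by
      rw [abs_mul, abs_of_pos hρ, Real.log_mul hρ.ne' (abs_ne_zero.2 hu)]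
    have hcs : ((|u| : ℝ) : ℂ) * (Real.sign u : ℂ) = (u : ℂ) := by
      rw [← Complex.ofReal_mul, abs_mul_sign]
    rw [hlog, hsign, abs_mul, abs_of_pos hρ, Real.rpow_one]
    push_cast
    linear_combination (2 * Complex.I / Real.pi * ρ * Real.log ρ : ℂ) * hcs
  · rw [hsign, abs_mul, abs_of_pos hρ, Real.mul_rpow hρ.le (abs_nonneg u)]
    push_cast
    ring

theorem exists_norm_nu_le {α : ℝ} (hα : 0 < α) :
    ∃ B : ℝ, 0 ≤ B ∧ ∀ u : ℝ, |u| ≤ 1 → ‖nu α u‖ ≤ B := by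
  have hsgn : ∀ u : ℝ, ‖((Real.sign u : ℝ) : ℂ)‖ ≤ 1 := fun u => by
    rw [Complex.norm_real]
    rcases Real.sign_apply_eq u with h | h | h <;> simp [h]
  rcases eq_or_ne α 1 with rfl | h1
  · refine ⟨1 + 2 / Real.pi, by positivity, fun u hu => ?_⟩
    rcases eq_or_ne u 0 with rfl | hu0
    · simp [nu]; positivity
    have h2 : |(Real.log |u|) * (|u|)| ≤ 1 := (Real.abs_log_mul_self_lt _ (abs_pos.2 hu0) hu).le
    have e : nu 1 u = (|u| : ℝ) + 2 * Complex.I / Real.pi * (Real.sign u : ℂ) *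
        ((Real.log |u| * |u| : ℝ) : ℂ) := by
      simp only [nu, if_true]; push_cast; ring
    rw [e]
    refine (norm_add_le _ _).trans (add_le_add ?_ ?_)
    · rwa [Complex.norm_real, Real.norm_eq_abs, abs_abs]
    · rw [norm_mul, norm_mul, Complex.norm_real (Real.log (|u|) * |u|), Real.norm_eq_abs]
      have h3 : ‖2 * Complex.I / (Real.pi : ℂ)‖ = 2 / Real.pi := by
        simp [abs_of_pos Real.pi_pos]
      rw [h3]
      calc 2 / Real.pi * ‖((Real.sign u : ℝ) : ℂ)‖ * |(Real.log |u|) * (|u|)|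
          ≤ 2 / Real.pi * 1 * 1 := by
            have := hsgn u
            gcongr
        _ = _ := by ring
  · refine ⟨1 * (1 + 1 * 1 * |Real.tan (Real.pi * α / 2)|), by positivity, fun u hu => ?_⟩
    rw [nu, if_neg h1, norm_mul]
    have ha : ‖((|u| ^ α : ℝ) : ℂ)‖ ≤ 1 := by
      rw [Complex.norm_real, Real.norm_of_nonneg (by positivity)]
      exact Real.rpow_le_one (abs_nonneg _) hu hα.le
    refine mul_le_mul ha ?_ (norm_nonneg _) zero_le_one
    refine (norm_sub_le _ _).trans (add_le_add (by simp) ?_)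
    rw [norm_mul, norm_mul, Complex.norm_I, Complex.norm_real (Real.tan _), Real.norm_eq_abs]
    have := hsgn u
    gcongr

theorem exists_norm_nu_le_of_abs_le {α : ℝ} (hα : 0 < α) (ρ : ℝ) :
    ∃ B : ℝ, 0 ≤ B ∧ ∀ u : ℝ, |u| ≤ ρ → ‖nu α u‖ ≤ B := by
  obtain ⟨B, hB0, hB⟩ := exists_norm_nu_le hα
  set σ : ℝ := max ρ 1
  have hσ : 0 < σ := lt_of_lt_of_le one_pos (le_max_right _ _)
  refine ⟨σ ^ α * B + |logShift α σ|, by positivity, fun u hu => ?_⟩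
  have hu1 : |u / σ| ≤ 1 := by
    rw [abs_div, abs_of_pos hσ, div_le_one hσ]
    exact hu.trans (le_max_left _ _)
  have e : u = σ * (u / σ) := by field_simp
  rw [e, nu_mul α hσ]
  refine (norm_add_le _ _).trans (add_le_add ?_ ?_)
  · rw [norm_mul, Complex.norm_real, Real.norm_of_nonneg (by positivity)]
    gcongr
    exact hB _ hu1
  · rw [norm_mul, Complex.norm_I, one_mul, Complex.norm_real, Real.norm_eq_abs, abs_mul]
    exact mul_le_of_le_one_right (abs_nonneg _) hu1

end Exponent

/-! ### Averages of exponentials -/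

section Averages

variable {Ω : Type*} [MeasurableSpace Ω] {P : Measure Ω} [IsProbabilityMeasure P]

theorem norm_exp_neg_sub_le {z : ℂ} (hz : 0 ≤ z.re) :
    ‖Complex.exp (-z) - 1 + z‖ ≤ 3 * ‖z‖ ^ 2 := by
  rcases le_total ‖z‖ 1 with h | h
  · have := Complex.norm_exp_sub_one_sub_id_le (x := -z) (by rwa [norm_neg])
    rw [sub_neg_eq_add, norm_neg] at this
    nlinarith [sq_nonneg ‖z‖]
  · have h1 : ‖Complex.exp (-z)‖ ≤ 1 := by
      rw [Complex.norm_exp]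
      simpa using hz
    have h2 : ‖Complex.exp (-z) - 1 + z‖ ≤ ‖Complex.exp (-z)‖ + ‖(1 : ℂ)‖ + ‖z‖ :=
      (norm_add_le _ _).trans (add_le_add_left (norm_sub_le _ _) _)
    rw [norm_one] at h2
    nlinarith

theorem integrable_exp_neg {Z : Ω → ℂ} (hZ : Measurable Z) (hre : ∀ ω, 0 ≤ (Z ω).re) :
    Integrable (fun ω => Complex.exp (-Z ω)) P := by
  refine Integrable.of_bound (Complex.measurable_exp.comp hZ.neg).aestronglyMeasurable 1
    (ae_of_all _ fun ω => ?_)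
  rw [Complex.norm_exp]
  simpa using hre ω

/-- Moving the average inside the exponential costs an error of second order. -/
theorem norm_integral_exp_neg_sub_exp_neg_integral_le {Z : Ω → ℂ} {b : ℝ} (hZ : Measurable Z)
    (hre : ∀ ω, 0 ≤ (Z ω).re) (hb : ∀ ω, ‖Z ω‖ ≤ b) :
    ‖(∫ ω, Complex.exp (-Z ω) ∂P) - Complex.exp (-∫ ω, Z ω ∂P)‖ ≤ 6 * b ^ 2 := by
  have hi : Integrable Z P := Integrable.of_bound hZ.aestronglyMeasurable b (ae_of_all _ hb)
  have hie := integrable_exp_neg (P := P) hZ hre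
  have hmre : 0 ≤ (∫ ω, Z ω ∂P).re := by
    have := integral_re (𝕜 := ℂ) hi
    simp only [RCLike.re_to_complex] at this
    rw [← this]
    exact integral_nonneg hre
  have hmb : ‖∫ ω, Z ω ∂P‖ ≤ b := by
    have := norm_integral_le_of_norm_le_const (μ := P) (ae_of_all _ hb)
    simpa using this
  have hb0 : 0 ≤ b := (norm_nonneg _).trans hmb
  have h1 : ‖∫ ω, (Complex.exp (-Z ω) - 1 + Z ω) ∂P‖ ≤ 3 * b ^ 2 := by
    have := norm_integral_le_of_norm_le_const (μ := P) (C := 3 * b ^ 2)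
      (f := fun ω => Complex.exp (-Z ω) - 1 + Z ω) (ae_of_all _ fun ω => by
        refine (norm_exp_neg_sub_le (hre ω)).trans ?_
        have := hb ω
        gcongr)
    simpa using this
  have h2 : ‖Complex.exp (-∫ ω, Z ω ∂P) - 1 + ∫ ω, Z ω ∂P‖ ≤ 3 * b ^ 2 :=
    (norm_exp_neg_sub_le hmre).trans (by gcongr)
  have e : (∫ ω, Complex.exp (-Z ω) ∂P) - Complex.exp (-∫ ω, Z ω ∂P)
      = (∫ ω, (Complex.exp (-Z ω) - 1 + Z ω) ∂P)
        - (Complex.exp (-∫ ω, Z ω ∂P) - 1 + ∫ ω, Z ω ∂P) := by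
    have h3 : Integrable (fun ω => Complex.exp (-Z ω) - 1) P := hie.sub (integrable_const _)
    rw [integral_add h3 hi, integral_sub hie (integrable_const _)]
    simp
  rw [e]
  exact (norm_sub_le _ _).trans (by linarith)

theorem exp_neg_le_one_sub_div {x B : ℝ} (hx : 0 ≤ x) (hB : x ≤ B) :
    Real.exp (-x) ≤ 1 - x / (1 + B) := by
  have h1 : Real.exp (-x) ≤ 1 / (1 + x) := by
    rw [Real.exp_neg, ← one_div]
    exact one_div_le_one_div_of_le (by linarith) (by linarith [Real.add_one_le_exp x])
  have h2 : 1 / (1 + x) = 1 - x / (1 + x) := by field_simp; ring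
  have h3 : x / (1 + B) ≤ x / (1 + x) := by gcongr
  linarith

/-- For a bounded nonnegative variable the Laplace transform is at most an exponential in the mean;
this reverses Jensen's inequality at the cost of the factor `1 + B`. -/
theorem integral_exp_neg_le {X : Ω → ℝ} {B : ℝ} (hX : Measurable X) (h0 : ∀ ω, 0 ≤ X ω)
    (hB : ∀ ω, X ω ≤ B) :
    ∫ ω, Real.exp (-X ω) ∂P ≤ Real.exp (-(∫ ω, X ω ∂P) / (1 + B)) := by
  have hi : Integrable X P := Integrable.of_bound hX.aestronglyMeasurable B
    (ae_of_all _ fun ω => by rw [Real.norm_of_nonneg (h0 ω)]; exact hB ω)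
  have hie : Integrable (fun ω => Real.exp (-X ω)) P :=
    Integrable.of_bound (Real.measurable_exp.comp hX.neg).aestronglyMeasurable 1
    (ae_of_all _ fun ω => by
      rw [Real.norm_of_nonneg (Real.exp_pos _).le, Real.exp_le_one_iff]; linarith [h0 ω])
  calc ∫ ω, Real.exp (-X ω) ∂P ≤ ∫ ω, (1 - X ω / (1 + B)) ∂P :=
        integral_mono hie ((integrable_const _).sub (hi.div_const _))
          fun ω => exp_neg_le_one_sub_div (h0 ω) (hB ω)
    _ = 1 - (∫ ω, X ω ∂P) / (1 + B) := by
        rw [integral_sub (integrable_const _) (hi.div_const _), integral_div]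
        simp
    _ ≤ _ := by
        have := Real.add_one_le_exp (-(∫ ω, X ω ∂P) / (1 + B))
        rw [neg_div] at this ⊢
        linarith

end Averages

/-! ### Nondegenerate measures on the sphere -/

section LowerBound

variable {E : Type*} [NormedAddCommGroup E] [InnerProductSpace ℝ E] [FiniteDimensional ℝ E]
  [MeasurableSpace E] [BorelSpace E]

/-- A measure on the unit sphere that is not carried by any hyperplane of `V` has fractional
moments bounded below along the directions of `V`, by compactness. -/
theorem exists_le_integral_abs_inner_rpow {ρ : Measure E} [IsProbabilityMeasure ρ]
    (V : Submodule ℝ E) {α : ℝ} (hα : 0 < α) (hρ : ∀ᵐ R ∂ρ, ‖R‖ = 1)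
    (h : ∀ S ∈ V, (∀ᵐ R ∂ρ, inner ℝ R S = 0) → S = 0) :
    ∃ c : ℝ, 0 < c ∧ ∀ S ∈ V, c * ‖S‖ ^ α ≤ ∫ R, |inner ℝ R S| ^ α ∂ρ := by
  have hle : ∀ S : E, ∀ᵐ R ∂ρ, |inner ℝ R S| ^ α ≤ ‖S‖ ^ α := fun S => by
    filter_upwards [hρ] with R hR
    have := abs_real_inner_le_norm R S
    rw [hR, one_mul] at this
    gcongr
  have hm : ∀ S : E, Measurable fun R : E => |inner ℝ R S| ^ α := fun S =>
    (Measurable.abs (by fun_prop)).pow_const α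
  have hint : ∀ S : E, Integrable (fun R : E => |inner ℝ R S| ^ α) ρ := fun S => by
    refine Integrable.of_bound (hm S).aestronglyMeasurable (‖S‖ ^ α) ?_
    filter_upwards [hle S] with R hR
    rwa [Real.norm_of_nonneg (by positivity)]
  set K : Set E := (V : Set E) ∩ Metric.sphere 0 1
  have hK : IsCompact K := (isCompact_sphere 0 1).inter_left V.closed_of_finiteDimensional
  have hcont : ContinuousOn (fun S : E => ∫ R, |inner ℝ R S| ^ α ∂ρ) K := by
    refine continuousOn_of_dominated (bound := fun _ => 1) ?_ ?_ (integrable_const _) ?_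
    · exact fun S _ => (hm S).aestronglyMeasurable
    · intro S hS
      filter_upwards [hle S] with R hR
      rw [Real.norm_of_nonneg (by positivity)]
      refine hR.trans (le_of_eq ?_)
      rw [mem_sphere_zero_iff_norm.1 hS.2, Real.one_rpow]
    · refine ae_of_all _ fun R => Continuous.continuousOn ?_
      exact (Continuous.abs (by fun_prop)).rpow_const fun S => Or.inr hα.le
  have hpos : ∀ S ∈ K, 0 < ∫ R, |inner ℝ R S| ^ α ∂ρ := by
    intro S hS
    refine lt_of_le_of_ne (integral_nonneg fun _ => by positivity) fun h0 => ?_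
    have h1 := (integral_eq_zero_iff_of_nonneg (fun _ => by positivity) (hint S)).1 h0.symm
    have h2 : S = 0 := h S hS.1 (by
      filter_upwards [h1] with R hR
      have := (Real.rpow_eq_zero (abs_nonneg _) hα.ne').1 hR
      exact abs_eq_zero.1 this)
    have h3 := mem_sphere_zero_iff_norm.1 hS.2
    rw [h2, norm_zero] at h3
    exact zero_ne_one h3
  obtain ⟨c, hc, hcK⟩ : ∃ c : ℝ, 0 < c ∧ ∀ S ∈ K, c ≤ ∫ R, |inner ℝ R S| ^ α ∂ρ := by
    rcases K.eq_empty_or_nonempty with he | hne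
    · exact ⟨1, one_pos, by simp [he]⟩
    · obtain ⟨S, hS, hmin⟩ := hK.exists_isMinOn hne hcont
      exact ⟨_, hpos S hS, fun T hT => hmin hT⟩
  refine ⟨c, hc, fun S hS => ?_⟩
  rcases eq_or_ne S 0 with rfl | hS0
  · rw [norm_zero, Real.zero_rpow hα.ne', mul_zero]
    exact integral_nonneg fun _ => by positivity
  have hn : 0 < ‖S‖ := norm_pos_iff.2 hS0
  have h1 := hcK (‖S‖⁻¹ • S) ⟨V.smul_mem _ hS, by
    rw [mem_sphere_zero_iff_norm, norm_smul, norm_inv, norm_norm, inv_mul_cancel₀ hn.ne']⟩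
  have h2 : ∀ R : E, |inner ℝ R (‖S‖⁻¹ • S)| ^ α = (‖S‖ ^ α)⁻¹ * |inner ℝ R S| ^ α := fun R => by
    rw [inner_smul_right, abs_mul, abs_of_pos (inv_pos.2 hn),
      Real.mul_rpow (by positivity) (abs_nonneg _), Real.inv_rpow hn.le]
  simp only [h2] at h1
  rw [integral_const_mul, ← div_eq_inv_mul, le_div_iff₀ (by positivity)] at h1
  exact h1

end LowerBound

/-! ### The eigenvalue part of a spectral measure -/

section EigPart

variable {N : ℕ} {H : Measure (Herm N)}

theorem measurable_eigenvalues_perm (σ : Equiv.Perm (Fin N)) :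
    Measurable fun (R : Herm N) i => (isHermitian R).eigenvalues (σ i) :=
  measurable_pi_lambda _ fun i => (measurable_pi_apply (σ i)).comp measurable_eigenvalues

theorem factorial_inv_ne_zero : ((N.factorial : ℝ≥0∞)⁻¹) ≠ 0 :=
  ENNReal.inv_ne_zero.2 (ENNReal.natCast_ne_top _)

theorem ae_eigPart_iff {p : (Fin N → ℝ) → Prop} (hp : MeasurableSet {r | p r}) :
    (∀ᵐ r ∂eigPart H, p r) ↔ ∀ σ : Equiv.Perm (Fin N),
      ∀ᵐ R ∂H, p fun i => (isHermitian R).eigenvalues (σ i) := by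
  have h1 : (∀ᵐ r ∂eigPart H, p r) ↔ ∀ σ : Equiv.Perm (Fin N), ∀ᵐ r ∂(((N.factorial : ℝ≥0∞)⁻¹) •
    H.map fun (R : Herm N) i => (isHermitian R).eigenvalues (σ i)), p r := by
    simp only [ae_iff, eigPart, Measure.coe_finsetSum, Finset.sum_apply, Finset.sum_eq_zero_iff,
      Finset.mem_univ, true_imp_iff]
  rw [h1]
  refine forall_congr' fun σ => ?_
  rw [Measure.ae_ennreal_smul_measure_iff factorial_inv_ne_zero,
    ae_map_iff (measurable_eigenvalues_perm σ).aemeasurable hp]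

theorem isProbabilityMeasure_eigPart [IsProbabilityMeasure H] :
    IsProbabilityMeasure (eigPart H) := ⟨by
  have h : ∀ σ : Equiv.Perm (Fin N), (H.map fun (R : Herm N) i =>
      (isHermitian R).eigenvalues (σ i)) Set.univ = 1 := fun σ => by
    rw [Measure.map_apply (measurable_eigenvalues_perm σ) MeasurableSet.univ, Set.preimage_univ,
      measure_univ]
  simp only [eigPart, Measure.coe_finsetSum, Finset.sum_apply, Measure.smul_apply, h, smul_eq_mul,
    mul_one, Finset.sum_const, Finset.card_univ, Fintype.card_perm, Fintype.card_fin, nsmul_eq_mul]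
  exact ENNReal.mul_inv_cancel (by exact_mod_cast N.factorial_ne_zero) (ENNReal.natCast_ne_top _)⟩

theorem integral_eigPart {F : Type*} [NormedAddCommGroup F] [NormedSpace ℝ F]
    {f : (Fin N → ℝ) → F} (hf : Integrable f (eigPart H)) :
    ∫ r, f r ∂eigPart H = ∑ σ : Equiv.Perm (Fin N), ((N.factorial : ℝ)⁻¹) •
      ∫ R, f (fun i => (isHermitian R).eigenvalues (σ i)) ∂H := by
  rw [eigPart] at hf ⊢
  have hi : ∀ σ ∈ (Finset.univ : Finset (Equiv.Perm (Fin N))), Integrable f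
      (((N.factorial : ℝ≥0∞)⁻¹) • H.map fun (R : Herm N) i => (isHermitian R).eigenvalues (σ i)) :=
    integrable_finsetSum_measure.1 hf
  rw [integral_finsetSum_measure hi]
  refine Finset.sum_congr rfl fun σ hσ => ?_
  have h2 := (integrable_smul_measure factorial_inv_ne_zero
    (ENNReal.inv_ne_top.2 (by exact_mod_cast N.factorial_ne_zero))).1 (hi σ hσ)
  rw [integral_smul_measure,
    integral_map (measurable_eigenvalues_perm σ).aemeasurable h2.aestronglyMeasurable]
  simp

/-- The eigenvalue part is permutation invariant. -/
theorem map_eigPart_perm (τ : Equiv.Perm (Fin N)) :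
    (eigPart H).map (fun r : Fin N → ℝ => r ∘ τ) = eigPart H := by
  have hm : Measurable fun r : Fin N → ℝ => r ∘ τ :=
    measurable_pi_lambda _ fun i => measurable_pi_apply (τ i)
  have h : ∀ σ : Equiv.Perm (Fin N), (((N.factorial : ℝ≥0∞)⁻¹) •
      H.map fun (R : Herm N) i => (isHermitian R).eigenvalues (σ i)).map
        (fun r : Fin N → ℝ => r ∘ τ) = ((N.factorial : ℝ≥0∞)⁻¹) •
      H.map fun (R : Herm N) i => (isHermitian R).eigenvalues ((σ * τ) i) := fun σ => by
    rw [Measure.map_smul, Measure.map_map hm (measurable_eigenvalues_perm σ)]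
    rfl
  rw [eigPart, ← Measure.mapₗ_apply_of_measurable hm, map_sum]
  simp only [Measure.mapₗ_apply_of_measurable hm, h]
  exact Equiv.sum_comp (Equiv.mulRight τ) fun σ : Equiv.Perm (Fin N) => ((N.factorial : ℝ≥0∞)⁻¹) •
      H.map fun (R : Herm N) i => (isHermitian R).eigenvalues (σ i)

theorem integral_eigPart_apply_eq (i j : Fin N) :
    ∫ r, r i ∂eigPart H = ∫ r, r j ∂eigPart H := by
  have hm : Measurable fun r : Fin N → ℝ => r ∘ Equiv.swap i j :=
    measurable_pi_lambda _ fun k => measurable_pi_apply (Equiv.swap i j k)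
  rw [← map_eigPart_perm (Equiv.swap i j), integral_map hm.aemeasurable
    (measurable_pi_apply i).aestronglyMeasurable, map_eigPart_perm (Equiv.swap i j)]
  simp

theorem dotProduct_eq_trPair_eigenvalues (R : Herm N) (σ : Equiv.Perm (Fin N)) :
    ∃ V : UGroup N, ∀ S : Herm N, (fun i => (isHermitian R).eigenvalues (σ i)) ⬝ᵥ diagVec S
      = trPair (conj V R) S := by
  obtain ⟨V, hV⟩ := conj_conj_permUnitary_eigenvalues R σ
  exact ⟨V, fun S => by rw [← hV, trPair_diagMat]⟩

theorem ae_dotProduct_self_eigPart (h : ∀ᵐ R ∂H, trPair R R = 1) :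
    ∀ᵐ r ∂eigPart H, r ⬝ᵥ r = 1 := by
  have hm : MeasurableSet {r : Fin N → ℝ | r ⬝ᵥ r = 1} := by
    refine measurableSet_eq_fun ?_ measurable_const
    simp only [dotProduct]
    fun_prop
  rw [ae_eigPart_iff hm]
  intro σ
  filter_upwards [h] with R hR
  obtain ⟨V, hV⟩ := conj_conj_permUnitary_eigenvalues R σ
  have := trPair_diagMat (fun i => (isHermitian R).eigenvalues (σ i))
    (diagMat (fun i => (isHermitian R).eigenvalues (σ i)))
  rw [diagVec_diagMat] at this
  rw [← this, hV, trPair_conj_conj, hR]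

end EigPart

/-! ### Exponents of the two stable laws -/

section SpectralExponent

variable {N : ℕ} {H : Measure (Herm N)} {α : ℝ}

theorem abs_trPair_le {R S : Herm N} (hR : trPair R R = 1) :
    |trPair R S| ≤ √(trPair S S) := by
  let _ := hermNormed N
  let _ := hermInner N
  have h := abs_real_inner_le_norm R S
  rw [norm_eq_sqrt_real_inner R, norm_eq_sqrt_real_inner S, inner_eq_trPair, inner_eq_trPair,
    inner_eq_trPair, hR, Real.sqrt_one, one_mul] at h
  exact h

theorem abs_dotProduct_diagVec_le {r : Fin N → ℝ} (hr : r ⬝ᵥ r = 1) (S : Herm N) :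
    |r ⬝ᵥ diagVec S| ≤ √(trPair S S) := by
  rw [← trPair_diagMat]
  refine abs_trPair_le ?_
  rw [trPair_diagMat, diagVec_diagMat, hr]

theorem trPair_conj_self (U : UGroup N) (S : Herm N) : trPair (conj U S) (conj U S) = trPair S S :=
  trPair_conj_conj U S S

theorem measurable_dotProduct_diagVec (S : Herm N) :
    Measurable fun r : Fin N → ℝ => r ⬝ᵥ diagVec S := by
  simp only [dotProduct]; fun_prop

theorem measurable_trPair : Measurable fun p : Herm N × Herm N => trPair p.1 p.2 := by
  simp only [trPair_eq_sum]
  refine Finset.measurable_sum _ fun i _ => Finset.measurable_sum _ fun j _ => ?_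
  have h : ∀ i j : Fin N, Measurable fun R : Herm N => (R : Matrix (Fin N) (Fin N) ℂ) i j :=
    fun i j => (measurable_pi_apply j).comp ((measurable_pi_apply i).comp measurable_subtype_coe)
  have h1 : Measurable fun p : Herm N × Herm N => (p.1 : Matrix (Fin N) (Fin N) ℂ) i j :=
    (h i j).comp measurable_fst
  have h2 : Measurable fun p : Herm N × Herm N => (p.2 : Matrix (Fin N) (Fin N) ℂ) i j :=
    (h i j).comp measurable_snd
  exact ((Complex.measurable_re.comp h1).mul (Complex.measurable_re.comp h2)).add
    ((Complex.measurable_im.comp h1).mul (Complex.measurable_im.comp h2))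

/-- The exponent `∫ ν_α (r · diag S) H_eig(dr)` of the stable law of the eigenvalue part. -/
def eigExponent (α : ℝ) (H : Measure (Herm N)) (S : Herm N) : ℂ :=
  ∫ r, nu α (r ⬝ᵥ diagVec S) ∂eigPart H

/-- The exponent `∫ ν_α (tr R S) H(dR)` of the matrix stable law. -/
def matExponent (α : ℝ) (H : Measure (Herm N)) (S : Herm N) : ℂ :=
  ∫ R, nu α (trPair R S) ∂H

variable [IsProbabilityMeasure H]

theorem integrable_nu_dotProduct (hα : 0 < α) (hs : ∀ᵐ R ∂H, trPair R R = 1) (S : Herm N) :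
    Integrable (fun r => nu α (r ⬝ᵥ diagVec S)) (eigPart H) := by
  have := isProbabilityMeasure_eigPart (H := H)
  obtain ⟨B, -, hB⟩ := exists_norm_nu_le_of_abs_le hα (√(trPair S S))
  refine Integrable.of_bound
    ((measurable_nu α).comp (measurable_dotProduct_diagVec S)).aestronglyMeasurable B ?_
  filter_upwards [ae_dotProduct_self_eigPart hs] with r hr
  exact hB _ (abs_dotProduct_diagVec_le hr S)

theorem integrable_dotProduct_diagVec (hs : ∀ᵐ R ∂H, trPair R R = 1) (S : Herm N) :
    Integrable (fun r => r ⬝ᵥ diagVec S) (eigPart H) := by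
  have := isProbabilityMeasure_eigPart (H := H)
  refine Integrable.of_bound (measurable_dotProduct_diagVec S).aestronglyMeasurable
    (√(trPair S S)) ?_
  filter_upwards [ae_dotProduct_self_eigPart hs] with r hr
  exact abs_dotProduct_diagVec_le hr S

/-- By permutation invariance the mean of the eigenvalue part is `t₀` times the vector of ones. -/
theorem integral_dotProduct_diagVec (hs : ∀ᵐ R ∂H, trPair R R = 1) (S : Herm N) :
    ∫ r, r ⬝ᵥ diagVec S ∂eigPart H = tZero (eigPart H) * trForm N S := by
  have hi : ∀ i : Fin N, Integrable (fun r : Fin N → ℝ => r i) (eigPart H) := fun i => by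
    have := integrable_dotProduct_diagVec hs (diagMat (Pi.single i 1))
    simpa [diagVec_diagMat] using this
  rw [trForm_eq_sum_diagVec, tZero]
  simp only [dotProduct]
  rw [integral_finsetSum _ fun i _ => (hi i).mul_const _, integral_finsetSum _ fun i _ => hi i,
    Finset.mul_sum]
  refine Finset.sum_congr rfl fun i _ => ?_
  rw [integral_mul_const, Finset.sum_congr rfl fun j _ => integral_eigPart_apply_eq (H := H) j i]
  have hN : (N : ℝ) ≠ 0 := by
    have := i.pos
    positivity
  simp only [Finset.sum_const, Finset.card_univ, Fintype.card_fin, nsmul_eq_mul]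
  field_simp

theorem eigExponent_smul (hα : 0 < α) (hs : ∀ᵐ R ∂H, trPair R R = 1) {ρ : ℝ} (hρ : 0 < ρ)
    (S : Herm N) : eigExponent α H (ρ • S) = (ρ ^ α : ℝ) * eigExponent α H S +
      Complex.I * (logShift α ρ * (tZero (eigPart H) * trForm N S) : ℝ) := by
  have h : ∀ r : Fin N → ℝ, nu α (r ⬝ᵥ diagVec (ρ • S)) = (ρ ^ α : ℝ) * nu α (r ⬝ᵥ diagVec S) +
      Complex.I * (logShift α ρ * (r ⬝ᵥ diagVec S) : ℝ) := fun r => by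
    rw [diagVec_smul, dotProduct_smul, smul_eq_mul, nu_mul α hρ]
  have hi : Integrable (fun r : Fin N → ℝ => Complex.I * (logShift α ρ * (r ⬝ᵥ diagVec S) : ℝ))
      (eigPart H) :=
    (((integrable_dotProduct_diagVec hs S).const_mul _).ofReal).const_mul _
  simp only [eigExponent, h]
  rw [integral_add ((integrable_nu_dotProduct hα hs S).const_mul _) hi, integral_const_mul,
    integral_const_mul, integral_complex_ofReal, integral_const_mul,
    integral_dotProduct_diagVec hs]

theorem eigExponent_re (hα : 0 < α) (hs : ∀ᵐ R ∂H, trPair R R = 1) (S : Herm N) :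
    (eigExponent α H S).re = ∫ r, |r ⬝ᵥ diagVec S| ^ α ∂eigPart H := by
  have := integral_re (𝕜 := ℂ) (integrable_nu_dotProduct hα hs S)
  simp only [RCLike.re_to_complex, nu_re] at this
  exact this.symm

theorem eigExponent_re_nonneg (hα : 0 < α) (hs : ∀ᵐ R ∂H, trPair R R = 1) (S : Herm N) :
    0 ≤ (eigExponent α H S).re := by
  rw [eigExponent_re hα hs]
  exact integral_nonneg fun _ => by positivity

theorem exists_norm_eigExponent_le (hα : 0 < α) (hs : ∀ᵐ R ∂H, trPair R R = 1) :
    ∃ B : ℝ, 0 ≤ B ∧ ∀ S : Herm N, trPair S S ≤ 1 → ‖eigExponent α H S‖ ≤ B := by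
  have := isProbabilityMeasure_eigPart (H := H)
  obtain ⟨B, hB0, hB⟩ := exists_norm_nu_le hα
  refine ⟨B, hB0, fun S hS => ?_⟩
  have h := norm_integral_le_of_norm_le_const (μ := eigPart H) (C := B)
    (f := fun r => nu α (r ⬝ᵥ diagVec S)) (by
      filter_upwards [ae_dotProduct_self_eigPart hs] with r hr
      exact hB _ ((abs_dotProduct_diagVec_le hr S).trans (Real.sqrt_le_one.2 hS)))
  simpa [eigExponent] using h

theorem integrable_nu_trPair (hα : 0 < α) (hs : ∀ᵐ R ∂H, trPair R R = 1) (S : Herm N) :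
    Integrable (fun R => nu α (trPair R S)) H := by
  obtain ⟨B, -, hB⟩ := exists_norm_nu_le_of_abs_le hα (√(trPair S S))
  refine Integrable.of_bound ((measurable_nu α).comp
    (measurable_trPair.comp (measurable_id.prodMk measurable_const))).aestronglyMeasurable B ?_
  filter_upwards [hs] with R hR
  exact hB _ (abs_trPair_le hR)

theorem matExponent_re (hα : 0 < α) (hs : ∀ᵐ R ∂H, trPair R R = 1) (S : Herm N) :
    (matExponent α H S).re = ∫ R, |trPair R S| ^ α ∂H := by
  have := integral_re (𝕜 := ℂ) (integrable_nu_trPair hα hs S)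
  simp only [RCLike.re_to_complex, nu_re] at this
  exact this.symm

end SpectralExponent

/-! ### Rotations in coordinate planes -/

section Rotation

variable {N : ℕ}

/-- The rotation by the angle `θ` in the coordinate plane of `i` and `j`, with phase `w`. -/
def rotMat (i j : Fin N) (w : ℂ) (θ : ℝ) : Matrix (Fin N) (Fin N) ℂ :=
  1 + (Real.cos θ - 1 : ℂ) • (Matrix.single i i (1 : ℂ) + Matrix.single j j 1) +
    (Real.sin θ : ℂ) • (Matrix.single i j w - Matrix.single j i (star w))

theorem rotMat_mul {i j : Fin N} (hij : i ≠ j) {w : ℂ} (hw : w * star w = 1) (θ φ : ℝ) :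
    rotMat i j w θ * rotMat i j w φ = rotMat i j w (θ + φ) := by
  set P : Matrix (Fin N) (Fin N) ℂ := Matrix.single i i (1 : ℂ) + Matrix.single j j 1 with hP
  set A : Matrix (Fin N) (Fin N) ℂ := Matrix.single i j w - Matrix.single j i (star w) with hA
  have hw' : star w * w = 1 := by rw [mul_comm]; exact hw
  have hPP : P * P = P := by
    simp [hP, add_mul, mul_add, Matrix.single_mul_single_of_ne, hij, hij.symm]
  have hPA : P * A = A := by
    simp [hP, hA, add_mul, mul_sub, Matrix.single_mul_single_of_ne, hij, hij.symm]
  have hAP : A * P = A := by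
    simp [hP, hA, mul_add, sub_mul, Matrix.single_mul_single_of_ne, hij, hij.symm]
    abel
  have hAA : A * A = -P := by
    simp [hP, hA, mul_sub, sub_mul, Matrix.single_mul_single_of_ne, hij, hij.symm] at hw hw' ⊢
    rw [hw, hw']
    abel
  have h1 : rotMat i j w θ = 1 + (Real.cos θ - 1 : ℂ) • P + (Real.sin θ : ℂ) • A := rfl
  have h2 : rotMat i j w φ = 1 + (Real.cos φ - 1 : ℂ) • P + (Real.sin φ : ℂ) • A := rfl
  have h3 : rotMat i j w (θ + φ)
    = 1 + (Real.cos (θ + φ) - 1 : ℂ) • P + (Real.sin (θ + φ) : ℂ) • A := rfl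
  rw [h1, h2, h3]
  simp only [add_mul, mul_add, one_mul, mul_one, smul_mul_smul_comm, hPP, hPA, hAP, hAA,
    Real.cos_add, Real.sin_add, Complex.ofReal_sub, Complex.ofReal_add, Complex.ofReal_mul]
  module

theorem rotMat_zero (i j : Fin N) (w : ℂ) : rotMat i j w 0 = 1 := by
  simp [rotMat]

theorem star_rotMat (i j : Fin N) (w : ℂ) (θ : ℝ) :
    star (rotMat i j w θ) = rotMat i j w (-θ) := by
  simp only [rotMat, Matrix.star_eq_conjTranspose, Matrix.conjTranspose_add,
    Matrix.conjTranspose_smul, Matrix.conjTranspose_sub, Matrix.conjTranspose_single,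
    Matrix.conjTranspose_one, Real.cos_neg, Real.sin_neg, star_one, star_star]
  simp only [Complex.star_def, map_sub, Complex.conj_ofReal, map_one, Complex.ofReal_neg]
  module

theorem rotMat_mem_unitaryGroup {i j : Fin N} (hij : i ≠ j) {w : ℂ} (hw : w * star w = 1)
    (θ : ℝ) : rotMat i j w θ ∈ Matrix.unitaryGroup (Fin N) ℂ := by
  rw [Matrix.mem_unitaryGroup_iff, star_rotMat, rotMat_mul hij hw, add_neg_cancel, rotMat_zero]

/-- The rotations as unitary matrices. -/
def rot {i j : Fin N} (hij : i ≠ j) {w : ℂ} (hw : w * star w = 1) (θ : ℝ) : UGroup N :=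
  ⟨rotMat i j w θ, rotMat_mem_unitaryGroup hij hw θ⟩

theorem rot_mul {i j : Fin N} (hij : i ≠ j) {w : ℂ} (hw : w * star w = 1) (θ φ : ℝ) :
    rot hij hw θ * rot hij hw φ = rot hij hw (θ + φ) :=
  Subtype.ext (rotMat_mul hij hw θ φ)

theorem rot_pow {i j : Fin N} (hij : i ≠ j) {w : ℂ} (hw : w * star w = 1) (θ : ℝ) (n : ℕ) :
    rot hij hw θ ^ n = rot hij hw (n * θ) := by
  induction n with
  | zero => exact Subtype.ext (by simp [rot, rotMat_zero])
  | succ n ih => rw [pow_succ, ih, rot_mul]; congr 1; push_cast; ring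

theorem rot_inv {i j : Fin N} (hij : i ≠ j) {w : ℂ} (hw : w * star w = 1) (θ : ℝ) :
    (rot hij hw θ)⁻¹ = rot hij hw (-θ) :=
  Subtype.ext (star_rotMat i j w θ)

/-- A rotation mixes two diagonal entries and adds `sin 2θ` times the off-diagonal entry between
them. -/
theorem diagVec_conj_rot {i j : Fin N} (hij : i ≠ j) {w : ℂ} (hw : w * star w = 1) (θ : ℝ)
    (M : Herm N) : diagVec (conj (rot hij hw θ) M) i =
      Real.cos θ ^ 2 * diagVec M i + Real.sin θ ^ 2 * diagVec M j +
        Real.sin (2 * θ) * ((M : Matrix (Fin N) (Fin N) ℂ) i j * star w).re := by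
  have hrow : ∀ b, rotMat i j w θ i b
      = (if i = b then (Real.cos θ : ℂ) else 0) + (if j = b then (Real.sin θ : ℂ) * w else 0) := by
    intro b
    simp only [rotMat, Matrix.add_apply, Matrix.smul_apply, Matrix.sub_apply, Matrix.single_apply,
      Matrix.one_apply, hij.symm, false_and, if_false, true_and, smul_eq_mul]
    split_ifs <;> ring
  have hji : (M : Matrix (Fin N) (Fin N) ℂ) j i
      = (starRingEnd ℂ) ((M : Matrix (Fin N) (Fin N) ℂ) i j) := (star_apply M i j).symm
  have hw2 : w.re * w.re + w.im * w.im = 1 := by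
    have := congrArg Complex.re hw
    simpa [Complex.mul_re] using this
  -- Hermitian matrices have real diagonal
  have him : ∀ k, ((M : Matrix (Fin N) (Fin N) ℂ) k k).im = 0 := fun k => by
    have := congrArg Complex.im (star_apply M k k)
    simp only [Complex.conj_im] at this
    linarith
  simp only [diagVec, conj, rot, Matrix.mul_apply, Matrix.conjTranspose_apply, hrow, add_mul,
    ite_mul, zero_mul, Finset.sum_add_distrib, Finset.sum_ite_eq, Finset.mem_univ, if_true,
    star_add, mul_add, apply_ite (star : ℂ → ℂ), star_zero, mul_ite, mul_zero, hji]
  simp only [Complex.star_def, map_mul, Complex.conj_ofReal, Complex.add_re, Complex.mul_re,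
    Complex.mul_im, Complex.ofReal_re, Complex.ofReal_im, Complex.conj_re, Complex.conj_im, him,
    Real.sin_two_mul]
  linear_combination (Real.sin θ ^ 2 * ((M : Matrix (Fin N) (Fin N) ℂ) j j).re) * hw2

end Rotation

/-! ### Anti-concentration of the diagonal in a random basis -/

section AntiConcentration

variable {N : ℕ}

instance instSecondCountableTopologyHerm (N : ℕ) : SecondCountableTopology (Herm N) :=
  TopologicalSpace.Subtype.secondCountableTopology _

theorem measurable_conj : Measurable fun p : UGroup N × Herm N => conj p.1 p.2 :=
  continuous_conj.measurable

theorem measurable_conj_inv (M : Herm N) : Measurable fun U : UGroup N => conj U⁻¹ M := by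
  have h : Measurable fun U : UGroup N => (U⁻¹, M) := measurable_inv.prodMk measurable_const
  have h2 := measurable_conj.comp h
  exact h2

theorem measurable_diagVec_apply (i : Fin N) : Measurable fun S : Herm N => diagVec S i :=
  ((continuous_apply i).comp continuous_diagVec).measurable

theorem measurable_entry (i j : Fin N) :
    Measurable fun S : Herm N => (S : Matrix (Fin N) (Fin N) ℂ) i j :=
  (continuous_subtype_val.matrix_elem i j).measurable

variable (𝓗 : Measure (UGroup N)) [IsProbabilityMeasure 𝓗] [𝓗.IsMulRightInvariant]

/-- Rotating in the plane of `i` and `j` by distinct small angles makes the events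
`{small diagonal, large entry}` disjoint, and there are about `1 / ε` such angles. -/
theorem measureReal_small_diag_large_entry_le {i j : Fin N} (hij : i ≠ j) {w : ℂ}
    (hw : w * star w = 1) {c ε : ℝ} (hc : 0 < c) (hε : 0 < ε) (M : Herm N) :
    𝓗.real {U | (∀ k, |diagVec (conj U⁻¹ M) k| ≤ ε) ∧
      c ≤ |((conj U⁻¹ M : Matrix (Fin N) (Fin N) ℂ) i j * star w).re|} ≤ 12 / c * ε := by
  set G : Set (UGroup N) := {U | (∀ k, |diagVec (conj U⁻¹ M) k| ≤ ε) ∧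
      c ≤ |((conj U⁻¹ M : Matrix (Fin N) (Fin N) ℂ) i j * star w).re|} with hG
  have hGm : MeasurableSet G := by
    have h1 : ∀ k, MeasurableSet {U : UGroup N | |diagVec (conj U⁻¹ M) k| ≤ ε} := fun k =>
      measurableSet_le ((measurable_diagVec_apply k).comp (measurable_conj_inv M)).abs
        measurable_const
    have h2 : MeasurableSet {U : UGroup N |
        c ≤ |((conj U⁻¹ M : Matrix (Fin N) (Fin N) ℂ) i j * star w).re|} := by
      refine measurableSet_le measurable_const (Measurable.abs (Complex.measurable_re.comp ?_))
      exact ((measurable_entry i j).comp (measurable_conj_inv M)).mul_const _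
    have : G = (⋂ k, {U : UGroup N | |diagVec (conj U⁻¹ M) k| ≤ ε}) ∩ {U : UGroup N |
        c ≤ |((conj U⁻¹ M : Matrix (Fin N) (Fin N) ℂ) i j * star w).re|} := by
      ext U; simp [hG]
    rw [this]
    exact (MeasurableSet.iInter h1).inter h2
  rcases lt_or_ge (c / 12) ε with hbig | hsmall
  · refine measureReal_le_one.trans ?_
    rw [div_mul_eq_mul_div, le_div_iff₀ hc]
    linarith
  -- the step of the angles is such that one rotation moves the diagonal by more than `2 ε`, while
  -- all `K` of them stay in the range where the sine is at least linear
  set β : ℝ := 3 * ε / c with hβ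
  have hβ0 : 0 < β := by positivity
  set K : ℕ := ⌊c / (6 * ε)⌋₊ with hK
  have hKle : (K : ℝ) * (2 * β) ≤ 1 := by
    have : (K : ℝ) ≤ c / (6 * ε) := Nat.floor_le (by positivity)
    calc (K : ℝ) * (2 * β) ≤ c / (6 * ε) * (2 * β) := by gcongr
      _ = 1 := by rw [hβ]; field_simp; norm_num
  have hKge : c / (12 * ε) ≤ K := by
    have h1 : c / (6 * ε) < K + 1 := Nat.lt_floor_add_one _
    have h2 : 1 ≤ c / (12 * ε) := by rw [one_le_div (by positivity)]; linarith
    have h3 : c / (6 * ε) = 2 * (c / (12 * ε)) := by field_simp; norm_num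
    linarith
  set V : UGroup N := rot hij hw β with hV
  -- the translates of `G` by the powers of the rotation `V` are disjoint
  have hdisj : ∀ k l : ℕ, k < l → l < K →
      Disjoint ((· * V ^ k) ⁻¹' G) ((· * V ^ l) ⁻¹' G) := by
    intro k l hkl hl
    rw [Set.disjoint_left]
    rintro U ⟨hU1, hU2⟩ ⟨hU3, -⟩
    obtain ⟨n, rfl⟩ : ∃ n, l = k + n := ⟨l - k, by omega⟩
    set T := conj (U * V ^ k)⁻¹ M with hT
    have hT2 : conj (U * V ^ (k + n))⁻¹ M = conj (rot hij hw (-(n * β))) T := by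
      rw [hT, conj_conj, pow_add, ← mul_assoc, mul_inv_rev (U * V ^ k), hV, rot_pow hij hw β n,
        rot_inv]
    have h4 := hU3 i
    simp only [hT2] at h4
    rw [diagVec_conj_rot] at h4
    set τ : ℝ := ((T : Matrix (Fin N) (Fin N) ℂ) i j * star w).re
    have hn1 : (1 : ℝ) ≤ n := by exact_mod_cast (show 1 ≤ n by omega)
    have hnK : (n : ℝ) ≤ K := by exact_mod_cast (show n ≤ K by omega)
    have hsin : β ≤ Real.sin (2 * (n * β)) := by
      have h5 : 2 * ((n : ℝ) * β) ≤ Real.pi / 2 := by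
        have : (n : ℝ) * (2 * β) ≤ K * (2 * β) := by gcongr
        linarith [Real.pi_gt_three]
      have h6 := Real.mul_le_sin (by positivity : (0 : ℝ) ≤ 2 * (n * β)) h5
      refine le_trans ?_ h6
      have h7 : 1 / 2 ≤ 2 / Real.pi := by
        rw [div_le_div_iff₀ two_pos Real.pi_pos]
        linarith [Real.pi_le_four]
      calc β = 1 / 2 * (2 * (1 * β)) := by ring
        _ ≤ 2 / Real.pi * (2 * (n * β)) := by gcongr
    have h5 : |Real.sin (2 * -(n * β)) * τ| ≤ 2 * ε := by
      have a1 := abs_le.1 (hU1 i)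
      have a2 := abs_le.1 (hU1 j)
      have a3 := abs_le.1 h4
      have a4 := Real.sin_sq_add_cos_sq (-(n * β))
      have a5 := sq_nonneg (Real.sin (-(n * β)))
      have a6 := sq_nonneg (Real.cos (-(n * β)))
      set s2 := Real.sin (-(n * β)) ^ 2
      set c2 := Real.cos (-(n * β)) ^ 2
      have b1 : |c2 * diagVec T i + s2 * diagVec T j| ≤ ε := by
        rw [abs_le]
        have e : ε = c2 * ε + s2 * ε := by rw [← add_mul, add_comm, a4, one_mul]
        constructor <;> nlinarith
      have b2 := abs_le.1 b1
      rw [abs_le]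
      constructor <;> linarith
    rw [mul_neg, Real.sin_neg, neg_mul, abs_neg, abs_mul, abs_of_pos (hβ0.trans_le hsin)] at h5
    have h6 : β * c ≤ 2 * ε := le_trans (mul_le_mul hsin hU2 hc.le (hβ0.le.trans hsin)) h5
    rw [hβ, div_mul_cancel₀ _ hc.ne'] at h6
    linarith
  have hsum : ∑ k ∈ Finset.range K, 𝓗.real ((· * V ^ k) ⁻¹' G) ≤ 1 := by
    rw [← measureReal_biUnion_finset]
    · exact measureReal_le_one
    · intro k hk l hl hkl
      rcases lt_or_gt_of_ne hkl with h | h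
      · exact hdisj k l h (Finset.mem_range.1 hl)
      · exact (hdisj l k h (Finset.mem_range.1 hk)).symm
    · exact fun k _ => measurable_mul_const _ hGm
  have heq : ∀ k, 𝓗.real ((· * V ^ k) ⁻¹' G) = 𝓗.real G := fun k => by
    rw [Measure.real, Measure.real, measure_preimage_mul_right]
  simp only [heq, Finset.sum_const, Finset.card_range, nsmul_eq_mul] at hsum
  have hG0 : 0 ≤ 𝓗.real G := measureReal_nonneg
  have h7 : c / (12 * ε) * 𝓗.real G ≤ 1 := le_trans (by gcongr) hsum
  rw [div_mul_eq_mul_div, div_le_one (by positivity)] at h7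
  rw [div_mul_eq_mul_div, le_div_iff₀ hc]
  linarith

/-- A Hermitian matrix of norm one in a Haar distributed basis has small diagonal with small
probability. -/
theorem exists_measureReal_small_diag_le (hN : 0 < N) : ∃ C : ℝ, 0 ≤ C ∧ ∀ ε : ℝ, 0 < ε →
    ∀ M : Herm N, trPair M M = 1 →
      𝓗.real {U | ∀ k, |diagVec (conj U⁻¹ M) k| ≤ ε} ≤ C * ε := by
  have hN' : (1 : ℝ) ≤ N := by exact_mod_cast hN
  have hN0 : (N : ℝ) ≠ 0 := by positivity
  -- entries below `c` off the diagonal contribute at most `1 / 2` to the squared norm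
  set c : ℝ := 1 / (2 * N) with hc
  have hc0 : 0 < c := by positivity
  have h1 : (1 : ℂ) * star 1 = 1 := by simp
  have hI : Complex.I * star Complex.I = 1 := by simp
  refine ⟨2 * N + ∑ _i : Fin N, ∑ _j : Fin N, (12 / c + 12 / c), by positivity,
    fun ε hε M hM => ?_⟩
  rcases lt_or_ge (1 / (2 * N : ℝ)) ε with hbig | hsmall
  · refine measureReal_le_one.trans ?_
    have : 1 ≤ 2 * N * ε := by
      rw [div_lt_iff₀ (by positivity)] at hbig; linarith
    rw [add_mul]
    have : 0 ≤ (∑ _i : Fin N, ∑ _j : Fin N, (12 / c + 12 / c)) * ε := by positivity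
    linarith
  set G : Fin N → Fin N → ℂ → Set (UGroup N) := fun i j w => {U | i ≠ j ∧
    (∀ k, |diagVec (conj U⁻¹ M) k| ≤ ε) ∧
      c ≤ |((conj U⁻¹ M : Matrix (Fin N) (Fin N) ℂ) i j * star w).re|} with hG
  have hGle : ∀ i j w, w * star w = 1 → 𝓗.real (G i j w) ≤ 12 / c * ε := by
    intro i j w hw
    by_cases hij : i = j
    · have : G i j w = ∅ := by ext U; simp [hG, hij]
      rw [this, measureReal_empty]; positivity
    · refine le_trans (measureReal_mono ?_)
        (measureReal_small_diag_large_entry_le 𝓗 hij hw hc0 hε M)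
      exact fun U hU => hU.2
  have hsub : {U : UGroup N | ∀ k, |diagVec (conj U⁻¹ M) k| ≤ ε} ⊆
      ⋃ i, ⋃ j, (G i j 1 ∪ G i j Complex.I) := by
    intro U hU
    by_contra hn
    simp only [Set.mem_iUnion, Set.mem_union, not_exists, not_or] at hn
    set T := conj U⁻¹ M with hT
    have hTn : trPair T T = 1 := by rw [hT, trPair_conj_self, hM]
    have hent : ∀ i j, ‖(T : Matrix (Fin N) (Fin N) ℂ) i j‖ ^ 2
        ≤ (if i = j then ε ^ 2 else 0) + 2 * c ^ 2 := by
      intro i j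
      rw [← Complex.normSq_eq_norm_sq, Complex.normSq_apply]
      split_ifs with hij
      · subst hij
        have him : ((T : Matrix (Fin N) (Fin N) ℂ) i i).im = 0 := by
          have := congrArg Complex.im (star_apply T i i)
          simp only [Complex.conj_im] at this
          linarith
        have := abs_le.1 (hU i)
        simp only [← hT, diagVec] at this
        rw [him]
        nlinarith
      · have a1 : |((T : Matrix (Fin N) (Fin N) ℂ) i j).re| < c := by
          by_contra hcon
          exact (hn i j).1 ⟨hij, hU, by simpa using not_lt.1 hcon⟩
        have a2 : |((T : Matrix (Fin N) (Fin N) ℂ) i j).im| < c := by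
          by_contra hcon
          exact (hn i j).2 ⟨hij, hU, by simpa using not_lt.1 hcon⟩
        have b1 := abs_lt.1 a1
        have b2 := abs_lt.1 a2
        nlinarith
    have hle : (1 : ℝ) ≤ N * ε ^ 2 + N * (N * (2 * c ^ 2)) := by
      rw [← hTn, trPair_self_eq_sum]
      refine (Finset.sum_le_sum fun i _ => Finset.sum_le_sum fun j _ => hent i j).trans ?_
      simp [Finset.sum_add_distrib]
    have e1 : (N : ℝ) * (N * (2 * c ^ 2)) = 1 / 2 := by rw [hc]; field_simp
    have e2 : (N : ℝ) * ε ^ 2 ≤ 1 / 4 := by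
      have e3 : ε ^ 2 ≤ (1 / (2 * (N : ℝ))) ^ 2 := by gcongr
      have e4 : (N : ℝ) * (1 / (2 * (N : ℝ))) ^ 2 = 1 / 4 * (1 / (N : ℝ)) := by
        field_simp; norm_num
      have e5 : 1 / (N : ℝ) ≤ 1 := (div_le_one (by positivity)).2 hN'
      nlinarith
    linarith
  refine (measureReal_mono hsub).trans ?_
  refine (measureReal_iUnion_fintype_le _).trans ?_
  rw [add_mul, Finset.sum_mul]
  refine le_trans (Finset.sum_le_sum fun i _ => ?_) (le_add_of_nonneg_left (by positivity))
  refine (measureReal_iUnion_fintype_le _).trans ?_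
  rw [Finset.sum_mul]
  refine Finset.sum_le_sum fun j _ => (measureReal_union_le _ _).trans ?_
  rw [add_mul]
  exact add_le_add (hGle i j 1 h1) (hGle i j _ hI)

end AntiConcentration

/-! ### Averaging the exponent over the unitary group -/

section Averaging

variable {N : ℕ} {H : Measure (Herm N)} {α : ℝ} [IsProbabilityMeasure H]
variable (𝓗 : Measure (UGroup N)) [IsProbabilityMeasure 𝓗] [𝓗.IsMulRightInvariant]

theorem measurable_dotProduct_diagVec_conj (S : Herm N) :
    Measurable fun p : UGroup N × (Fin N → ℝ) => p.2 ⬝ᵥ diagVec (conj p.1⁻¹ S) := by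
  simp only [dotProduct]
  refine Finset.measurable_sum _ fun i _ => ?_
  exact ((measurable_pi_apply i).comp measurable_snd).mul
    (((measurable_diagVec_apply i).comp (measurable_conj_inv S)).comp measurable_fst)

theorem measurable_trPair_self : Measurable fun R : Herm N => trPair R R := by
  have h := measurable_trPair.comp (measurable_id.prodMk (measurable_id (α := Herm N)))
  exact h

theorem measurable_trPair_left (S : Herm N) : Measurable fun R : Herm N => trPair R S := by
  have h := measurable_trPair.comp (measurable_id.prodMk (measurable_const (a := S)))
  exact h

theorem measurable_trPair_conj (S : Herm N) :
    Measurable fun p : UGroup N × Herm N => trPair (conj p.1 p.2) S := by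
  have h := measurable_trPair.comp (measurable_conj.prodMk (measurable_const (a := S)))
  exact h

/-- Averaging the exponent of the eigenvalue part over the eigenvectors gives the exponent of the
matrix law. -/
theorem integral_eigExponent_conj (hα : 0 < α) (hs : ∀ᵐ R ∂H, trPair R R = 1)
    (hinv : ∀ U : UGroup N, H.map (conj U) = H) (S : Herm N) :
    ∫ U : UGroup N, eigExponent α H (conj U⁻¹ S) ∂𝓗 = matExponent α H S := by
  have := isProbabilityMeasure_eigPart (H := H)
  obtain ⟨B, -, hB⟩ := exists_norm_nu_le_of_abs_le hα (√(trPair S S))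
  have hi1 : Integrable (Function.uncurry fun (U : UGroup N) (r : Fin N → ℝ) =>
      nu α (r ⬝ᵥ diagVec (conj U⁻¹ S))) (𝓗.prod (eigPart H)) := by
    refine Integrable.of_bound (C := B)
      ((measurable_nu α).comp (measurable_dotProduct_diagVec_conj S)).aestronglyMeasurable ?_
    filter_upwards [Measure.quasiMeasurePreserving_snd.ae (ae_dotProduct_self_eigPart hs)]
      with p hp
    refine hB _ ((abs_dotProduct_diagVec_le hp _).trans_eq ?_)
    rw [trPair_conj_self]
  have hi2 : Integrable (Function.uncurry fun (U : UGroup N) (R : Herm N) =>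
      nu α (trPair (conj U R) S)) (𝓗.prod H) := by
    refine Integrable.of_bound (C := B)
      ((measurable_nu α).comp (measurable_trPair_conj S)).aestronglyMeasurable ?_
    filter_upwards [Measure.quasiMeasurePreserving_snd.ae hs] with p hp
    exact hB _ (abs_trPair_le (by rw [trPair_conj_self, hp]))
  have hmat : ∀ U : UGroup N, ∫ R, nu α (trPair (conj U R) S) ∂H = matExponent α H S := fun U => by
    have hm : Measurable (conj U : Herm N → Herm N) := by
      have h := measurable_conj.comp (measurable_prodMk_left (x := U))
      exact h
    have hm2 : AEStronglyMeasurable (fun R => nu α (trPair R S)) (H.map (conj U)) :=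
      ((measurable_nu α).comp (measurable_trPair_left S)).aestronglyMeasurable
    rw [← integral_map hm.aemeasurable hm2, hinv U, matExponent]
  have hshift : ∀ (R : Herm N) (σ : Equiv.Perm (Fin N)),
      ∫ U : UGroup N, nu α ((fun i => (isHermitian R).eigenvalues (σ i)) ⬝ᵥ
        diagVec (conj U⁻¹ S)) ∂𝓗 = ∫ U : UGroup N, nu α (trPair (conj U R) S) ∂𝓗 := fun R σ => by
    obtain ⟨V, hV⟩ := dotProduct_eq_trPair_eigenvalues R σ
    rw [← integral_mul_right_eq_self (μ := 𝓗) (fun U : UGroup N => nu α (trPair (conj U R) S)) V]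
    refine integral_congr_ae (ae_of_all _ fun U => ?_)
    simp only [hV, ← conj_conj, trPair_conj_left]
  simp only [eigExponent]
  have hi3 : Integrable (fun r : Fin N → ℝ => ∫ U : UGroup N, nu α (r ⬝ᵥ diagVec (conj U⁻¹ S)) ∂𝓗)
      (eigPart H) := hi1.integral_prod_right
  rw [integral_integral_swap hi1, integral_eigPart hi3]
  simp only [hshift]
  rw [Finset.sum_const, Finset.card_univ, Fintype.card_perm, Fintype.card_fin,
    ← Nat.cast_smul_eq_nsmul ℝ, smul_smul, mul_inv_cancel₀ (by positivity), one_smul,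
    ← integral_integral_swap hi2]
  simp [hmat]

end Averaging

/-! ### Coercivity of the exponents -/

section LowerBounds

attribute [local instance] hermNormed hermInner

variable {N : ℕ} {H : Measure (Herm N)} {α : ℝ} {W : Submodule ℝ (Herm N)}

theorem sq_norm_eq_trPair (S : Herm N) : ‖S‖ ^ 2 = trPair S S := by
  rw [← inner_eq_trPair, real_inner_self_eq_norm_sq]

theorem norm_eq_one_iff_trPair {S : Herm N} : ‖S‖ = 1 ↔ trPair S S = 1 := by
  rw [← sq_norm_eq_trPair]
  constructor
  · intro h; rw [h, one_pow]
  · intro h; exact (pow_eq_one_iff_of_nonneg (norm_nonneg S) two_ne_zero).1 h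

theorem norm_eq_sqrt_trPair (S : Herm N) : ‖S‖ = √(trPair S S) := by
  rw [← sq_norm_eq_trPair, Real.sqrt_sq (norm_nonneg S)]

/-- A spectral measure of `W` is not carried by a hyperplane of `W`. -/
theorem IsSpectralMeasure.eq_zero_of_ae_trPair_eq_zero (hH : IsSpectralMeasure W H) {S : Herm N}
    (hS : S ∈ W) (h : ∀ᵐ R ∂H, trPair R S = 0) : S = 0 := by
  have hcl : IsClosed {R : Herm N | trPair R S = 0} := by
    have hc := continuous_trPair.comp (continuous_id.prodMk (continuous_const (y := S)))
    exact isClosed_eq hc continuous_const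
  have hsub := Measure.support_subset_of_isClosed hcl h
  let K : Submodule ℝ (Herm N) := LinearMap.ker (innerₗ (Herm N) S)
  have hK : Submodule.span ℝ H.support ≤ K := Submodule.span_le.2 fun R hR => by
    have h1 : trPair R S = 0 := hsub hR
    simpa [K, inner_eq_trPair, trPair_comm S R] using h1
  rw [hH.span_support] at hK
  have h2 : inner ℝ S S = 0 := by simpa [K] using hK hS
  exact inner_self_eq_zero.1 h2

theorem IsSpectralMeasure.ae_trPair_self (hH : IsSpectralMeasure W H) :
    ∀ᵐ R ∂H, trPair R R = 1 := hH.sphere.mono fun _ h => h.2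

theorem IsSpectralMeasure.exists_le_matExponent_re (hH : IsSpectralMeasure W H) (hα : 0 < α) :
    ∃ c : ℝ, 0 < c ∧ ∀ S ∈ W, c * ‖S‖ ^ α ≤ (matExponent α H S).re := by
  have := hH.isProbabilityMeasure
  obtain ⟨c, hc, h⟩ := exists_le_integral_abs_inner_rpow (ρ := H) W hα
    (hH.ae_trPair_self.mono fun R hR => norm_eq_one_iff_trPair.2 hR)
    (fun S hS h => hH.eq_zero_of_ae_trPair_eq_zero hS h)
  refine ⟨c, hc, fun S hS => (h S hS).trans_eq ?_⟩
  rw [matExponent_re hα hH.ae_trPair_self]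
  rfl

/-- The diagonal matrices of `W`. -/
def diagSub (W : Submodule ℝ (Herm N)) : Submodule ℝ (Herm N) where
  carrier := {S | S ∈ W ∧ diagMat (diagVec S) = S}
  add_mem' := fun ha hb => ⟨W.add_mem ha.1 hb.1, by rw [diagVec_add, diagMat_add, ha.2, hb.2]⟩
  zero_mem' := ⟨W.zero_mem, by
    have h := diagMat_smul (N := N) 0 0
    have h2 := diagVec_smul (N := N) 0 0
    simp only [zero_smul] at h h2
    rw [h2, h]⟩
  smul_mem' := fun c S hS => ⟨W.smul_mem c hS.1, by rw [diagVec_smul, diagMat_smul, hS.2]⟩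

theorem mem_diagSub {S : Herm N} : S ∈ diagSub W ↔ S ∈ W ∧ diagMat (diagVec S) = S := Iff.rfl

theorem diagMat_mem_diagSub {x : Fin N → ℝ} : diagMat x ∈ diagSub W ↔ diagMat x ∈ W := by
  rw [mem_diagSub, diagVec_diagMat]; simp

/-- The squared moduli of the entries of a unitary matrix form a doubly stochastic matrix. -/
theorem sq_norm_entries_mem_doublyStochastic (V : UGroup N) :
    (Matrix.of fun i j => ‖(V : Matrix (Fin N) (Fin N) ℂ) i j‖ ^ 2) ∈
      doublyStochastic ℝ (Fin N) := by
  have h1 := Matrix.mem_unitaryGroup_iff.1 V.2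
  have h2 := Matrix.mem_unitaryGroup_iff'.1 V.2
  rw [mem_doublyStochastic_iff_sum]
  refine ⟨fun i j => by simp only [Matrix.of_apply]; positivity, fun i => ?_, fun j => ?_⟩
  · have := congrFun (congrFun h1 i) i
    simp only [Matrix.mul_apply, Matrix.star_apply, Matrix.one_apply_eq, RCLike.star_def,
      Complex.mul_conj, Complex.normSq_eq_norm_sq] at this
    simp only [Matrix.of_apply]
    exact_mod_cast this
  · have := congrFun (congrFun h2 j) j
    simp only [Matrix.mul_apply, Matrix.star_apply, Matrix.one_apply_eq, RCLike.star_def,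
      Complex.conj_mul', ← Complex.ofReal_pow] at this
    simp only [Matrix.of_apply]
    exact_mod_cast this

/-- If `x` is orthogonal to every rearrangement of the eigenvalues of `R`, it is orthogonal to the
diagonal of `R`, since by Birkhoff's theorem the diagonal is a convex combination of these
rearrangements. -/
theorem trPair_diagMat_eq_zero_of_forall_perm (R : Herm N) {x : Fin N → ℝ}
    (h : ∀ σ : Equiv.Perm (Fin N), (fun i => (isHermitian R).eigenvalues (σ i)) ⬝ᵥ x = 0) :
    trPair R (diagMat x) = 0 := by
  obtain ⟨V, hV⟩ := exists_conj_diagMat_eigenvalues R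
  set l := (isHermitian R).eigenvalues
  obtain ⟨w, -, -, hw⟩ :=
    exists_eq_sum_perm_of_mem_doublyStochastic (sq_norm_entries_mem_doublyStochastic V)
  have hdiag : ∀ i, diagVec R i = ∑ j, ‖(V : Matrix (Fin N) (Fin N) ℂ) i j‖ ^ 2 * l j := fun i => by
    rw [hV]
    simp only [diagVec, conj, diagMat]
    rw [Matrix.mul_apply, Complex.re_sum]
    simp only [Matrix.mul_diagonal, Matrix.conjTranspose_apply]
    refine Finset.sum_congr rfl fun j _ => ?_
    rw [mul_right_comm, RCLike.star_def, Complex.mul_conj, Complex.normSq_eq_norm_sq,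
      ← Complex.ofReal_mul, Complex.ofReal_re]
  have hM : ∀ i j, ‖(V : Matrix (Fin N) (Fin N) ℂ) i j‖ ^ 2 =
      ∑ σ, w σ * (if σ i = j then 1 else 0) := fun i j => by
    have := congrFun (congrFun hw i) j
    simp only [Matrix.sum_apply, Matrix.smul_apply, Matrix.of_apply, smul_eq_mul,
      Equiv.Perm.permMatrix, PEquiv.toMatrix_apply, Equiv.toPEquiv_apply, Option.mem_def,
      Option.some.injEq] at this
    rw [← this]
  rw [trPair_comm, trPair_diagMat, dotProduct]
  simp only [hdiag, hM]
  have h3 : ∀ i, ∑ j, (∑ σ : Equiv.Perm (Fin N), w σ * (if σ i = j then 1 else 0)) * l j =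
      ∑ σ : Equiv.Perm (Fin N), w σ * l (σ i) := fun i => by
    simp only [Finset.sum_mul]
    rw [Finset.sum_comm]
    refine Finset.sum_congr rfl fun σ _ => ?_
    simp
  simp only [h3, Finset.mul_sum]
  rw [Finset.sum_comm]
  refine Finset.sum_eq_zero fun σ _ => ?_
  have h4 := h σ
  rw [dotProduct] at h4
  calc ∑ i, x i * (w σ * l (σ i)) = w σ * ∑ i, l (σ i) * x i := by
        rw [Finset.mul_sum]
        exact Finset.sum_congr rfl fun i _ => by ring
    _ = 0 := by rw [h4, mul_zero]

/-- The real part of the exponent of the eigenvalue part controls the diagonal of `S`. The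
eigenvalue part is not carried by a hyperplane of the diagonal matrices of `W`, because otherwise,
by Birkhoff's theorem, `H` would be carried by a hyperplane of `W`. -/
theorem IsSpectralMeasure.exists_le_eigExponent_re (hH : IsSpectralMeasure W H)
    (hW : W = ⊤ ∨ W = Herm₀ N) (hα : 0 < α) :
    ∃ c : ℝ, 0 < c ∧ ∀ S ∈ W, c * ‖diagMat (diagVec S)‖ ^ α ≤ (eigExponent α H S).re := by
  have := hH.isProbabilityMeasure
  have := isProbabilityMeasure_eigPart (H := H)
  have hdm : Measurable (diagMat : (Fin N → ℝ) → Herm N) := continuous_diagMat.measurable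
  have hp : IsProbabilityMeasure ((eigPart H).map diagMat) :=
    Measure.isProbabilityMeasure_map hdm.aemeasurable
  have hone : ∀ᵐ R ∂(eigPart H).map diagMat, trPair R R = 1 := by
    have hm : MeasurableSet {R : Herm N | trPair R R = 1} :=
      measurableSet_eq_fun measurable_trPair_self measurable_const
    refine (ae_map_iff hdm.aemeasurable hm).2 ?_
    filter_upwards [ae_dotProduct_self_eigPart hH.ae_trPair_self] with r hr
    rw [trPair_diagMat, diagVec_diagMat, hr]
  have hclS : ∀ S : Herm N, MeasurableSet {R : Herm N | trPair R S = 0} := fun S =>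
    measurableSet_eq_fun (measurable_trPair_left S) measurable_const
  have hnd : ∀ S ∈ diagSub W, (∀ᵐ R ∂(eigPart H).map diagMat, trPair R S = 0) → S = 0 := by
    intro S hS h
    have h1 := (ae_map_iff hdm.aemeasurable (hclS S)).1 h
    simp only [trPair_diagMat] at h1
    have h2 := (ae_eigPart_iff (measurableSet_eq_fun (measurable_dotProduct_diagVec S)
      measurable_const)).1 h1
    refine hH.eq_zero_of_ae_trPair_eq_zero hS.1 ?_
    filter_upwards [ae_all_iff.2 h2] with R hR
    rw [← hS.2]
    exact trPair_diagMat_eq_zero_of_forall_perm R hR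
  obtain ⟨c, hc, h⟩ := exists_le_integral_abs_inner_rpow (ρ := (eigPart H).map diagMat)
    (diagSub W) hα (hone.mono fun R hR => norm_eq_one_iff_trPair.2 hR) hnd
  refine ⟨c, hc, fun S hS => ?_⟩
  refine (h _ (diagMat_mem_diagSub.2 (diagMat_mem_of_mem hW hS))).trans_eq ?_
  rw [eigExponent_re hα hH.ae_trPair_self, integral_map hdm.aemeasurable]
  · simp only [inner_eq_trPair, trPair_diagMat, diagVec_diagMat]
  · have hm := ((measurable_trPair_left (diagMat (diagVec S))).abs.pow_const α).aestronglyMeasurable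
      (μ := (eigPart H).map diagMat)
    exact hm

end LowerBounds

/-! ### The characteristic function of a summand -/

section HaarChar

attribute [local instance] hermNormed hermInner

variable {N : ℕ} {H : Measure (Herm N)} {α : ℝ} {W : Submodule ℝ (Herm N)}

/-- The characteristic function `E exp (-G(U† S U))` of `U diag(X) U†`, where `G` is the exponent of
the eigenvalue part and `U` has law `𝓗`. -/
def haarChar (𝓗 : Measure (UGroup N)) (α : ℝ) (H : Measure (Herm N)) (S : Herm N) : ℂ :=
  ∫ U : UGroup N, Complex.exp (-eigExponent α H (conj U⁻¹ S)) ∂𝓗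

theorem measurable_eigExponent [IsProbabilityMeasure H] : Measurable (eigExponent α H) := by
  have := isProbabilityMeasure_eigPart (H := H)
  have hm : Measurable (Function.uncurry fun (S : Herm N) (r : Fin N → ℝ) =>
      nu α (r ⬝ᵥ diagVec S)) := by
    refine (measurable_nu α).comp ?_
    simp only [dotProduct]
    refine Finset.measurable_sum _ fun i _ => ?_
    exact ((measurable_pi_apply i).comp measurable_snd).mul
      ((measurable_diagVec_apply i).comp measurable_fst)
  exact (hm.stronglyMeasurable.integral_prod_right (ν := eigPart H)).measurable

theorem measurable_matExponent [IsProbabilityMeasure H] : Measurable (matExponent α H) := by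
  have hm : Measurable (Function.uncurry fun (S R : Herm N) => nu α (trPair R S)) := by
    have h := (measurable_nu α).comp (measurable_trPair.comp
      (measurable_swap (α := Herm N) (β := Herm N)))
    exact h
  exact (hm.stronglyMeasurable.integral_prod_right (ν := H)).measurable

theorem measurable_eigExponent_conj [IsProbabilityMeasure H] (S : Herm N) :
    Measurable fun U : UGroup N => eigExponent α H (conj U⁻¹ S) :=
  measurable_eigExponent.comp (measurable_conj_inv S)

theorem measurable_haarChar [IsProbabilityMeasure H] (𝓗 : Measure (UGroup N))
    [IsProbabilityMeasure 𝓗] : Measurable (haarChar 𝓗 α H) := by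
  have h1 : Measurable fun p : Herm N × UGroup N => conj p.2⁻¹ p.1 := by
    have h := measurable_conj.comp ((measurable_inv.comp measurable_snd).prodMk
      (measurable_fst (α := Herm N) (β := UGroup N)))
    exact h
  have hm : Measurable (Function.uncurry fun (S : Herm N) (U : UGroup N) =>
      Complex.exp (-eigExponent α H (conj U⁻¹ S))) :=
    (measurable_eigExponent.comp h1).neg.cexp
  exact (hm.stronglyMeasurable.integral_prod_right (ν := 𝓗)).measurable

theorem eigExponent_smul_re [IsProbabilityMeasure H] (hα : 0 < α)
    (hs : ∀ᵐ R ∂H, trPair R R = 1) {ρ : ℝ} (hρ : 0 < ρ) (S : Herm N) :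
    (eigExponent α H (ρ • S)).re = ρ ^ α * (eigExponent α H S).re := by
  rw [eigExponent_smul hα hs hρ]
  simp

/-- The phase that scaling by `ρ` produces is the same for all conjugates of `S`. -/
theorem eigExponent_conj_smul [IsProbabilityMeasure H] (hα : 0 < α)
    (hs : ∀ᵐ R ∂H, trPair R R = 1) {ρ : ℝ} (hρ : 0 < ρ) (U : UGroup N) (S : Herm N) :
    eigExponent α H (conj U (ρ • S)) = (ρ ^ α : ℝ) * eigExponent α H (conj U S) +
      Complex.I * (logShift α ρ * (tZero (eigPart H) * trForm N S) : ℝ) := by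
  rw [conj_smul, eigExponent_smul hα hs hρ, trForm_conj]

theorem norm_haarChar_le (𝓗 : Measure (UGroup N)) (S : Herm N) :
    ‖haarChar 𝓗 α H S‖ ≤ ∫ U : UGroup N, Real.exp (-(eigExponent α H (conj U⁻¹ S)).re) ∂𝓗 := by
  refine (norm_integral_le_integral_norm _).trans_eq ?_
  simp only [Complex.norm_exp, Complex.neg_re]

section Haar

variable [IsProbabilityMeasure H] (𝓗 : Measure (UGroup N)) [IsProbabilityMeasure 𝓗]

theorem exists_norm_eigExponent_le_of_norm (hα : 0 < α) (hs : ∀ᵐ R ∂H, trPair R R = 1) :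
    ∃ B : ℝ, 0 ≤ B ∧ ∀ (U : UGroup N) (S : Herm N), ‖S‖ ≤ 1 →
      ‖eigExponent α H (conj U S)‖ ≤ B := by
  obtain ⟨B, hB0, hB⟩ := exists_norm_eigExponent_le hα hs
  refine ⟨B, hB0, fun U S hS => hB _ ?_⟩
  rw [trPair_conj_self, ← sq_norm_eq_trPair]
  exact pow_le_one₀ (norm_nonneg S) hS

theorem integrable_exp_neg_re_eigExponent (hα : 0 < α) (hs : ∀ᵐ R ∂H, trPair R R = 1)
    (S : Herm N) :
    Integrable (fun U : UGroup N => Real.exp (-(eigExponent α H (conj U⁻¹ S)).re)) 𝓗 := by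
  have h := (integrable_exp_neg (P := 𝓗) (measurable_eigExponent_conj (α := α) (H := H) S)
    fun U => eigExponent_re_nonneg hα hs _).norm
  simpa only [Complex.norm_exp, Complex.neg_re] using h

theorem integrable_eigExponent_conj (hα : 0 < α) (hs : ∀ᵐ R ∂H, trPair R R = 1) (S : Herm N) :
    Integrable (fun U : UGroup N => eigExponent α H (conj U⁻¹ S)) 𝓗 := by
  obtain ⟨B, hB0, hB⟩ := exists_norm_nu_le_of_abs_le hα (√(trPair S S))
  have := isProbabilityMeasure_eigPart (H := H)
  refine Integrable.of_bound (C := B) (measurable_eigExponent_conj S).aestronglyMeasurable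
    (ae_of_all _ fun U => ?_)
  have h := norm_integral_le_of_norm_le_const (μ := eigPart H) (C := B)
    (f := fun r => nu α (r ⬝ᵥ diagVec (conj U⁻¹ S))) (by
      filter_upwards [ae_dotProduct_self_eigPart hs] with r hr
      refine hB _ ((abs_dotProduct_diagVec_le hr _).trans_eq ?_)
      rw [trPair_conj_self])
  simpa [eigExponent] using h

variable [𝓗.IsMulRightInvariant]

theorem integral_re_eigExponent_conj (hα : 0 < α) (hs : ∀ᵐ R ∂H, trPair R R = 1)
    (hinv : ∀ U : UGroup N, H.map (conj U) = H) (S : Herm N) :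
    ∫ U : UGroup N, (eigExponent α H (conj U⁻¹ S)).re ∂𝓗 = (matExponent α H S).re := by
  have hi := integrable_eigExponent_conj 𝓗 hα hs S
  rw [← integral_eigExponent_conj 𝓗 hα hs hinv S]
  exact integral_re (𝕜 := ℂ) hi

/-- Scaling of the matrix exponent. The phase is derived from the eigenvalue part by averaging over
a right-invariant law `𝓗` on `U(N)`, which does not occur in the conclusion. -/
theorem matExponent_smul (𝓗 : Measure (UGroup N)) [IsProbabilityMeasure 𝓗]
    [𝓗.IsMulRightInvariant] (hα : 0 < α) (hs : ∀ᵐ R ∂H, trPair R R = 1) {ρ : ℝ} (hρ : 0 < ρ)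
    (hinv : ∀ U : UGroup N, H.map (conj U) = H) (S : Herm N) :
    matExponent α H (ρ • S) = (ρ ^ α : ℝ) * matExponent α H S +
      Complex.I * (logShift α ρ * (tZero (eigPart H) * trForm N S) : ℝ) := by
  have hi := integrable_eigExponent_conj 𝓗 hα hs S
  rw [← integral_eigExponent_conj 𝓗 hα hs hinv S, ← integral_eigExponent_conj 𝓗 hα hs hinv]
  simp only [eigExponent_conj_smul hα hs hρ]
  rw [integral_add (hi.const_mul _) (integrable_const _), integral_const_mul, integral_const]
  simp

/-- A summand and the limit agree to second order at the origin: after the common phase is removed,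
the two characteristic functions differ by the place of the average over `U(N)`, inside or outside
the exponential. -/
theorem exists_norm_haarChar_sub_le (hα : 0 < α) (hs : ∀ᵐ R ∂H, trPair R R = 1)
    (hinv : ∀ U : UGroup N, H.map (conj U) = H) :
    ∃ C : ℝ, 0 ≤ C ∧ ∀ S : Herm N, ‖S‖ ≤ 1 →
      ‖haarChar 𝓗 α H S - Complex.exp (-matExponent α H S)‖ ≤ C * ‖S‖ ^ (2 * α) := by
  obtain ⟨B, hB0, hB⟩ := exists_norm_eigExponent_le_of_norm hα hs
  refine ⟨6 * B ^ 2, by positivity, fun S hS => ?_⟩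
  rcases eq_or_ne S 0 with rfl | hS0
  · have h0 : ∀ U : UGroup N, conj U (0 : Herm N) = 0 := fun U => by
      have := conj_smul U 0 0
      simpa using this
    have e1 : haarChar 𝓗 α H 0 = Complex.exp (-eigExponent α H 0) := by
      simp [haarChar, h0]
    have e2 : matExponent α H 0 = eigExponent α H 0 := by
      rw [← integral_eigExponent_conj 𝓗 hα hs hinv]
      simp [h0]
    rw [e1, e2, sub_self, norm_zero]
    positivity
  have hρ : 0 < ‖S‖ := norm_pos_iff.2 hS0
  set ρ := ‖S‖ with hρd
  set T : Herm N := ρ⁻¹ • S with hT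
  have hST : S = ρ • T := by rw [hT, smul_smul, mul_inv_cancel₀ hρ.ne', one_smul]
  have hT1 : ‖T‖ = 1 := by rw [hT, norm_smul, norm_inv, norm_norm, inv_mul_cancel₀ hρ.ne']
  set θ : ℝ := logShift α ρ * (tZero (eigPart H) * trForm N T) with hθ
  have h := norm_integral_exp_neg_sub_exp_neg_integral_le (P := 𝓗)
    (Z := fun U : UGroup N => ((ρ ^ α : ℝ) : ℂ) * eigExponent α H (conj U⁻¹ T)) (b := ρ ^ α * B)
    ((measurable_eigExponent_conj T).const_mul _)
    (fun U => by
      rw [Complex.re_ofReal_mul]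
      exact mul_nonneg (by positivity) (eigExponent_re_nonneg hα hs _))
    (fun U => by
      rw [norm_mul, Complex.norm_real, Real.norm_of_nonneg (by positivity)]
      gcongr
      exact hB _ _ hT1.le)
  have e1 : haarChar 𝓗 α H S = Complex.exp (-(Complex.I * θ)) * ∫ U : UGroup N,
      Complex.exp (-(((ρ ^ α : ℝ) : ℂ) * eigExponent α H (conj U⁻¹ T))) ∂𝓗 := by
    rw [← integral_const_mul, haarChar]
    refine integral_congr_ae (ae_of_all _ fun U => ?_)
    simp only
    rw [hST, eigExponent_conj_smul hα hs hρ, ← Complex.exp_add, neg_add, add_comm]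
  have e2 : Complex.exp (-matExponent α H S) = Complex.exp (-(Complex.I * θ)) *
      Complex.exp (-∫ U : UGroup N, ((ρ ^ α : ℝ) : ℂ) * eigExponent α H (conj U⁻¹ T) ∂𝓗) := by
    rw [integral_const_mul, integral_eigExponent_conj 𝓗 hα hs hinv, ← Complex.exp_add, hST,
      matExponent_smul 𝓗 hα hs hρ hinv, neg_add, add_comm]
  have e3 : ‖Complex.exp (-(Complex.I * (θ : ℂ)))‖ = 1 := by
    rw [Complex.norm_exp]; simp
  rw [e1, e2, ← mul_sub, norm_mul, e3, one_mul]
  refine h.trans_eq ?_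
  rw [mul_comm 2 α, Real.rpow_mul hρ.le, mul_pow]
  norm_cast
  ring

/-- Both characteristic functions are dominated by `exp (-c ‖S‖ ^ α)` on the unit ball. That of a
summand has a bound that decreases along rays, which keeps it away from one outside the ball. -/
theorem exists_norm_haarChar_le_exp (hα : 0 < α) (hH : IsSpectralMeasure W H) :
    ∃ c : ℝ, 0 < c ∧ (∀ S ∈ W, ‖S‖ ≤ 1 → ‖haarChar 𝓗 α H S‖ ≤ Real.exp (-c * ‖S‖ ^ α)) ∧
      (∀ S ∈ W, 1 ≤ ‖S‖ → ‖haarChar 𝓗 α H S‖ ≤ Real.exp (-c)) ∧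
      ∀ S ∈ W, ‖Complex.exp (-matExponent α H S)‖ ≤ Real.exp (-c * ‖S‖ ^ α) := by
  have hs := hH.ae_trPair_self
  obtain ⟨B, hB0, hB⟩ := exists_norm_eigExponent_le_of_norm hα hs
  obtain ⟨c, hc, h⟩ := hH.exists_le_matExponent_re hα
  have hsmall : ∀ S ∈ W, ‖S‖ ≤ 1 →
      ∫ U : UGroup N, Real.exp (-(eigExponent α H (conj U⁻¹ S)).re) ∂𝓗 ≤
        Real.exp (-(c / (1 + B)) * ‖S‖ ^ α) := fun S hS hS1 => by
    refine (integral_exp_neg_le (P := 𝓗) (B := B)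
      (Complex.measurable_re.comp (measurable_eigExponent_conj S))
      (fun U => eigExponent_re_nonneg hα hs _)
      (fun U => (Complex.re_le_norm _).trans (hB _ _ hS1))).trans ?_
    rw [Real.exp_le_exp]
    have e := integral_re_eigExponent_conj 𝓗 hα hs hH.invariant S
    simp only [Function.comp_def, e]
    rw [neg_div, neg_mul, neg_le_neg_iff, div_mul_eq_mul_div]
    gcongr
    exact h S hS
  refine ⟨c / (1 + B), by positivity, fun S hS hS1 => (norm_haarChar_le 𝓗 S).trans
    (hsmall S hS hS1), fun S hS hS1 => (norm_haarChar_le 𝓗 S).trans ?_, fun S hS => ?_⟩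
  · have hρ : 0 < ‖S‖ := by linarith
    set T : Herm N := ‖S‖⁻¹ • S with hT
    have hST : S = ‖S‖ • T := by rw [hT, smul_smul, mul_inv_cancel₀ hρ.ne', one_smul]
    have hT1 : ‖T‖ = 1 := by rw [hT, norm_smul, norm_inv, norm_norm, inv_mul_cancel₀ hρ.ne']
    have h1 := hsmall T (W.smul_mem _ hS) hT1.le
    rw [hT1, Real.one_rpow, mul_one] at h1
    refine le_trans (integral_mono (integrable_exp_neg_re_eigExponent 𝓗 hα hs S)
      (integrable_exp_neg_re_eigExponent 𝓗 hα hs T) fun U => ?_) h1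
    simp only
    rw [Real.exp_le_exp, neg_le_neg_iff]
    conv_rhs => rw [hST, conj_smul, eigExponent_smul_re hα hs hρ]
    exact le_mul_of_one_le_left (eigExponent_re_nonneg hα hs _) (Real.one_le_rpow hS1 hα.le)
  · rw [Complex.norm_exp, Real.exp_le_exp, Complex.neg_re, neg_mul, neg_le_neg_iff]
    refine le_trans ?_ (h S hS)
    have : c / (1 + B) ≤ c := div_le_self hc.le (by linarith)
    gcongr

/-- Polynomial decay of the characteristic function of a summand. For `S = ρ T` with `‖T‖ = 1`, the
bases in which the diagonal of `T` is below `ρ^{-1/2}` have probability `O(ρ^{-1/2})`, and in all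
other bases the integrand is at most `exp (-κ ρ^{α/2})`. -/
theorem exists_norm_haarChar_le_rpow (hα : 0 < α) (hN : 0 < N) (hH : IsSpectralMeasure W H)
    (hW : W = ⊤ ∨ W = Herm₀ N) :
    ∃ C : ℝ, 0 ≤ C ∧ ∀ S ∈ W, 1 ≤ ‖S‖ → ‖haarChar 𝓗 α H S‖ ≤ C * ‖S‖ ^ (-(1 / 2) : ℝ) := by
  have hs := hH.ae_trPair_self
  obtain ⟨κ, hκ, h⟩ := hH.exists_le_eigExponent_re hW hα
  obtain ⟨C, hC0, hC⟩ := exists_measureReal_small_diag_le 𝓗 hN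
  obtain ⟨K, hK0, hK⟩ := exists_rpow_mul_exp_neg_le hκ (1 / α)
  refine ⟨C + K, by positivity, fun S hS hS1 => (norm_haarChar_le 𝓗 S).trans ?_⟩
  have hρ : 0 < ‖S‖ := by linarith
  set ρ := ‖S‖ with hρd
  set T : Herm N := ρ⁻¹ • S with hT
  have hTW : T ∈ W := W.smul_mem _ hS
  have hST : S = ρ • T := by rw [hT, smul_smul, mul_inv_cancel₀ hρ.ne', one_smul]
  have hT1 : ‖T‖ = 1 := by rw [hT, norm_smul, norm_inv, norm_norm, inv_mul_cancel₀ hρ.ne']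
  set ε : ℝ := ρ ^ (-(1 / 2) : ℝ) with hε
  have hε0 : 0 < ε := Real.rpow_pos_of_pos hρ _
  set A : Set (UGroup N) := {U | ∀ k, |diagVec (conj U⁻¹ T) k| ≤ ε} with hA
  have hAm : MeasurableSet A := by
    have : A = ⋂ k, {U : UGroup N | |diagVec (conj U⁻¹ T) k| ≤ ε} := by ext U; simp [hA]
    rw [this]
    exact MeasurableSet.iInter fun k => measurableSet_le
      ((measurable_diagVec_apply k).comp (measurable_conj_inv T)).abs measurable_const
  have hexp : Real.exp (-κ * ρ ^ (α / 2)) ≤ K * ε := by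
    have h1 := hK (ρ ^ (α / 2)) (Real.one_le_rpow hS1 (by positivity))
    rw [← Real.rpow_mul hρ.le, show α / 2 * (1 / α) = 1 / 2 by field_simp] at h1
    rw [hε, Real.rpow_neg hρ.le, ← div_eq_mul_inv, le_div_iff₀ (Real.rpow_pos_of_pos hρ _),
      mul_comm]
    exact h1
  have hpt : ∀ U : UGroup N, Real.exp (-(eigExponent α H (conj U⁻¹ S)).re) ≤
      A.indicator 1 U + K * ε := fun U => by
    by_cases hU : U ∈ A
    · rw [Set.indicator_of_mem hU, Pi.one_apply]
      have : Real.exp (-(eigExponent α H (conj U⁻¹ S)).re) ≤ 1 :=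
        Real.exp_le_one_iff.2 (neg_nonpos.2 (eigExponent_re_nonneg hα hs _))
      have : 0 ≤ K * ε := by positivity
      linarith
    · rw [Set.indicator_of_notMem hU, zero_add]
      refine le_trans ?_ hexp
      rw [Real.exp_le_exp, neg_mul, neg_le_neg_iff]
      conv_rhs => rw [hST, conj_smul, eigExponent_smul_re hα hs hρ]
      have hk : ∃ k, ε < |diagVec (conj U⁻¹ T) k| := by
        by_contra hcon
        push Not at hcon
        exact hU hcon
      obtain ⟨k, hk⟩ := hk
      have h2 : ε ≤ ‖diagMat (diagVec (conj U⁻¹ T))‖ := by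
        refine hk.le.trans (abs_le_of_sq_le_sq ?_ (norm_nonneg _))
        rw [sq_norm_eq_trPair, trPair_diagMat, diagVec_diagMat, dotProduct, sq]
        exact Finset.single_le_sum (f := fun i => diagVec (conj U⁻¹ T) i * diagVec (conj U⁻¹ T) i)
          (fun i _ => mul_self_nonneg _) (Finset.mem_univ k)
      have h3 := h _ (conj_mem hW U⁻¹ hTW)
      calc κ * ρ ^ (α / 2) = ρ ^ α * (κ * ε ^ α) := by
            rw [hε, ← Real.rpow_mul hρ.le, mul_left_comm, ← Real.rpow_add hρ]
            congr 2; ring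
        _ ≤ ρ ^ α * (κ * ‖diagMat (diagVec (conj U⁻¹ T))‖ ^ α) := by gcongr
        _ ≤ _ := by gcongr
  have hi : Integrable (A.indicator (1 : UGroup N → ℝ)) 𝓗 :=
    (integrable_const (1 : ℝ)).indicator hAm
  refine (integral_mono (integrable_exp_neg_re_eigExponent 𝓗 hα hs S)
    (hi.add (integrable_const _)) hpt).trans ?_
  simp only [Pi.add_apply]
  rw [integral_add hi (integrable_const _), integral_indicator_one hAm, integral_const,
    probReal_univ, one_smul, add_mul]
  gcongr
  exact hC ε hε0 T (norm_eq_one_iff_trPair.1 hT1)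

/-- The real part of the limiting characteristic function is `1 - O(‖S‖ ^ α)`. For `α = 1` the
exponent itself has a term `‖S‖ log ‖S‖`, but this is imaginary and enters through its square. -/
theorem exists_one_sub_re_exp_matExponent_le (𝓗 : Measure (UGroup N)) [IsProbabilityMeasure 𝓗]
    [𝓗.IsMulRightInvariant] (hα : 0 < α) (hs : ∀ᵐ R ∂H, trPair R R = 1)
    (hinv : ∀ U : UGroup N, H.map (conj U) = H) :
    ∃ C : ℝ, 0 ≤ C ∧ ∀ S : Herm N,
      1 - (Complex.exp (-matExponent α H S)).re ≤ C * ‖S‖ ^ α := by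
  obtain ⟨B, hB0, hB⟩ := exists_norm_nu_le hα
  have hb1 : ∀ T : Herm N, ‖T‖ ≤ 1 → ‖matExponent α H T‖ ≤ B := fun T hT => by
    have h := norm_integral_le_of_norm_le_const (μ := H) (C := B) (f := fun R => nu α (trPair R T))
      (by
        filter_upwards [hs] with R hR
        exact hB _ ((abs_trPair_le hR).trans (by rwa [← norm_eq_sqrt_trPair])))
    simpa [matExponent] using h
  set t := |tZero (eigPart H)| * ‖(1 : Herm N)‖ with ht
  refine ⟨2 + B + B ^ 2 + 4 * t ^ 2, by positivity, fun S => ?_⟩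
  have hre0 : ∀ T, 0 ≤ (matExponent α H T).re := fun T => by
    rw [matExponent_re hα hs]; exact integral_nonneg fun _ => by positivity
  rcases le_or_gt 1 ‖S‖ with hS1 | hS1
  · have h1 : ‖Complex.exp (-matExponent α H S)‖ ≤ 1 := by
      rw [Complex.norm_exp, Real.exp_le_one_iff, Complex.neg_re]
      linarith [hre0 S]
    have h2 := (abs_le.1 ((Complex.abs_re_le_norm _).trans h1)).1
    have h3 := Real.one_le_rpow hS1 hα.le
    have : 2 ≤ (2 + B + B ^ 2 + 4 * t ^ 2) * 1 := by nlinarith [sq_nonneg t, sq_nonneg B]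
    calc _ ≤ (2 : ℝ) := by linarith
      _ ≤ (2 + B + B ^ 2 + 4 * t ^ 2) * 1 := this
      _ ≤ _ := by gcongr
  rcases eq_or_ne S 0 with rfl | hS0
  · have : matExponent α H 0 = 0 := by
      have h0 : ∀ R : Herm N, nu α (trPair R 0) = 0 := fun R => by
        have : trPair R 0 = 0 := by simp [trPair]
        rw [this, nu]
        split_ifs <;> simp [Real.zero_rpow hα.ne']
      simp [matExponent, h0]
    rw [this]
    simp only [neg_zero, Complex.exp_zero, Complex.one_re, sub_self]
    positivity
  have hρ : 0 < ‖S‖ := norm_pos_iff.2 hS0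
  set ρ := ‖S‖ with hρd
  set T : Herm N := ρ⁻¹ • S with hT
  have hST : S = ρ • T := by rw [hT, smul_smul, mul_inv_cancel₀ hρ.ne', one_smul]
  have hT1 : ‖T‖ = 1 := by rw [hT, norm_smul, norm_inv, norm_norm, inv_mul_cancel₀ hρ.ne']
  have hsm := matExponent_smul 𝓗 hα hs hρ hinv T
  rw [← hST] at hsm
  set θ : ℝ := logShift α ρ * (tZero (eigPart H) * trForm N T) with hθ
  set G := matExponent α H T with hG
  have hGn := hb1 T hT1.le
  have hGre := (abs_le.1 ((Complex.abs_re_le_norm G).trans hGn))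
  have hGim := (abs_le.1 ((Complex.abs_im_le_norm G).trans hGn))
  have hρα : 0 < ρ ^ α := Real.rpow_pos_of_pos hρ α
  have hρα1 : ρ ^ α ≤ 1 := Real.rpow_le_one hρ.le hS1.le hα.le
  -- the logarithm in the shift is absorbed by half a power of the scale
  have hθ2 : θ ^ 2 ≤ 4 * t ^ 2 * ρ ^ α := by
    have e1 : |tZero (eigPart H) * trForm N T| ≤ t := by
      rw [abs_mul, ht, trForm_eq_trPair_one, norm_eq_sqrt_trPair 1]
      gcongr
      exact abs_trPair_le (norm_eq_one_iff_trPair.1 hT1)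
    have e2 : logShift α ρ ^ 2 ≤ 4 * ρ ^ α := by
      rw [logShift]
      split_ifs with h1
      · have e3 := Real.abs_log_mul_self_rpow_lt ρ (1 / 2) hρ hS1.le (by norm_num)
        have e4 : (Real.log ρ * ρ ^ (1 / 2 : ℝ)) ^ 2 ≤ 4 := by
          have := abs_lt.1 e3
          nlinarith
        have e5 : (ρ ^ (1 / 2 : ℝ)) ^ 2 = ρ := by
          rw [← Real.rpow_natCast, ← Real.rpow_mul hρ.le]; norm_num
        have e6 : (2 / Real.pi) ^ 2 ≤ 1 := by
          refine pow_le_one₀ (by positivity) ?_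
          rw [div_le_one Real.pi_pos]; linarith [Real.pi_gt_three]
        rw [h1, Real.rpow_one]
        calc (2 / Real.pi * (ρ * Real.log ρ)) ^ 2
            = (2 / Real.pi) ^ 2 * (ρ * (Real.log ρ * ρ ^ (1 / 2 : ℝ)) ^ 2) := by
              rw [mul_pow (Real.log ρ), e5]; ring
          _ ≤ 1 * (ρ * 4) := by gcongr
          _ = 4 * ρ := by ring
      · rw [zero_pow two_ne_zero]; positivity
    have e3 : (tZero (eigPart H) * trForm N T) ^ 2 ≤ t ^ 2 :=
      sq_le_sq' (abs_le.1 e1).1 (abs_le.1 e1).2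
    rw [hθ, mul_pow]
    calc _ ≤ 4 * ρ ^ α * t ^ 2 := by gcongr
      _ = _ := by ring
  have hre : (matExponent α H S).re = ρ ^ α * G.re := by rw [hsm]; simp
  have him : (matExponent α H S).im = ρ ^ α * G.im + θ := by rw [hsm]; simp
  rw [Complex.exp_re, Complex.neg_re, Complex.neg_im, Real.cos_neg]
  set a := (matExponent α H S).re with ha
  set b := (matExponent α H S).im with hb
  have h1 : 1 - a ≤ Real.exp (-a) := by linarith [Real.add_one_le_exp (-a)]
  have h2 : 1 - b ^ 2 / 2 ≤ Real.cos b := Real.one_sub_sq_div_two_le_cos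
  have h3 : Real.exp (-a) ≤ 1 := Real.exp_le_one_iff.2 (by linarith [hre0 S])
  have h4 : 1 - Real.exp (-a) * Real.cos b ≤ a + b ^ 2 / 2 := by
    nlinarith [Real.exp_pos (-a), Real.cos_le_one b]
  have h5 : a ≤ B * ρ ^ α := by rw [hre]; nlinarith
  have h6 : b ^ 2 ≤ 2 * (ρ ^ α * G.im) ^ 2 + 2 * θ ^ 2 := by
    rw [him]; nlinarith [sq_nonneg (ρ ^ α * G.im - θ)]
  have h7 : (ρ ^ α * G.im) ^ 2 ≤ B ^ 2 * ρ ^ α := by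
    have : G.im ^ 2 ≤ B ^ 2 := sq_le_sq' hGim.1 hGim.2
    rw [mul_pow]
    calc (ρ ^ α) ^ 2 * G.im ^ 2 ≤ (ρ ^ α * 1) * B ^ 2 := by rw [sq]; gcongr
      _ = _ := by ring
  nlinarith

end Haar

end HaarChar

/-! ### Null sets and local diffeomorphisms -/

section NullImage

variable {E : Type*} [NormedAddCommGroup E] [NormedSpace ℝ E] [FiniteDimensional ℝ E]
  [MeasurableSpace E] [BorelSpace E]

/-- Near a point where the strict derivative is invertible, a map sends only null sets to null
sets. -/
theorem exists_nhds_null_of_image_null (μ : Measure E) [μ.IsAddHaarMeasure] {F : E → E}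
    {F' : E →L[ℝ] E} {x : E} (hF : HasStrictFDerivAt F F' x) (hinj : Function.Injective F') :
    ∃ u ∈ 𝓝 x, ∀ s ⊆ u, μ (F '' s) = 0 → μ s = 0 := by
  have hdet : F'.det ≠ 0 := fun h => by
    have h2 := LinearMap.bot_lt_ker_of_det_eq_zero h
    rw [LinearMap.ker_eq_bot.2 hinj] at h2
    exact lt_irrefl _ h2
  set m : NNReal := Real.toNNReal (|F'.det| / 2) with hm
  have hpos : 0 < |F'.det| := abs_pos.2 hdet
  have hm0 : m ≠ 0 := by
    rw [hm, Ne, Real.toNNReal_eq_zero]; linarith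
  have hlt : (m : ℝ≥0∞) < ENNReal.ofReal |F'.det| := by
    rw [hm]
    exact (ENNReal.ofReal_lt_ofReal_iff hpos).2 (by linarith)
  obtain ⟨δ, hδ, hδ0⟩ := ((mul_le_addHaar_image_of_lt_det μ F' hlt).and
    self_mem_nhdsWithin).exists
  obtain ⟨u, hu, hau⟩ := hF.approximates_deriv_on_nhds (c := δ) (Or.inr hδ0)
  refine ⟨u, hu, fun s hs h0 => ?_⟩
  have h := hδ s F (hau.mono_set hs)
  rw [h0, nonpos_iff_eq_zero, mul_eq_zero] at h
  exact h.resolve_left (by exact_mod_cast hm0)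

end NullImage

/-! ### The derivative of conjugation by exponentials -/

section Conjugation

/-- The derivative of `v ↦ e^{l v} (d v) e^{-l v}` at a zero of `l` is a commutator. -/
theorem exists_hasStrictFDerivAt_exp_mul_mul_exp {E F 𝔸 : Type*} [NormedAddCommGroup E]
    [NormedSpace ℝ E] [NormedAddCommGroup F] [NormedSpace ℝ F] [NormedRing 𝔸] [NormedAlgebra ℝ 𝔸]
    [CompleteSpace 𝔸] (l d : E →L[ℝ] 𝔸) (P : 𝔸 →L[ℝ] F) {w : E} (hl0 : l w = 0) :
    ∃ F' : E →L[ℝ] F, HasStrictFDerivAt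
      (fun v => P (NormedSpace.exp (l v) * d v * NormedSpace.exp (-l v))) F' w ∧
      ∀ h, F' h = P (d h + (l h * d w - d w * l h)) := by
  have hexp : HasStrictFDerivAt (fun v : E => NormedSpace.exp (l v)) l w := by
    have h1 : HasStrictFDerivAt (NormedSpace.exp : 𝔸 → 𝔸) (1 : 𝔸 →L[ℝ] 𝔸) (l w) := by
      rw [hl0]; exact hasStrictFDerivAt_exp_zero
    exact h1.comp w l.hasStrictFDerivAt
  have hexp2 : HasStrictFDerivAt (fun v : E => NormedSpace.exp (-l v)) (-l) w := by
    have h1 : HasStrictFDerivAt (NormedSpace.exp : 𝔸 → 𝔸) (1 : 𝔸 →L[ℝ] 𝔸) ((-l) w) := by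
      rw [neg_apply, hl0, neg_zero]; exact hasStrictFDerivAt_exp_zero
    exact h1.comp w (-l).hasStrictFDerivAt
  have hG := (hexp.fun_mul' d.hasStrictFDerivAt).fun_mul' hexp2
  refine ⟨_, P.hasStrictFDerivAt.comp w hG, fun h => ?_⟩
  rw [ContinuousLinearMap.comp_apply]
  congr 1
  simp only [hl0, neg_zero, NormedSpace.exp_zero, add_apply, smul_apply, neg_apply, one_mul,
    one_smul, MulOpposite.op_one, smul_eq_mul]
  noncomm_ring

attribute [local instance] Matrix.linftyOpNormedRing Matrix.linftyOpNormedAlgebra in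
/-- The same for matrices and linear maps. The norm used on matrices is auxiliary, since the
statement concerns only the topology of the matrices. -/
theorem exists_hasStrictFDerivAt_exp_mul_mul_exp_matrix {E F : Type*} [NormedAddCommGroup E]
    [NormedSpace ℝ E] [FiniteDimensional ℝ E] [NormedAddCommGroup F] [NormedSpace ℝ F] {N : ℕ}
    (l d : E →ₗ[ℝ] Matrix (Fin N) (Fin N) ℂ) (P : Matrix (Fin N) (Fin N) ℂ →ₗ[ℝ] F) {w : E}
    (hl0 : l w = 0) :
    ∃ F' : E →L[ℝ] F, HasStrictFDerivAt
      (fun v => P (NormedSpace.exp (l v) * d v * NormedSpace.exp (-l v))) F' w ∧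
      ∀ h, F' h = P (d h + (l h * d w - d w * l h)) :=
  exists_hasStrictFDerivAt_exp_mul_mul_exp (LinearMap.toContinuousLinearMap l)
    (LinearMap.toContinuousLinearMap d) (LinearMap.toContinuousLinearMap P) hl0

end Conjugation

/-! ### Spectral coordinates near a regular diagonal matrix -/

section Diagonalisation

attribute [local instance] hermNormed hermInner

variable {N : ℕ} {W : Submodule ℝ (Herm N)}

theorem skew_of_herm (S : Herm N) :
    (Complex.I • (S : Matrix (Fin N) (Fin N) ℂ))ᴴ =
      -(Complex.I • (S : Matrix (Fin N) (Fin N) ℂ)) := by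
  rw [Matrix.conjTranspose_smul, (isHermitian S).eq]
  simp

theorem conjTranspose_exp_I_smul (S : Herm N) :
    (NormedSpace.exp (Complex.I • (S : Matrix (Fin N) (Fin N) ℂ)))ᴴ =
      NormedSpace.exp (-(Complex.I • (S : Matrix (Fin N) (Fin N) ℂ))) := by
  rw [← Matrix.exp_conjTranspose, skew_of_herm]

/-- The unitary matrix `exp (i S)`. -/
def expUnitary (S : Herm N) : UGroup N :=
  ⟨NormedSpace.exp (Complex.I • (S : Matrix (Fin N) (Fin N) ℂ)), by
    rw [Matrix.mem_unitaryGroup_iff, Matrix.star_eq_conjTranspose, conjTranspose_exp_I_smul,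
      ← Matrix.exp_add_of_commute _ _ (Commute.refl
        (Complex.I • (S : Matrix (Fin N) (Fin N) ℂ))).neg_right, add_neg_cancel,
      NormedSpace.exp_zero]⟩

theorem mem_of_trForm_eq (hW : W = ⊤ ∨ W = Herm₀ N) {S T : Herm N} (hS : S ∈ W)
    (h : trForm N T = trForm N S) : T ∈ W := by
  rcases hW with rfl | rfl
  · trivial
  · rw [Herm₀, LinearMap.mem_ker] at hS ⊢
    rw [h, hS]

/-- The diagonal matrix with the diagonal of `S`, as a linear map. -/
def diagPart (N : ℕ) : Herm N →ₗ[ℝ] Herm N where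
  toFun S := diagMat (diagVec S)
  map_add' R S := by rw [diagVec_add, diagMat_add]
  map_smul' c S := by rw [diagVec_smul, diagMat_smul]; rfl

theorem diagPart_apply (S : Herm N) : diagPart N S = diagMat (diagVec S) := rfl

/-- The matrix `e^{iO} D e^{-iO}`, where `D` and `O` are the diagonal and the off-diagonal part of
`w`. -/
def rotDiag (hW : W = ⊤ ∨ W = Herm₀ N) (w : W) : W :=
  ⟨conj (expUnitary ((w : Herm N) - diagPart N w)) (diagPart N w),
    conj_mem hW _ (diagMat_mem_of_mem hW w.2)⟩

/-- The inclusion of `W` in the matrices. -/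
def inclMat (W : Submodule ℝ (Herm N)) : W →ₗ[ℝ] Matrix (Fin N) (Fin N) ℂ where
  toFun w := ((w : Herm N) : Matrix (Fin N) (Fin N) ℂ)
  map_add' _ _ := rfl
  map_smul' _ _ := rfl

theorem inclMat_injective : Function.Injective (inclMat W) := fun _ _ h =>
  Subtype.ext (Subtype.ext h)

/-- The diagonal part of an element of `W`, as a matrix. -/
def diagInclMat (W : Submodule ℝ (Herm N)) : W →ₗ[ℝ] Matrix (Fin N) (Fin N) ℂ where
  toFun w := ((diagPart N w : Herm N) : Matrix (Fin N) (Fin N) ℂ)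
  map_add' _ _ := by rw [Submodule.coe_add, map_add]; rfl
  map_smul' _ _ := by rw [Submodule.coe_smul, map_smul]; rfl

/-- `i` times the off-diagonal part of an element of `W`, as a matrix. -/
def offInclMat (W : Submodule ℝ (Herm N)) : W →ₗ[ℝ] Matrix (Fin N) (Fin N) ℂ where
  toFun w := Complex.I • (((w : Herm N) - diagPart N w : Herm N) : Matrix (Fin N) (Fin N) ℂ)
  map_add' x y := by
    rw [Submodule.coe_add, map_add, add_sub_add_comm, AddSubgroup.coe_add, smul_add]
  map_smul' c x := by
    rw [Submodule.coe_smul, map_smul, ← smul_sub, selfAdjoint.val_smul, smul_comm, RingHom.id_apply]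

/-- Diagonal matrices with distinct entries. -/
def IsRegularDiag (S : Herm N) : Prop := ∀ i j, i ≠ j → diagVec S i ≠ diagVec S j

/-- At a diagonal matrix with distinct entries the map `D + O ↦ e^{iO} D e^{-iO}` has an injective
derivative: the commutator multiplies the off-diagonal entry `(i, j)` by the difference of the
diagonal entries. -/
theorem exists_hasStrictFDerivAt_rotDiag (hW : W = ⊤ ∨ W = Herm₀ N) (w : W)
    (hd : diagPart N (w : Herm N) = w) (hr : IsRegularDiag (w : Herm N)) :
    ∃ F' : W →L[ℝ] W, HasStrictFDerivAt (rotDiag hW) F' w ∧ Function.Injective F' := by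
  obtain ⟨p, hp⟩ := (inclMat W).exists_leftInverse_of_injective
    (LinearMap.ker_eq_bot.2 inclMat_injective)
  have hp' : ∀ v : W, p (inclMat W v) = v := fun v => LinearMap.congr_fun hp v
  let l : W →ₗ[ℝ] Matrix (Fin N) (Fin N) ℂ := offInclMat W
  let d : W →ₗ[ℝ] Matrix (Fin N) (Fin N) ℂ := diagInclMat W
  have hl0 : l w = 0 := by
    change Complex.I • (((w : Herm N) - diagPart N w : Herm N) : Matrix (Fin N) (Fin N) ℂ) = 0
    rw [hd, sub_self]; simp
  obtain ⟨F', hF, hF'⟩ := exists_hasStrictFDerivAt_exp_mul_mul_exp_matrix l d p hl0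
  have hfun : (fun v : W => p (NormedSpace.exp (l v) * d v * NormedSpace.exp (-l v))) =
      rotDiag hW := by
    funext v
    refine (congrArg p ?_).trans (hp' (rotDiag hW v))
    change _ = NormedSpace.exp (l v) * d v * (NormedSpace.exp (l v))ᴴ
    congr 1
    exact (conjTranspose_exp_I_smul _).symm
  rw [hfun] at hF
  refine ⟨F', hF, ?_⟩
  rw [injective_iff_map_eq_zero]
  intro h hh
  have hval : p (d h + (l h * d w - d w * l h)) = 0 := by
    rw [← hF', hh]
  have hsk : (l h)ᴴ = -l h := skew_of_herm _
  have hdw : (d w)ᴴ = d w := isHermitian _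
  have hdh : (d h)ᴴ = d h := isHermitian _
  let k : Herm N := ⟨d h + (l h * d w - d w * l h), by
    rw [selfAdjoint.mem_iff, Matrix.star_eq_conjTranspose, Matrix.conjTranspose_add,
      Matrix.conjTranspose_sub, Matrix.conjTranspose_mul, Matrix.conjTranspose_mul, hsk, hdw, hdh]
    noncomm_ring⟩
  have hk : k ∈ W := by
    refine mem_of_trForm_eq hW (diagMat_mem_of_mem hW h.2) ?_
    change (Matrix.trace (d h + (l h * d w - d w * l h))).re = (Matrix.trace (d h)).re
    rw [Matrix.trace_add, Matrix.trace_sub, Matrix.trace_mul_comm (l h), sub_self, add_zero]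
  have hk0 : d h + (l h * d w - d w * l h) = 0 := by
    have h1 : (⟨k, hk⟩ : W) = 0 := (hp' ⟨k, hk⟩).symm.trans hval
    have h2 := congrArg (inclMat W) h1
    rw [map_zero] at h2
    exact h2
  have hdiag : ∀ (v : W) i j, d v i j = if i = j then (diagVec (v : Herm N) i : ℂ) else 0 :=
    fun v i j => by
      change Matrix.diagonal (fun i => (diagVec (v : Herm N) i : ℂ)) i j = _
      rw [Matrix.diagonal_apply]
  have hoff : ∀ i j, l h i j =
      Complex.I * ((((h : Herm N) : Matrix (Fin N) (Fin N) ℂ)) i j - d h i j) := fun i j => rfl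
  have hentry : ∀ i j, d h i j + l h i j * ((diagVec (w : Herm N) j : ℂ) -
      diagVec (w : Herm N) i) = 0 := fun i j => by
    have h1 := congrFun (congrFun hk0 i) j
    have h2 : d w = Matrix.diagonal fun i => (diagVec (w : Herm N) i : ℂ) := rfl
    rw [Matrix.add_apply, Matrix.sub_apply, h2, Matrix.mul_diagonal, Matrix.diagonal_mul,
      Matrix.zero_apply] at h1
    rw [← h1]; ring
  refine Subtype.ext (Subtype.ext ?_)
  ext i j
  have h1 := hentry i j
  change ((h : Herm N) : Matrix (Fin N) (Fin N) ℂ) i j = 0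
  by_cases hij : i = j
  · subst hij
    rw [sub_self, mul_zero, add_zero, hdiag, if_pos rfl] at h1
    have him : (((h : Herm N) : Matrix (Fin N) (Fin N) ℂ) i i).im = 0 := by
      have := congrArg Complex.im (star_apply (h : Herm N) i i)
      simp only [Complex.conj_im] at this
      linarith
    exact Complex.ext (by exact_mod_cast h1) him
  · rw [hoff, hdiag, if_neg hij, zero_add, sub_zero, mul_eq_zero, mul_eq_zero] at h1
    rcases h1 with (h1 | h1) | h1
    · exact absurd h1 Complex.I_ne_zero
    · exact h1
    · exact absurd (by exact_mod_cast (sub_eq_zero.1 h1).symm) (hr i j hij)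

end Diagonalisation

/-! ### Conjugation-invariant null sets -/

section NullSets

attribute [local instance] hermNormed hermInner

variable {N : ℕ} {W : Submodule ℝ (Herm N)}

theorem diagPart_diagPart (S : Herm N) : diagPart N (diagPart N S) = diagPart N S := by
  rw [diagPart_apply, diagPart_apply, diagVec_diagMat]

/-- The map `S ↦ S_{ii} - S_{jj}` on `W`. -/
def diagDiff (W : Submodule ℝ (Herm N)) (i j : Fin N) : W →ₗ[ℝ] ℝ where
  toFun w := diagVec (w : Herm N) i - diagVec (w : Herm N) j
  map_add' x y := by
    rw [Submodule.coe_add, diagVec_add, Pi.add_apply, Pi.add_apply]; ring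
  map_smul' c x := by
    rw [Submodule.coe_smul, diagVec_smul, Pi.smul_apply, Pi.smul_apply, ← smul_sub]; rfl

theorem ker_diagDiff_ne_top (hW : W = ⊤ ∨ W = Herm₀ N) {i j : Fin N} (hij : i ≠ j) :
    (diagDiff W i j).ker ≠ ⊤ := by
  intro h
  have hm : diagMat (Pi.single i 1 - Pi.single j 1) ∈ W := by
    rcases hW with rfl | rfl
    · trivial
    · rw [Herm₀, LinearMap.mem_ker, trForm_eq_sum_diagVec, diagVec_diagMat]
      simp
  have h1 : (⟨_, hm⟩ : W) ∈ (diagDiff W i j).ker := by rw [h]; trivial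
  rw [LinearMap.mem_ker] at h1
  change diagVec (diagMat (Pi.single i 1 - Pi.single j 1)) i -
    diagVec (diagMat (Pi.single i 1 - Pi.single j 1)) j = 0 at h1
  rw [diagVec_diagMat] at h1
  simp [hij, hij.symm] at h1

theorem measure_irregular_eq_zero (hW : W = ⊤ ∨ W = Herm₀ N) (μ : Measure W)
    [μ.IsAddHaarMeasure] : μ {w : W | ¬ IsRegularDiag (w : Herm N)} = 0 := by
  have hsub : {w : W | ¬ IsRegularDiag (w : Herm N)} ⊆
      ⋃ i : Fin N, ⋃ j : Fin N, ⋃ _ : i ≠ j, ((diagDiff W i j).ker : Set W) := by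
    intro w hw
    simp only [IsRegularDiag, Set.mem_ofPred_eq, not_forall, not_not] at hw
    obtain ⟨i, j, hij, h⟩ := hw
    simp only [Set.mem_iUnion]
    exact ⟨i, j, hij, LinearMap.mem_ker.2 (sub_eq_zero.2 h)⟩
  refine measure_mono_null hsub ?_
  refine measure_iUnion_null fun i => measure_iUnion_null fun j => measure_iUnion_null fun hij => ?_
  exact Measure.addHaar_submodule μ _ (ker_diagDiff_ne_top hW hij)

/-- Matrices whose diagonal lies in a null set which is stable under conjugation form a null set. -/
theorem measure_diagPart_mem_eq_zero (hW : W = ⊤ ∨ W = Herm₀ N) (μ : Measure W)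
    [μ.IsAddHaarMeasure] {Z : Set (Herm N)} (hinv : ∀ (U : UGroup N), ∀ S ∈ Z, conj U S ∈ Z)
    (h0 : μ (Subtype.val ⁻¹' Z) = 0) : μ {w : W | diagPart N (w : Herm N) ∈ Z} = 0 := by
  set T : Set W := {w : W | diagPart N (w : Herm N) ∈ Z} with hT
  have hreg : μ (T ∩ {w : W | IsRegularDiag (w : Herm N)}) = 0 := by
    refine measure_null_of_locally_null _ fun w₀ hw₀ => ?_
    let x : W := ⟨diagPart N (w₀ : Herm N), diagMat_mem_of_mem hW w₀.2⟩
    have hxr : IsRegularDiag (x : Herm N) := fun i j hij => by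
      have := hw₀.2 i j hij
      change diagVec (diagMat (diagVec (w₀ : Herm N))) i ≠
        diagVec (diagMat (diagVec (w₀ : Herm N))) j
      rwa [diagVec_diagMat]
    obtain ⟨F', hF, hF'⟩ := exists_hasStrictFDerivAt_rotDiag hW x (diagPart_diagPart _) hxr
    obtain ⟨u, hu, hus⟩ := exists_nhds_null_of_image_null μ hF hF'
    have hnull : μ (u ∩ T) = 0 := by
      refine hus _ Set.inter_subset_left (measure_mono_null ?_ h0)
      rintro _ ⟨w, hw, rfl⟩
      exact hinv _ _ hw.2
    refine ⟨(fun w => w + (x - w₀)) ⁻¹' (u ∩ T), ?_, ?_⟩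
    · -- both the neighbourhood and `T` are moved along off-diagonal matrices
      have h1 : (fun w => w + (x - w₀)) ⁻¹' u ∈ 𝓝 w₀ := by
        have hc : ContinuousAt (fun w : W => w + (x - w₀)) w₀ := by fun_prop
        refine hc.preimage_mem_nhds ?_
        simpa using hu
      refine Filter.mem_of_superset
        (inter_mem (mem_nhdsWithin_of_mem_nhds h1) self_mem_nhdsWithin) ?_
      rintro w ⟨hw1, hw2, -⟩
      refine ⟨hw1, ?_⟩
      change diagPart N ((w : Herm N) + (diagPart N (w₀ : Herm N) - w₀)) ∈ Z
      rw [map_add, map_sub, diagPart_diagPart, sub_self, add_zero]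
      exact hw2
    · rw [measure_preimage_add_right, hnull]
  refine measure_mono_null (fun w hw => ?_)
    (measure_union_null hreg (measure_irregular_eq_zero hW μ))
  by_cases h : IsRegularDiag (w : Herm N)
  · exact Or.inl ⟨hw, h⟩
  · exact Or.inr h

/-- The trace on the diagonal matrices of a null set which is stable under conjugation is a null
set. -/
theorem ae_diagSub_notMem (hW : W = ⊤ ∨ W = Herm₀ N) (μ : Measure W) [μ.IsAddHaarMeasure]
    (ν : Measure (diagSub W)) [ν.IsAddHaarMeasure]
    {Z : Set (Herm N)} (hZ : MeasurableSet Z) (hinv : ∀ (U : UGroup N), ∀ S ∈ Z, conj U S ∈ Z)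
    (h0 : μ (Subtype.val ⁻¹' Z) = 0) : ∀ᵐ x : diagSub W ∂ν, (x : Herm N) ∉ Z := by
  let L : W →ₗ[ℝ] diagSub W := LinearMap.codRestrict (diagSub W) (diagPart N ∘ₗ W.subtype)
    fun w => ⟨diagMat_mem_of_mem hW w.2, diagPart_diagPart _⟩
  have hL : Function.Surjective L := fun x => ⟨⟨x, x.2.1⟩, Subtype.ext x.2.2⟩
  have h := ae_comp_linearMap_mem_iff L μ ν hL (s := Subtype.val ⁻¹' Zᶜ)
    (measurable_subtype_coe hZ.compl)
  refine h.1 ?_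
  have h1 := measure_diagPart_mem_eq_zero hW μ hinv h0
  filter_upwards [measure_eq_zero_iff_ae_notMem.1 h1] with w hw
  exact hw

/-- Conjugation by `U`, as a linear map of `W`. -/
def conjW (hW : W = ⊤ ∨ W = Herm₀ N) (U : UGroup N) : W →ₗ[ℝ] W where
  toFun w := ⟨conj U w, conj_mem hW U w.2⟩
  map_add' _ _ := Subtype.ext (conj_add U _ _)
  map_smul' c _ := Subtype.ext (conj_smul U c _)

theorem det_conjW_ne_zero (hW : W = ⊤ ∨ W = Herm₀ N) (U : UGroup N) :
    LinearMap.det (conjW hW U) ≠ 0 := fun h => by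
  have h2 := LinearMap.bot_lt_ker_of_det_eq_zero h
  rw [LinearMap.ker_eq_bot.2 ?_] at h2
  · exact lt_irrefl _ h2
  · intro x y hxy
    have h1 : conj U (x : Herm N) = conj U y := congrArg Subtype.val hxy
    exact Subtype.ext (by rw [← conj_inv_conj U (x : Herm N), h1, conj_inv_conj])

/-- If `S` has a density on the diagonal matrices of `W` and `U` is Haar distributed and
independent of `S`, then `U S U†` has a density on `W`. -/
theorem ae_ae_conj_notMem (hW : W = ⊤ ∨ W = Herm₀ N) (μ : Measure W) [μ.IsAddHaarMeasure]
    (𝓗 : Measure (UGroup N)) [IsProbabilityMeasure 𝓗] [𝓗.IsMulRightInvariant]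
    {κ : Measure (diagSub W)} (ν : Measure (diagSub W)) [ν.IsAddHaarMeasure] (hκ : κ ≪ ν)
    {A : Set (Herm N)} (hA : MeasurableSet A) (h0 : μ (Subtype.val ⁻¹' A) = 0) :
    ∀ᵐ x : diagSub W ∂κ, ∀ᵐ U ∂𝓗, conj U (x : Herm N) ∉ A := by
  refine hκ.ae_le ?_
  set Z : Set (Herm N) := {S | ¬ ∀ᵐ U ∂𝓗, conj U S ∉ A} with hZ
  have hZm : MeasurableSet Z := by
    have h1 : MeasurableSet {p : UGroup N × Herm N | conj p.1 p.2 ∈ A} := measurable_conj hA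
    have h2 : Measurable fun S : Herm N => 𝓗 {U | conj U S ∈ A} :=
      measurable_measure_prodMk_right h1
    have h3 : Z = {S | 𝓗 {U | conj U S ∈ A} = 0}ᶜ := by
      ext S
      simp only [hZ, ae_iff, not_not, Set.mem_ofPred_eq, Set.mem_compl_iff]
    rw [h3]
    exact (h2 (measurableSet_singleton 0)).compl
  have hinv : ∀ (V : UGroup N), ∀ S ∈ Z, conj V S ∈ Z := fun V S hS hcon => hS (by
    rw [ae_iff] at hcon ⊢
    simp only [not_not] at hcon ⊢
    have h1 : {U : UGroup N | conj U (conj V S) ∈ A} = (· * V) ⁻¹' {U | conj U S ∈ A} := by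
      ext U; simp [conj_conj]
    rwa [h1, measure_preimage_mul_right] at hcon)
  refine (ae_diagSub_notMem hW μ ν hZm hinv ?_).mono fun x hx => not_not.1 hx
  have h1 : MeasurableSet {p : UGroup N × W | conj p.1 (p.2 : Herm N) ∉ A} := by
    have h2 : Measurable fun p : UGroup N × W => conj p.1 (p.2 : Herm N) := by
      have h3 := measurable_conj.comp (measurable_fst.prodMk
        ((measurable_subtype_coe (p := fun S : Herm N => S ∈ W)).comp
          (measurable_snd (α := UGroup N) (β := W))))
      exact h3
    exact h2 hA.compl
  have h2 : ∀ᵐ U ∂𝓗, ∀ᵐ w : W ∂μ, conj U (w : Herm N) ∉ A := ae_of_all _ fun U => by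
    have h3 := Measure.addHaar_preimage_linearMap μ (det_conjW_ne_zero hW U) (Subtype.val ⁻¹' A)
    rw [h0, mul_zero] at h3
    exact measure_eq_zero_iff_ae_notMem.1 h3
  have h3 := (Measure.ae_ae_comm h1).1 h2
  rw [measure_eq_zero_iff_ae_notMem]
  exact h3.mono fun w hw => not_not.2 hw

end NullSets

/-! ### Absolute continuity of a summand and of the limit -/

section Summand

attribute [local instance] hermNormed hermInner

variable {N : ℕ} {W : Submodule ℝ (Herm N)} {H : Measure (Herm N)} {α : ℝ}

theorem charFun_eq_integral_trPair (μ : Measure (Herm N)) (S : Herm N) :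
    charFun μ S = ∫ X, Complex.exp (Complex.I * (trPair S X : ℂ)) ∂μ := by
  rw [charFun_apply]
  refine integral_congr_ae (ae_of_all _ fun X => ?_)
  simp only
  rw [inner_eq_trPair, trPair_comm, mul_comm]

theorem charFun_of_isStableLaw {μ : Measure (Herm N)} (h : IsStableLaw trPair α H μ)
    (S : Herm N) : charFun μ S = Complex.exp (-matExponent α H S) := by
  rw [charFun_eq_integral_trPair, h.2 S, matExponent]

theorem measurable_diagMat : Measurable (diagMat : (Fin N → ℝ) → Herm N) :=
  continuous_diagMat.measurable

theorem integral_exp_trPair_diagMat {ν : Measure (Fin N → ℝ)}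
    (h : IsStableLaw dotProduct α (eigPart H) ν) (S : Herm N) :
    ∫ x, Complex.exp (Complex.I * (trPair S (diagMat x) : ℂ)) ∂ν =
      Complex.exp (-eigExponent α H S) := by
  rw [eigExponent, ← h.2 (diagVec S)]
  refine integral_congr_ae (ae_of_all _ fun X => ?_)
  simp only
  rw [trPair_comm, trPair_diagMat, dotProduct_comm]

theorem measurable_exp_trPair (S : Herm N) :
    Measurable fun X : Herm N => Complex.exp (Complex.I * (trPair S X : ℂ)) := by
  have h : Measurable fun X : Herm N => trPair S X := by
    simp only [trPair_comm S]
    exact measurable_trPair_left S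
  exact ((Complex.measurable_ofReal.comp h).const_mul _).cexp

theorem charFun_map_diagMat {ν : Measure (Fin N → ℝ)}
    (h : IsStableLaw dotProduct α (eigPart H) ν) (S : Herm N) :
    charFun (ν.map diagMat) S = Complex.exp (-eigExponent α H S) := by
  rw [charFun_eq_integral_trPair, integral_map measurable_diagMat.aemeasurable
    (measurable_exp_trPair S).aestronglyMeasurable, integral_exp_trPair_diagMat h]

theorem nu_zero (hα : 0 < α) : nu α 0 = 0 := by
  rw [nu]
  split_ifs <;> simp [Real.zero_rpow hα.ne']

/-- The eigenvalue part is carried by the spectra of the matrices of `W`. -/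
theorem IsSpectralMeasure.ae_diagMat_mem (hH : IsSpectralMeasure W H)
    (hW : W = ⊤ ∨ W = Herm₀ N) : ∀ᵐ r ∂eigPart H, diagMat r ∈ W := by
  have hm : MeasurableSet {r : Fin N → ℝ | diagMat r ∈ W} :=
    measurable_diagMat (Submodule.closed_of_finiteDimensional W).measurableSet
  rw [ae_eigPart_iff hm]
  intro σ
  filter_upwards [hH.sphere] with R hR
  obtain ⟨V, hV⟩ := conj_conj_permUnitary_eigenvalues R σ
  rw [hV]
  exact conj_mem hW V hR.1

/-- The matrix `diag(X)` of a stable vector lies in `W`: its characteristic function is one on the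
orthogonal complement of the diagonal matrices of `W`. -/
theorem ae_mem_diagSub (hα : 0 < α) (hH : IsSpectralMeasure W H) (hW : W = ⊤ ∨ W = Herm₀ N)
    {ν : Measure (Fin N → ℝ)} (h : IsStableLaw dotProduct α (eigPart H) ν) :
    ∀ᵐ S ∂ν.map diagMat, S ∈ diagSub W := by
  have := h.1
  have : IsProbabilityMeasure (ν.map (diagMat : (Fin N → ℝ) → Herm N)) :=
    Measure.isProbabilityMeasure_map measurable_diagMat.aemeasurable
  refine ae_mem_of_charFun_eq_one (diagSub W) fun s hs => ?_
  have h0 : eigExponent α H s = 0 := by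
    rw [eigExponent]
    refine integral_eq_zero_of_ae ?_
    filter_upwards [hH.ae_diagMat_mem hW] with r hr
    have h1 := (Submodule.mem_orthogonal _ _).1 hs _ (diagMat_mem_diagSub.2 hr)
    rw [inner_eq_trPair, trPair_diagMat] at h1
    rw [h1, nu_zero hα]; rfl
  rw [charFun_map_diagMat h, h0, neg_zero, Complex.exp_zero]

theorem projLaw_diagSub_absolutelyContinuous (hα : 0 < α) (hH : IsSpectralMeasure W H)
    (hW : W = ⊤ ∨ W = Herm₀ N) {ν : Measure (Fin N → ℝ)}
    (h : IsStableLaw dotProduct α (eigPart H) ν) :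
    projLaw (diagSub W) (ν.map diagMat) ≪ volume := by
  have := h.1
  have : IsProbabilityMeasure (ν.map (diagMat : (Fin N → ℝ) → Herm N)) :=
    Measure.isProbabilityMeasure_map measurable_diagMat.aemeasurable
  have := isProbabilityMeasure_projLaw (diagSub W) (ν.map (diagMat : (Fin N → ℝ) → Herm N))
  refine absolutelyContinuous_of_integrable_charFun ?_
  obtain ⟨c, hc, hcb⟩ := hH.exists_le_eigExponent_re hW hα
  refine integrable_of_norm_le_exp hα hc measurable_charFun fun s => ?_
  rw [charFun_projLaw, charFun_map_diagMat h, Complex.norm_exp, Real.exp_le_exp, Complex.neg_re,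
    neg_mul, neg_le_neg_iff]
  have h1 := hcb s s.2.1
  rwa [s.2.2] at h1

theorem measurableEmbedding_val (V : Submodule ℝ (Herm N)) :
    MeasurableEmbedding (Subtype.val : V → Herm N) :=
  MeasurableEmbedding.subtype_coe (Submodule.closed_of_finiteDimensional V).measurableSet

variable {Ω : Type*} [MeasurableSpace Ω] {P : Measure Ω} {X : Ω → Fin N → ℝ} {U : Ω → UGroup N}

theorem ae_summand_mem (hα : 0 < α) (hH : IsSpectralMeasure W H) (hW : W = ⊤ ∨ W = Herm₀ N)
    (hX : Measurable X) (h : IsStableLaw dotProduct α (eigPart H) (P.map X)) :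
    ∀ᵐ ω ∂P, conj (U ω) (diagMat (X ω)) ∈ W := by
  have h1 := ae_of_ae_map hX.aemeasurable
    (ae_of_ae_map measurable_diagMat.aemeasurable (ae_mem_diagSub hα hH hW h))
  filter_upwards [h1] with ω hω
  exact conj_mem hW _ hω.1

variable [IsProbabilityMeasure P]

theorem measurable_conj_diagMat : Measurable fun p : (Fin N → ℝ) × UGroup N =>
    conj p.2 (diagMat p.1) := continuous_conj_diagMat.measurable

theorem measurable_summand (hX : Measurable X) (hU : Measurable U) :
    Measurable fun ω => conj (U ω) (diagMat (X ω)) := by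
  have h := measurable_conj_diagMat.comp (hX.prodMk hU)
  exact h

theorem map_summand (hX : Measurable X) (hU : Measurable U) (hXU : IndepFun X U P) :
    P.map (fun ω => conj (U ω) (diagMat (X ω))) =
      ((P.map X).prod (P.map U)).map fun p => conj p.2 (diagMat p.1) := by
  rw [← (indepFun_iff_map_prod_eq_prod_map_map hX.aemeasurable hU.aemeasurable).1 hXU,
    Measure.map_map measurable_conj_diagMat (hX.prodMk hU)]
  rfl

/-- Conditioning on the unitary matrix. -/
theorem charFun_summand (hX : Measurable X) (hU : Measurable U) (hXU : IndepFun X U P)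
    (h : IsStableLaw dotProduct α (eigPart H) (P.map X)) (S : Herm N) :
    charFun (P.map fun ω => conj (U ω) (diagMat (X ω))) S = haarChar (P.map U) α H S := by
  have : IsProbabilityMeasure (P.map U) := Measure.isProbabilityMeasure_map hU.aemeasurable
  have := h.1
  have hi : Integrable (fun p : (Fin N → ℝ) × UGroup N =>
      Complex.exp (Complex.I * (trPair S (conj p.2 (diagMat p.1)) : ℂ)))
      ((P.map X).prod (P.map U)) := by
    refine Integrable.of_bound (C := 1)
      ((measurable_exp_trPair S).comp measurable_conj_diagMat).aestronglyMeasurable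
      (ae_of_all _ fun p => ?_)
    rw [mul_comm, Complex.norm_exp_ofReal_mul_I]
  rw [charFun_eq_integral_trPair, map_summand hX hU hXU,
    integral_map measurable_conj_diagMat.aemeasurable
      (measurable_exp_trPair S).aestronglyMeasurable, integral_prod_symm _ hi, haarChar]
  refine integral_congr_ae (ae_of_all _ fun V => ?_)
  simp only
  rw [← integral_exp_trPair_diagMat h]
  simp only [trPair_conj_left, inv_inv]

/-- The law of a single summand is absolutely continuous on `W`. -/
theorem map_summand_eq_zero (hα : 0 < α) (hH : IsSpectralMeasure W H) (hW : W = ⊤ ∨ W = Herm₀ N)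
    (vol : Measure W) [vol.IsAddHaarMeasure]
    (hX : Measurable X) (hU : Measurable U) (hXU : IndepFun X U P)
    (h : IsStableLaw dotProduct α (eigPart H) (P.map X)) [(P.map U).IsMulRightInvariant]
    {A : Set (Herm N)} (hA : MeasurableSet A) (h0 : vol (Subtype.val ⁻¹' A) = 0) :
    P.map (fun ω => conj (U ω) (diagMat (X ω))) A = 0 := by
  have : IsProbabilityMeasure (P.map U) := Measure.isProbabilityMeasure_map hU.aemeasurable
  have := h.1
  have h1 := ae_ae_conj_notMem hW vol (P.map U) volume
    (projLaw_diagSub_absolutelyContinuous hα hH hW h) hA h0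
  have h2 : ∀ᵐ S ∂(P.map X).map diagMat, ∀ᵐ V ∂P.map U, conj V S ∉ A := by
    rw [← map_val_projLaw (ae_mem_diagSub hα hH hW h)]
    exact (measurableEmbedding_val (diagSub W)).ae_map_iff.2 h1
  have h3 := ae_of_ae_map measurable_diagMat.aemeasurable h2
  rw [map_summand hX hU hXU, Measure.map_apply measurable_conj_diagMat hA,
    Measure.measure_prod_null (measurable_conj_diagMat hA)]
  filter_upwards [h3] with x hx
  exact measure_eq_zero_iff_ae_notMem.2 hx

theorem ae_mem_of_isStableLaw (hα : 0 < α) (hH : IsSpectralMeasure W H)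
    {μ : Measure (Herm N)} (h : IsStableLaw trPair α H μ) : ∀ᵐ S ∂μ, S ∈ W := by
  have := h.1
  refine ae_mem_of_charFun_eq_one W fun s hs => ?_
  have h0 : matExponent α H s = 0 := by
    rw [matExponent]
    refine integral_eq_zero_of_ae ?_
    filter_upwards [hH.sphere] with R hR
    have h1 := (Submodule.mem_orthogonal _ _).1 hs _ hR.1
    rw [inner_eq_trPair] at h1
    rw [h1, nu_zero hα]; rfl
  rw [charFun_of_isStableLaw h, h0, neg_zero, Complex.exp_zero]

theorem projLaw_absolutelyContinuous_of_isStableLaw (hα : 0 < α) (hH : IsSpectralMeasure W H)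
    (vol : Measure W) [vol.IsAddHaarMeasure]
    {μ : Measure (Herm N)} (h : IsStableLaw trPair α H μ) : projLaw W μ ≪ vol := by
  refine Measure.AbsolutelyContinuous.trans ?_
    (Measure.absolutelyContinuous_isAddHaarMeasure volume vol)
  have := h.1
  have := isProbabilityMeasure_projLaw W μ
  refine absolutelyContinuous_of_integrable_charFun ?_
  obtain ⟨c, hc, hcb⟩ := hH.exists_le_matExponent_re hα
  refine integrable_of_norm_le_exp hα hc measurable_charFun fun s => ?_
  rw [charFun_projLaw, charFun_of_isStableLaw h, Complex.norm_exp, Real.exp_le_exp,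
    Complex.neg_re, neg_mul, neg_le_neg_iff]
  exact hcb s s.2

end Summand

/-! ### Densities on the subspace -/

section Densities

attribute [local instance] hermNormed hermInner

variable {N : ℕ} {W : Submodule ℝ (Herm N)} {vol : Measure W} {μ : Measure (Herm N)}

theorem projLaw_map_val (ν : Measure W) : projLaw W (ν.map Subtype.val) = ν := by
  rw [projLaw, Measure.map_map (ContinuousLinearMap.measurable _) measurable_subtype_coe]
  refine (Measure.map_congr (g := id) (ae_of_all _ fun x => ?_)).trans Measure.map_id
  exact Submodule.orthogonalProjectionOnto_mem_subspace_eq_self x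

theorem IsDensity.projLaw_eq {p : W → ℝ} (h : IsDensity vol μ p) :
    projLaw W μ = vol.withDensity fun x => ENNReal.ofReal (p x) := by
  rw [h.2.2, projLaw_map_val]

theorem exists_isDensity [vol.IsAddHaarMeasure] [IsProbabilityMeasure μ] (h : ∀ᵐ x ∂μ, x ∈ W)
    (hac : projLaw W μ ≪ vol) : ∃ p : W → ℝ, IsDensity vol μ p := by
  have := isProbabilityMeasure_projLaw W μ
  refine ⟨fun x => ((projLaw W μ).rnDeriv vol x).toReal,
    (Measure.measurable_rnDeriv _ _).ennreal_toReal, fun _ => ENNReal.toReal_nonneg, ?_⟩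
  have h1 : (vol.withDensity fun x => ENNReal.ofReal ((projLaw W μ).rnDeriv vol x).toReal) =
      projLaw W μ := by
    conv_rhs => rw [← Measure.withDensity_rnDeriv_eq _ _ hac]
    refine withDensity_congr_ae ?_
    filter_upwards [Measure.rnDeriv_lt_top (projLaw W μ) vol] with x hx
    exact ENNReal.ofReal_toReal hx.ne
  rw [h1, map_val_projLaw h]

theorem IsDensity.integrable [IsProbabilityMeasure μ] {p : W → ℝ} (h : IsDensity vol μ p) :
    Integrable p vol ∧ ∫ x, p x ∂vol = 1 := by
  have := isProbabilityMeasure_projLaw W μ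
  have h1 : ∫⁻ x, ENNReal.ofReal (p x) ∂vol = 1 := by
    have h2 : projLaw W μ Set.univ = 1 := measure_univ
    rwa [h.projLaw_eq, withDensity_apply _ MeasurableSet.univ, Measure.restrict_univ] at h2
  have h2 : Integrable p vol := by
    refine ⟨h.1.aestronglyMeasurable, ?_⟩
    rw [hasFiniteIntegral_iff_ofReal (ae_of_all _ h.2.1), h1]
    exact ENNReal.one_lt_top
  refine ⟨h2, ?_⟩
  rw [integral_eq_lintegral_of_nonneg_ae (ae_of_all _ h.2.1) h.1.aestronglyMeasurable, h1]
  rfl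

theorem IsDensity.setIntegral_eq [IsProbabilityMeasure μ] {p : W → ℝ} (h : IsDensity vol μ p)
    {B : Set W} (hB : MeasurableSet B) : ∫ x in B, p x ∂vol = (projLaw W μ).real B := by
  rw [integral_eq_lintegral_of_nonneg_ae (ae_of_all _ h.2.1) h.1.aestronglyMeasurable,
    Measure.real, h.projLaw_eq, withDensity_apply _ hB]

theorem IsDensity.tvDist_eq {μ' : Measure (Herm N)} [IsProbabilityMeasure μ]
    [IsProbabilityMeasure μ'] {p q : W → ℝ} (h : IsDensity vol μ p) (h' : IsDensity vol μ' q) :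
    tvDist vol p q = 1 / 2 * ∫ x, |p x - q x| ∂vol :=
  iSup_abs_setIntegral_sub_eq h.1 h'.1 h.integrable.1 h'.integrable.1
    (h.integrable.2.trans h'.integrable.2.symm)

/-- Two densities with respect to any Lebesgue measure differ by at most a multiple of the
`L¹`-distance of the characteristic functions. -/
theorem exists_ae_abs_sub_le (vol : Measure W) [vol.IsAddHaarMeasure] :
    ∃ C : ℝ, 0 ≤ C ∧ ∀ (μ μ' : Measure (Herm N)) (p q : W → ℝ), IsProbabilityMeasure μ →
      IsProbabilityMeasure μ' → IsDensity vol μ p → IsDensity vol μ' q →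
      Integrable (fun x : W => charFun μ (x : Herm N) - charFun μ' x) →
      ∀ᵐ x ∂vol, |p x - q x| ≤ C * ∫ x : W, ‖charFun μ (x : Herm N) - charFun μ' x‖ := by
  set c : NNReal := Measure.addHaarScalarFactor vol volume with hc
  have hc0 : 0 < c := Measure.addHaarScalarFactor_pos_of_isAddHaarMeasure _ _
  have hvol : vol = (c : ℝ≥0∞) • volume := Measure.isAddLeftInvariant_eq_smul _ _
  refine ⟨(c : ℝ)⁻¹ * (2 * Real.pi)⁻¹ ^ Module.finrank ℝ W, by positivity,
    fun μ μ' p q hμ hμ' hp hq hi => ?_⟩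
  have := isProbabilityMeasure_projLaw W μ
  have := isProbabilityMeasure_projLaw W μ'
  have hconv : ∀ (ρ : Measure (Herm N)) (f : W → ℝ), IsDensity vol ρ f →
      projLaw W ρ = volume.withDensity fun x => ENNReal.ofReal (c * f x) := fun ρ f hf => by
    rw [hf.projLaw_eq, hvol, withDensity_smul_measure]
    have : (fun x => ENNReal.ofReal (c * f x)) = (c : ℝ≥0∞) • fun x => ENNReal.ofReal (f x) := by
      ext x
      rw [Pi.smul_apply, smul_eq_mul, ENNReal.ofReal_mul c.coe_nonneg, ENNReal.ofReal_coe_nnreal]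
    rw [this, withDensity_smul _ hf.1.ennreal_ofReal]
  have hcf : ∀ (ρ : Measure (Herm N)) (x : W), charFun (projLaw W ρ) x = charFun ρ (x : Herm N) :=
    fun ρ x => charFun_projLaw W ρ x
  have h := abs_density_sub_le (hp.1.const_mul (c : ℝ)) (hq.1.const_mul (c : ℝ))
    (fun x => mul_nonneg c.coe_nonneg (hp.2.1 x)) (fun x => mul_nonneg c.coe_nonneg (hq.2.1 x))
    (hconv μ p hp) (hconv μ' q hq) (by simpa only [hcf] using hi)
  simp only [hcf] at h
  rw [hvol]
  refine Measure.ae_smul_measure ?_ _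
  filter_upwards [h] with x hx
  have hc1 : (0 : ℝ) < c := hc0
  rw [← mul_sub, abs_mul, abs_of_pos hc1] at hx
  rw [mul_assoc, inv_mul_eq_div, le_div_iff₀ hc1, mul_comm]
  exact hx

/-- The real dimension of the Hermitian matrices is at most `N²`, since a Hermitian matrix is
determined by the sums of the real and imaginary parts of its entries. -/
theorem finrank_le (W : Submodule ℝ (Herm N)) : Module.finrank ℝ W ≤ N ^ 2 := by
  refine (Submodule.finrank_le W).trans ?_
  let f : Herm N →ₗ[ℝ] Matrix (Fin N) (Fin N) ℝ :=
    { toFun := fun S => Matrix.of fun i j =>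
        ((S : Matrix (Fin N) (Fin N) ℂ) i j).re + ((S : Matrix (Fin N) (Fin N) ℂ) i j).im
      map_add' := fun S T => by ext i j; simp; ring
      map_smul' := fun c S => by ext i j; simp; ring }
  have hf : Function.Injective f := by
    rw [injective_iff_map_eq_zero]
    intro S hS
    refine Subtype.ext ?_
    ext i j
    have h1 : ((S : Matrix (Fin N) (Fin N) ℂ) i j).re +
        ((S : Matrix (Fin N) (Fin N) ℂ) i j).im = 0 :=
      congrFun (congrFun hS i) j
    have h2 : ((S : Matrix (Fin N) (Fin N) ℂ) j i).re +
        ((S : Matrix (Fin N) (Fin N) ℂ) j i).im = 0 :=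
      congrFun (congrFun hS j) i
    rw [← star_apply S i j, Complex.conj_re, Complex.conj_im] at h2
    exact Complex.ext (by simp; linarith) (by simp; linarith)
  refine (LinearMap.finrank_le_finrank_of_injective hf).trans ?_
  rw [Module.finrank_matrix]
  simp [sq]

end Densities

/-! ### The standardised sums -/

section Sums

attribute [local instance] hermNormed hermInner

variable {N : ℕ} {W : Submodule ℝ (Herm N)} {H : Measure (Herm N)} {α : ℝ}
  {Ω : Type*} [MeasurableSpace Ω] {P : Measure Ω} {X : ℕ → Ω → Fin N → ℝ} {U : ℕ → Ω → UGroup N}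

/-- For traceless matrices the centring vanishes. -/
theorem tZero_smul_one_mem (hH : IsSpectralMeasure W H) (hW : W = ⊤ ∨ W = Herm₀ N) :
    tZero (eigPart H) • (1 : Herm N) ∈ W := by
  have h := hH.ae_diagMat_mem hW
  rcases hW with rfl | rfl
  · trivial
  · have h0 : tZero (eigPart H) = 0 := by
      rw [tZero, integral_eq_zero_of_ae, mul_zero]
      filter_upwards [h] with r hr
      rw [Herm₀, LinearMap.mem_ker, trForm_eq_sum_diagVec, diagVec_diagMat] at hr
      exact hr
    rw [h0, zero_smul]
    exact Submodule.zero_mem _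

theorem ae_stdSum_mem (hα : 0 < α) (hH : IsSpectralMeasure W H) (hW : W = ⊤ ∨ W = Herm₀ N)
    (hX : ∀ j, Measurable (X j))
    (hlaw : ∀ j, IsStableLaw dotProduct α (eigPart H) (P.map (X j))) (m : ℕ) :
    ∀ᵐ ω ∂P, stdSum α (tZero (eigPart H)) X U m ω ∈ W := by
  filter_upwards [ae_all_iff.2 fun j => ae_summand_mem (U := U j) hα hH hW (hX j) (hlaw j)]
    with ω hω
  rw [stdSum]
  refine W.sub_mem (W.smul_mem _ (W.sum_mem fun j _ => hω j)) ?_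
  split_ifs
  · have : (2 * tZero (eigPart H) * Real.log m / Real.pi) • (1 : Herm N) =
        (2 * Real.log m / Real.pi) • (tZero (eigPart H) • (1 : Herm N)) := by
      rw [smul_smul]; congr 1; ring
    rw [this]
    exact W.smul_mem _ (tZero_smul_one_mem hH hW)
  · rw [zero_smul]; exact W.zero_mem

theorem measurable_stdSum (t₀ : ℝ) (hX : ∀ j, Measurable (X j)) (hU : ∀ j, Measurable (U j))
    (m : ℕ) : Measurable (stdSum α t₀ X U m) := by
  have h := ((Finset.measurable_sum (Finset.range m) fun j _ =>
    measurable_summand (hX j) (hU j)).const_smul ((m : ℝ) ^ (-1 / α))).sub_const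
    ((if α = 1 then 2 * t₀ * Real.log m / Real.pi else 0) • (1 : Herm N))
  exact h

theorem iIndepFun_summand (hindep : iIndepFun (fun j ω => (X j ω, U j ω)) P) :
    iIndepFun (fun j ω => conj (U j ω) (diagMat (X j ω))) P := by
  have h := hindep.comp (fun _ p => conj p.2 (diagMat p.1)) fun _ => measurable_conj_diagMat
  exact h

variable [IsProbabilityMeasure P]

/-- The sum has a density as soon as its last summand has one, by convolution; scaling and centring
preserve null sets. -/
theorem projLaw_stdSum_absolutelyContinuous (hα : 0 < α) (hH : IsSpectralMeasure W H)
    (hW : W = ⊤ ∨ W = Herm₀ N) (vol : Measure W) [vol.IsAddHaarMeasure]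
    (hX : ∀ j, Measurable (X j)) (hU : ∀ j, Measurable (U j))
    (hlaw : ∀ j, IsStableLaw dotProduct α (eigPart H) (P.map (X j)))
    (hUinv : ∀ j, (P.map (U j)).IsMulRightInvariant) (hXU : ∀ j, IndepFun (X j) (U j) P)
    (hindep : iIndepFun (fun j ω => (X j ω, U j ω)) P) (t₀ : ℝ) {m : ℕ} (hm : 1 ≤ m) :
    projLaw W (P.map (stdSum α t₀ X U m)) ≪ vol := by
  have hpm : Measurable W.orthogonalProjectionOnto := ContinuousLinearMap.measurable _
  set Z : ℕ → Ω → W := fun j ω => W.orthogonalProjectionOnto (conj (U j ω) (diagMat (X j ω)))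
    with hZ
  have hZm : ∀ j, Measurable (Z j) := fun j => hpm.comp (measurable_summand (hX j) (hU j))
  have hZi : iIndepFun Z P := by
    have h := (iIndepFun_summand hindep).comp (fun _ => W.orthogonalProjectionOnto) fun _ => hpm
    exact h
  have hZac : ∀ j, P.map (Z j) ≪ vol := fun j => by
    refine Measure.AbsolutelyContinuous.mk fun B hB h0 => ?_
    have := hUinv j
    have h1 := map_summand_eq_zero hα hH hW vol (hX j) (hU j) (hXU j) (hlaw j) (hpm hB) (by
      rw [← h0]
      congr 1
      ext x
      simp only [Set.mem_preimage]
      rw [Submodule.orthogonalProjectionOnto_mem_subspace_eq_self])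
    rw [Measure.map_apply (hZm j) hB]
    rwa [Measure.map_apply (measurable_summand (hX j) (hU j)) (hpm hB)] at h1
  have hsm : ∀ n, Measurable (∑ j ∈ Finset.range n, Z j) := fun n => by
    have h : (∑ j ∈ Finset.range n, Z j) = fun ω => ∑ j ∈ Finset.range n, Z j ω :=
      funext fun ω => Finset.sum_apply _ _ _
    rw [h]
    exact Finset.measurable_fun_sum _ fun j _ => hZm j
  obtain ⟨n, rfl⟩ : ∃ n, m = n + 1 := ⟨m - 1, by omega⟩
  have hsum : P.map (∑ j ∈ Finset.range (n + 1), Z j) ≪ vol := by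
    have : IsProbabilityMeasure (P.map (Z n)) :=
      Measure.isProbabilityMeasure_map (hZm n).aemeasurable
    rw [Finset.sum_range_succ, IndepFun.map_add_eq_map_conv_map (hsm n) (hZm n)
      (hZi.indepFun_sum_range_succ hZm n)]
    exact Measure.conv_absolutelyContinuous (hZac n)
  set ρ : ℝ := ((n + 1 : ℕ) : ℝ) ^ (-1 / α) with hρ
  have hρ0 : ρ ≠ 0 := by positivity
  set b : W := W.orthogonalProjectionOnto
    ((if α = 1 then 2 * t₀ * Real.log (n + 1 : ℕ) / Real.pi else 0) • (1 : Herm N)) with hb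
  have hg1 : Measurable fun x : W => ρ • x := measurable_const_smul ρ
  have hg2 : Measurable fun x : W => x - b := measurable_sub_const b
  have heq : projLaw W (P.map (stdSum α t₀ X U (n + 1))) =
      ((P.map (∑ j ∈ Finset.range (n + 1), Z j)).map fun x => ρ • x).map fun x => x - b := by
    rw [projLaw, Measure.map_map hpm (measurable_stdSum t₀ hX hU _), Measure.map_map hg1 (hsm _),
      Measure.map_map hg2 (hg1.comp (hsm _))]
    congr 1
    funext ω
    simp only [Function.comp_apply, stdSum, map_sub, map_smul, map_sum, Finset.sum_apply,
      hZ, hb, hρ]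
  rw [heq]
  refine ((hsum.map hg1).map hg2).trans ?_
  refine (Measure.AbsolutelyContinuous.map
    (Measure.quasiMeasurePreserving_smul vol hρ0).absolutelyContinuous hg2).trans ?_
  exact (measurePreserving_sub_right vol b).quasiMeasurePreserving.absolutelyContinuous

theorem charFun_map_sum (𝓗 : Measure (UGroup N))
    (hX : ∀ j, Measurable (X j)) (hU : ∀ j, Measurable (U j))
    (hlaw : ∀ j, IsStableLaw dotProduct α (eigPart H) (P.map (X j)))
    (hUlaw : ∀ j, P.map (U j) = 𝓗) (hXU : ∀ j, IndepFun (X j) (U j) P)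
    (hindep : iIndepFun (fun j ω => (X j ω, U j ω)) P) (m : ℕ) (S : Herm N) :
    charFun (P.map fun ω => ∑ j ∈ Finset.range m, conj (U j ω) (diagMat (X j ω))) S =
      haarChar 𝓗 α H S ^ m := by
  have h := iIndepFun.charFun_map_fun_sum_eq_prod (P := P)
    (X := fun (j : Fin m) ω => conj (U j ω) (diagMat (X j ω)))
    (fun j => (measurable_summand (hX j) (hU j)).aemeasurable)
    ((iIndepFun_summand hindep).precomp (g := fun j : Fin m => (j : ℕ)) Fin.val_injective)
  simp only [Finset.sum_range]
  rw [h, Finset.prod_apply]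
  simp only [charFun_summand (hX _) (hU _) (hXU _) (hlaw _), hUlaw]
  simp

theorem charFun_stdSum (𝓗 : Measure (UGroup N))
    (hX : ∀ j, Measurable (X j)) (hU : ∀ j, Measurable (U j))
    (hlaw : ∀ j, IsStableLaw dotProduct α (eigPart H) (P.map (X j)))
    (hUlaw : ∀ j, P.map (U j) = 𝓗) (hXU : ∀ j, IndepFun (X j) (U j) P)
    (hindep : iIndepFun (fun j ω => (X j ω, U j ω)) P) (t₀ : ℝ) (m : ℕ) (S : Herm N) :
    charFun (P.map (stdSum α t₀ X U m)) S = Complex.exp (-(Complex.I *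
      ((if α = 1 then 2 * t₀ * Real.log m / Real.pi else 0) * trForm N S : ℝ))) *
        haarChar 𝓗 α H ((m : ℝ) ^ (-1 / α) • S) ^ m := by
  have hm : Measurable fun ω => ∑ j ∈ Finset.range m, conj (U j ω) (diagMat (X j ω)) :=
    Finset.measurable_fun_sum _ fun j _ => measurable_summand (hX j) (hU j)
  rw [← charFun_map_sum 𝓗 hX hU hlaw hUlaw hXU hindep, charFun_eq_integral_trPair,
    charFun_eq_integral_trPair,
    integral_map (measurable_stdSum t₀ hX hU m).aemeasurable
      (measurable_exp_trPair S).aestronglyMeasurable,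
    integral_map hm.aemeasurable (measurable_exp_trPair _).aestronglyMeasurable,
    ← integral_const_mul]
  refine integral_congr_ae (ae_of_all _ fun ω => ?_)
  simp only
  set T := ∑ j ∈ Finset.range m, conj (U j ω) (diagMat (X j ω)) with hT
  have h1 : trPair S (stdSum α t₀ X U m ω) = trPair ((m : ℝ) ^ (-1 / α) • S) T -
      (if α = 1 then 2 * t₀ * Real.log m / Real.pi else 0) * trForm N S := by
    rw [stdSum, ← hT, trForm_eq_trPair_one]
    simp only [← inner_eq_trPair]
    rw [inner_sub_right, inner_smul_right, inner_smul_right, real_inner_smul_left]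
  rw [h1, ← Complex.exp_add]
  congr 1
  push_cast
  ring

/-- The logarithmic centring cancels the phase of the limit, so that only the powers of the
characteristic functions of single summands have to be compared. -/
theorem norm_charFun_stdSum_sub (𝓗 : Measure (UGroup N)) [IsProbabilityMeasure 𝓗]
    [𝓗.IsMulRightInvariant] (hα : 0 < α) (hH : IsSpectralMeasure W H)
    (hX : ∀ j, Measurable (X j)) (hU : ∀ j, Measurable (U j))
    (hlaw : ∀ j, IsStableLaw dotProduct α (eigPart H) (P.map (X j)))
    (hUlaw : ∀ j, P.map (U j) = 𝓗) (hXU : ∀ j, IndepFun (X j) (U j) P)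
    (hindep : iIndepFun (fun j ω => (X j ω, U j ω)) P)
    {μ : Measure (Herm N)} (hμ : IsStableLaw trPair α H μ) {m : ℕ} (hm : 1 ≤ m) (S : Herm N) :
    ‖charFun (P.map (stdSum α (tZero (eigPart H)) X U m)) S - charFun μ S‖ =
      ‖haarChar 𝓗 α H ((m : ℝ) ^ (-1 / α) • S) ^ m -
        Complex.exp (-matExponent α H ((m : ℝ) ^ (-1 / α) • S)) ^ m‖ := by
  have := hH.isProbabilityMeasure
  have hm0 : (0 : ℝ) < m := by exact_mod_cast hm
  set ρ : ℝ := (m : ℝ) ^ (-1 / α) with hρ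
  have hρ0 : 0 < ρ := Real.rpow_pos_of_pos hm0 _
  set t₀ := tZero (eigPart H)
  set θ : ℝ := (if α = 1 then 2 * t₀ * Real.log m / Real.pi else 0) * trForm N S with hθ
  have hρα : ρ ^ α = (m : ℝ)⁻¹ := by
    rw [hρ, ← Real.rpow_mul hm0.le, div_mul_cancel₀ _ hα.ne', Real.rpow_neg_one]
  have hshift : m * (logShift α ρ * (t₀ * trForm N S)) = -θ := by
    rw [hθ, logShift]
    split_ifs with h1
    · have h2 : Real.log ρ = -Real.log m := by
        rw [hρ, Real.log_rpow hm0, h1]; ring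
      have h3 : ρ = (m : ℝ)⁻¹ := by rw [← hρα, h1, Real.rpow_one]
      rw [h2, h3]
      field_simp
    · ring
  have hlim : charFun μ S = Complex.exp (-(Complex.I * θ)) *
      Complex.exp (-matExponent α H (ρ • S)) ^ m := by
    rw [charFun_of_isStableLaw hμ, ← Complex.exp_nat_mul, ← Complex.exp_add,
      matExponent_smul 𝓗 hα hH.ae_trPair_self hρ0 hH.invariant, hρα]
    congr 1
    have h4 : (m : ℂ) * ((logShift α ρ * (t₀ * trForm N S) : ℝ) : ℂ) = -(θ : ℂ) := by
      rw [← Complex.ofReal_neg, ← hshift]; push_cast; ring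
    have h5 : (m : ℂ) * (((m : ℝ)⁻¹ : ℝ) : ℂ) = 1 := by
      rw [← Complex.ofReal_natCast, ← Complex.ofReal_mul, mul_inv_cancel₀ hm0.ne',
        Complex.ofReal_one]
    linear_combination (matExponent α H S) * h5 + Complex.I * h4
  rw [charFun_stdSum 𝓗 hX hU hlaw hUlaw hXU hindep, hlim, ← mul_sub, norm_mul]
  have : ‖Complex.exp (-(Complex.I * (θ : ℂ)))‖ = 1 := by rw [Complex.norm_exp]; simp
  rw [this, one_mul]

end Sums

/-! ### The rate of convergence -/

section Rate

attribute [local instance] hermNormed hermInner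

variable {N : ℕ} {W : Submodule ℝ (Herm N)} {H : Measure (Herm N)} {α : ℝ}
  {Ω : Type*} [MeasurableSpace Ω] {P : Measure Ω} [IsProbabilityMeasure P]
  {X : ℕ → Ω → Fin N → ℝ} {U : ℕ → Ω → UGroup N}

/-- The characteristic functions of the standardised sums converge in `L¹(W)` at rate `1 / m`. -/
theorem exists_integral_norm_charFun_sub_le (𝓗 : Measure (UGroup N)) [IsProbabilityMeasure 𝓗]
    [𝓗.IsMulRightInvariant] (hN : 0 < N) (hα : 0 < α) (hW : W = ⊤ ∨ W = Herm₀ N)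
    (hH : IsSpectralMeasure W H)
    (hX : ∀ j, Measurable (X j)) (hU : ∀ j, Measurable (U j))
    (hlaw : ∀ j, IsStableLaw dotProduct α (eigPart H) (P.map (X j)))
    (hUlaw : ∀ j, P.map (U j) = 𝓗) (hXU : ∀ j, IndepFun (X j) (U j) P)
    (hindep : iIndepFun (fun j ω => (X j ω, U j ω)) P)
    {μ : Measure (Herm N)} (hμ : IsStableLaw trPair α H μ) :
    ∃ K : ℝ, 0 ≤ K ∧ ∃ m₀ : ℕ, 1 ≤ m₀ ∧ ∀ m : ℕ, m₀ ≤ m →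
      Integrable (fun S : W => charFun (P.map (stdSum α (tZero (eigPart H)) X U m)) (S : Herm N) -
        charFun μ (S : Herm N)) ∧
      ∫ S : W, ‖charFun (P.map (stdSum α (tZero (eigPart H)) X U m)) (S : Herm N) -
        charFun μ (S : Herm N)‖ ≤ K / m := by
  have := hH.isProbabilityMeasure
  have := hμ.1
  obtain ⟨C₁, hC₁, h1⟩ := exists_norm_haarChar_sub_le 𝓗 hα hH.ae_trPair_self hH.invariant
  obtain ⟨c, hc, h2, h4, h3⟩ := exists_norm_haarChar_le_exp 𝓗 hα hH
  obtain ⟨C₂, hC₂, h5⟩ := exists_norm_haarChar_le_rpow 𝓗 hα hN hH hW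
  obtain ⟨K, hK, m₀, hm₀, h⟩ := exists_integral_norm_pow_sub_pow_le (E := W)
    (ψ := fun s => haarChar 𝓗 α H (s : Herm N))
    (Φ := fun s => Complex.exp (-matExponent α H (s : Herm N))) (C := max C₁ C₂) hα hc
    (hC₁.trans (le_max_left _ _))
    ((measurable_haarChar 𝓗).comp measurable_subtype_coe)
    ((measurable_matExponent.neg.cexp).comp measurable_subtype_coe)
    (fun s hs => (h1 s hs).trans (by
      rw [Submodule.coe_norm]; gcongr; exact le_max_left _ _))
    (fun s hs => h2 s s.2 hs) (fun s => h3 s s.2) (fun s hs => h4 s s.2 hs)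
    (fun s hs => (h5 s s.2 hs).trans (by
      rw [Submodule.coe_norm]; gcongr; exact le_max_right _ _))
  refine ⟨K, hK, m₀, hm₀, fun m hm => ?_⟩
  have heq := fun S : W => norm_charFun_stdSum_sub 𝓗 hα hH hX hU hlaw hUlaw hXU hindep hμ
    (hm₀.trans hm) (S : Herm N)
  have hp : IsProbabilityMeasure (P.map (stdSum α (tZero (eigPart H)) X U m)) :=
    Measure.isProbabilityMeasure_map (measurable_stdSum _ hX hU m).aemeasurable
  obtain ⟨hi, hle⟩ := h m hm
  simp only [Submodule.coe_smul] at hi hle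
  constructor
  · refine (integrable_norm_iff ?_).1 ?_
    · exact ((measurable_charFun.sub measurable_charFun).comp
        measurable_subtype_coe).aestronglyMeasurable
    · simpa only [heq] using hi
  · simpa only [heq] using hle

/-- Inside a ball of radius `R = m^{1/(N²+α)}` the densities differ by `O(1 / m)`, outside the
limit has mass `O(R^{-α})`. -/
theorem isBigO_tvDist (𝓗 : Measure (UGroup N)) [IsProbabilityMeasure 𝓗]
    [𝓗.IsMulRightInvariant] (hN : 0 < N) (hα : 0 < α) (hW : W = ⊤ ∨ W = Herm₀ N)
    (hH : IsSpectralMeasure W H) (vol : Measure W) [vol.IsAddHaarMeasure]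
    (hX : ∀ j, Measurable (X j)) (hU : ∀ j, Measurable (U j))
    (hlaw : ∀ j, IsStableLaw dotProduct α (eigPart H) (P.map (X j)))
    (hUlaw : ∀ j, P.map (U j) = 𝓗) (hXU : ∀ j, IndepFun (X j) (U j) P)
    (hindep : iIndepFun (fun j ω => (X j ω, U j ω)) P)
    {μ : Measure (Herm N)} (hμ : IsStableLaw trPair α H μ) {p : ℕ → W → ℝ} {q : W → ℝ}
    (hp : ∀ m : ℕ, 1 ≤ m → IsDensity vol (P.map (stdSum α (tZero (eigPart H)) X U m)) (p m))
    (hq : IsDensity vol μ q) :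
    (fun m : ℕ => tvDist vol (p m) q)
      =O[atTop] (fun m : ℕ => (m : ℝ) ^ (-α / ((N : ℝ) ^ 2 + α))) := by
  have := hH.isProbabilityMeasure
  have := hμ.1
  have hPp : ∀ m, IsProbabilityMeasure (P.map (stdSum α (tZero (eigPart H)) X U m)) := fun m =>
    Measure.isProbabilityMeasure_map (measurable_stdSum _ hX hU m).aemeasurable
  have := isProbabilityMeasure_projLaw W μ
  obtain ⟨K, hK, m₀, hm₀, hcf⟩ := exists_integral_norm_charFun_sub_le 𝓗 hN hα hW hH hX hU hlaw
    hUlaw hXU hindep hμ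
  obtain ⟨C, hC, hdens⟩ := exists_ae_abs_sub_le vol
  obtain ⟨D, hD, hD'⟩ := exists_one_sub_re_exp_matExponent_le 𝓗 hα hH.ae_trPair_self hH.invariant
  obtain ⟨T, hT, htail⟩ := exists_tail_le (μ := projLaw W μ) hα hD (fun s => by
    have h := hD' (s : Herm N)
    rw [← charFun_of_isStableLaw hμ, ← charFun_projLaw] at h
    exact h)
  set V := vol.real (Metric.ball (0 : W) 1) with hV
  have hV0 : 0 ≤ V := measureReal_nonneg
  refine Asymptotics.IsBigO.of_bound (C * K * V + T) ?_
  filter_upwards [eventually_ge_atTop m₀] with m hm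
  have hm1 : (1 : ℝ) ≤ m := by exact_mod_cast hm₀.trans hm
  have hm0 : (0 : ℝ) < m := by linarith
  have hpm := hp m (hm₀.trans hm)
  obtain ⟨hi, hle⟩ := hcf m hm
  -- the radius balances the volume of the ball against the tail of the limit law
  set R : ℝ := (m : ℝ) ^ (1 / ((N : ℝ) ^ 2 + α)) with hR
  have hden : (0 : ℝ) < (N : ℝ) ^ 2 + α := by positivity
  have hR1 : 1 ≤ R := Real.one_le_rpow hm1 (by positivity)
  have hR0 : 0 < R := by linarith
  have hbound : ∀ᵐ x ∂vol, |p m x - q x| ≤ C * (K / m) := by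
    filter_upwards [hdens _ μ (p m) q inferInstance inferInstance hpm hq hi] with x hx
    exact hx.trans (by gcongr)
  have h1 := half_integral_abs_sub_le hpm.2.1 hq.2.1 hpm.integrable.1 hq.integrable.1
    (hpm.integrable.2.trans hq.integrable.2.symm) hbound
    (Metric.isClosed_closedBall (x := (0 : W)) (ε := R)).measurableSet
    (isCompact_closedBall (0 : W) R).measure_lt_top.ne
  have h2 : vol.real (Metric.closedBall (0 : W) R) ≤ R ^ (N ^ 2) * V := by
    rw [Measure.addHaar_real_closedBall vol _ hR0.le]
    gcongr
    exact finrank_le W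
  have h3 : ∫ x in (Metric.closedBall (0 : W) R)ᶜ, q x ∂vol ≤ T * R ^ (-α) := by
    rw [hq.setIntegral_eq (Metric.isClosed_closedBall).measurableSet.compl]
    have hset : (Metric.closedBall (0 : W) R)ᶜ = {x | R < ‖x‖} := by ext x; simp
    rw [hset]
    exact htail R hR0
  have h4 : (m : ℝ)⁻¹ * R ^ (N ^ 2) = (m : ℝ) ^ (-α / ((N : ℝ) ^ 2 + α)) := by
    rw [hR, ← Real.rpow_natCast, ← Real.rpow_mul hm0.le, ← Real.rpow_neg_one,
      ← Real.rpow_add hm0]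
    congr 1
    push_cast
    field_simp
    ring
  have h5 : R ^ (-α) = (m : ℝ) ^ (-α / ((N : ℝ) ^ 2 + α)) := by
    rw [hR, ← Real.rpow_mul hm0.le]
    congr 1
    ring
  rw [hpm.tvDist_eq hq, Real.norm_of_nonneg (by positivity), Real.norm_of_nonneg (by positivity)]
  calc 1 / 2 * ∫ x, |p m x - q x| ∂vol
      ≤ C * (K / m) * vol.real (Metric.closedBall (0 : W) R) +
        ∫ x in (Metric.closedBall (0 : W) R)ᶜ, q x ∂vol := h1
    _ ≤ C * (K / m) * (R ^ (N ^ 2) * V) + T * R ^ (-α) := by gcongr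
    _ = C * K * V * ((m : ℝ)⁻¹ * R ^ (N ^ 2)) + T * R ^ (-α) := by ring
    _ = (C * K * V + T) * (m : ℝ) ^ (-α / ((N : ℝ) ^ 2 + α)) := by rw [h4, h5]; ring

end Rate

end StableEnsemble

end

theorem corollary3
    {N : ℕ} (hN : 2 ≤ N)
    {α : ℝ} (hα0 : 0 < α) (hα2 : α ≤ 2)
    -- the space `W` of all, respectively of all traceless, Hermitian matrices,
    -- with a Lebesgue measure (any translation invariant normalisation)
    (W : Submodule ℝ (StableEnsemble.Herm N)) (hW : W = ⊤ ∨ W = StableEnsemble.Herm₀ N)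
    (vol : Measure W) [vol.IsAddHaarMeasure]
    -- the spectral measure
    (H : Measure (StableEnsemble.Herm N)) (hH : StableEnsemble.IsSpectralMeasure W H)
    -- i.i.d. stable vectors and i.i.d. Haar unitaries, all independent
    {Ω : Type*} [MeasurableSpace Ω] (P : Measure Ω) [IsProbabilityMeasure P]
    (X : ℕ → Ω → Fin N → ℝ) (U : ℕ → Ω → StableEnsemble.UGroup N)
    (hXmeas : ∀ j, Measurable (X j)) (hUmeas : ∀ j, Measurable (U j))
    (hXlaw : ∀ j, StableEnsemble.IsStableLaw dotProduct α (StableEnsemble.eigPart H)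
      (P.map (X j)))
    (hUlaw : ∀ j, (P.map (U j)).IsHaarMeasure)
    (hXU : ∀ j, IndepFun (X j) (U j) P)
    (hindep : iIndepFun (fun j ω => (X j ω, U j ω)) P)
    -- the law `S(α, H, 0)` on Hermitian matrices
    (μinf : Measure (StableEnsemble.Herm N))
    (hY : StableEnsemble.IsStableLaw StableEnsemble.trPair α H μinf) :
    -- the densities exist
    (∀ m : ℕ, 1 ≤ m → ∃ p : W → ℝ, StableEnsemble.IsDensity vol
      (P.map (StableEnsemble.stdSum α (StableEnsemble.tZero (StableEnsemble.eigPart H)) X U m)) p) ∧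
    (∃ q : W → ℝ, StableEnsemble.IsDensity vol μinf q) ∧
    -- and satisfy the rate of convergence
    ∀ (p : ℕ → W → ℝ) (pinf : W → ℝ),
      (∀ m : ℕ, 1 ≤ m → StableEnsemble.IsDensity vol
        (P.map (StableEnsemble.stdSum α (StableEnsemble.tZero (StableEnsemble.eigPart H)) X U m))
        (p m)) →
      StableEnsemble.IsDensity vol μinf pinf →
        (∀ m : ℕ, 1 ≤ m → StableEnsemble.tvDist vol (p m) pinf
          = 1 / 2 * ∫ x, |p m x - pinf x| ∂vol) ∧
        (fun m : ℕ => StableEnsemble.tvDist vol (p m) pinf)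
          =O[atTop] (fun m : ℕ => (m : ℝ) ^ (-α / ((N : ℝ) ^ 2 + α))) := by
  open StableEnsemble in
  have hUm := fun j => Measure.isProbabilityMeasure_map (μ := P) (hUmeas j).aemeasurable
  have hU0 : ∀ j, P.map (U j) = P.map (U 0) := fun j => by
    have := hUlaw j
    have := hUlaw 0
    exact Measure.isHaarMeasure_eq_of_isProbabilityMeasure _ _
  have hUinv : ∀ j, (P.map (U j)).IsMulRightInvariant := fun j => by
    have := hUlaw j
    exact isMulRightInvariant_of_isHaarMeasure _
  have hμ := hY.1
  have hPp : ∀ m, IsProbabilityMeasure (P.map (stdSum α (tZero (eigPart H)) X U m)) := fun m =>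
    Measure.isProbabilityMeasure_map (measurable_stdSum _ hXmeas hUmeas m).aemeasurable
  refine ⟨fun m hm => exists_isDensity ?_ ?_, exists_isDensity ?_ ?_, fun p q hp hq => ⟨?_, ?_⟩⟩
  · refine (ae_map_iff (measurable_stdSum _ hXmeas hUmeas m).aemeasurable
      (Submodule.closed_of_finiteDimensional W).measurableSet).2 ?_
    exact ae_stdSum_mem hα0 hH hW hXmeas hXlaw m
  · exact projLaw_stdSum_absolutelyContinuous hα0 hH hW vol hXmeas hUmeas hXlaw hUinv hXU hindep
      _ hm
  · exact ae_mem_of_isStableLaw hα0 hH hY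
  · exact projLaw_absolutelyContinuous_of_isStableLaw hα0 hH vol hY
  · exact fun m hm => (hp m hm).tvDist_eq hq
  · exact isBigO_tvDist (P.map (U 0)) (by omega) hα0 hW hH vol hXmeas hUmeas hXlaw hU0 hXU hindep
      hY hp hq
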